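/- Let $A=\bigoplus_{m\ge 0}A_m$ be a standard graded domain over a field $A_0=k$ (that is, $A$ is generated over $k$ by the finite-dimensional space $A_1$), of Krull dimension $d\geq 1$, with homogeneous maximal ideal $\mathbf m=\bigoplus_{m\ge 1}A_m$. Let $I\subseteq A$ be a homogeneous ideal and put $\widetilde{I^n}=(I^n:_A\mathbf m^\infty)=\bigcup_{i\ge 0}(I^n:_A\mathbf m^i)$. Suppose that the filtration $\{\widetilde{I^n}\}_{n\in\mathbb N}$ is Noetherian, i.e. there is an integer $m\ge 1$ with $\widetilde{I^n}\cdot\widetilde{I^m}=\widetilde{I^{n+m}}$ for all $n\ge m$. Then the limit $$f_{\varepsilon(I)}(x)=\lim_{n\to\infty}\frac{\ell_k\big((\widetilde{I^n}/I^n)_{\lfloor xn\rfloor}\big)}{n^{d-1}/d!}$$ exists for every real $x\ge 0$, and the function $f_{\varepsilon(I)}$ on $\mathbb R_{\ge 0}$ is piecewise polynomial in the following sense: there are an integer $r\ge 1$, nonnegative rational numbers $a_1<\cdots<a_r$ and polynomials $\mathbf q_1,\ldots,\mathbf q_{r-1}\in\mathbb Q[x]$ of degree at most $d-1$ such that $f_{\varepsilon(I)}(x)=0$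 if $x<a_1$ or $x>a_r$, and $f_{\varepsilon(I)}(x)=\mathbf q_i(x)$ if $a_i<x<a_{i+1}$, for $i=1,\ldots,r-1$. Moreover, the epsilon multiplicity $$\varepsilon(I)=\limsup_{n\to\infty}\frac{\ell_A(\widetilde{I^n}/I^n)}{n^d/d!}$$ is a limit, and it is a (finite) rational number. -/

import Mathlib

open Filter Topology
open scoped ENNReal NNReal Polynomial

noncomputable section

namespace EpsilonDensity

/-- `A = ⨁ 𝒜 m` is a standard graded algebra over the field `𝒜 0 = k`: it is generated over `k` by
the finite-dimensional space `𝒜 1`. -/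
structure IsStandardGraded {k A : Type*} [Field k] [CommRing A] [Algebra k A]
    (𝒜 : ℕ → Submodule k A) [GradedAlgebra 𝒜] : Prop where
  /-- the degree zero part is the image of `k` -/
  zero_eq : 𝒜 0 = (1 : Submodule k A)
  /-- the degree one part is finite-dimensional -/
  finite_one : Module.Finite k (𝒜 1)
  /-- the degree one part generates the algebra -/
  adjoin_one : Algebra.adjoin k (𝒜 1 : Set A) = ⊤

/-- The saturation `I :_A 𝔪^∞ = ⋃ i, (I :_A 𝔪 ^ i)` of an ideal `I` with respect to the homogeneous
maximal ideal `𝔪 = ⨁_{m ≥ 1} 𝒜 m`. -/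
def saturation {k A : Type*} [Field k] [CommRing A] [Algebra k A]
    (𝒜 : ℕ → Submodule k A) [GradedAlgebra 𝒜] (I : Ideal A) : Ideal A :=
  ⨆ i : ℕ, I.colon (((HomogeneousIdeal.irrelevant 𝒜).toIdeal ^ i : Ideal A) : Set A)

/-- A Noetherian filtration of ideals. -/
structure IsNoetherianFiltration {A : Type*} [CommRing A] (F : ℕ → Ideal A) : Prop where
  zero_eq_top : F 0 = ⊤
  succ_le : ∀ n, F (n + 1) ≤ F n
  mul_le : ∀ n m, F n * F m ≤ F (n + m)
  noetherian : ∃ m, 1 ≤ m ∧ ∀ n, m ≤ n → F n * F m = F (n + m)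

/-- The degree `m` part `J_m = J ∩ 𝒜 m` of an ideal `J`, as a `k`-vector space. -/
def gradedPart {k A : Type*} [Field k] [CommRing A] [Algebra k A]
    (𝒜 : ℕ → Submodule k A) (J : Ideal A) (m : ℕ) : Submodule k A :=
  J.restrictScalars k ⊓ 𝒜 m

/-- The length `ℓ_k ((Ĩⁿ / Iⁿ)_m)`, where `Ĩⁿ` is the saturation of `I ^ n`. -/
def gradedLength {k A : Type*} [Field k] [CommRing A] [Algebra k A]
    (𝒜 : ℕ → Submodule k A) [GradedAlgebra 𝒜] (I : Ideal A) (n m : ℕ) : ℕ :=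
  Module.finrank k
    (gradedPart 𝒜 (saturation 𝒜 (I ^ n)) m ⧸
      (gradedPart 𝒜 (I ^ n) m).submoduleOf (gradedPart 𝒜 (saturation 𝒜 (I ^ n)) m))

/-- The sequence `ℓ_k ((Ĩⁿ / Iⁿ)_{⌊x n⌋}) / (n ^ (d - 1) / d!)`. -/
def densitySeq {k A : Type*} [Field k] [CommRing A] [Algebra k A]
    (𝒜 : ℕ → Submodule k A) [GradedAlgebra 𝒜] (d : ℕ) (I : Ideal A) (x : ℝ≥0) (n : ℕ) : ℝ :=
  (gradedLength 𝒜 I n ⌊x * n⌋₊ : ℝ) / ((n : ℝ) ^ (d - 1) / (d.factorial : ℝ))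

/-- The `ε`-density function `f_{ε(I)} : ℝ≥0 → ℝ`, the pointwise limit of `densitySeq`. -/
def epsilonDensity {k A : Type*} [Field k] [CommRing A] [Algebra k A]
    (𝒜 : ℕ → Submodule k A) [GradedAlgebra 𝒜] (d : ℕ) (I : Ideal A) (x : ℝ≥0) : ℝ :=
  limUnder atTop (densitySeq 𝒜 d I x)

/-- The sequence `ℓ_A (Ĩⁿ / Iⁿ) / (n ^ d / d!)` in `[0, ∞]`, where `Ĩⁿ / Iⁿ = H⁰_𝔪 (A / Iⁿ)`. -/
def epsilonSeq {k A : Type*} [Field k] [CommRing A] [Algebra k A]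
    (𝒜 : ℕ → Submodule k A) [GradedAlgebra 𝒜] (d : ℕ) (I : Ideal A) (n : ℕ) : ℝ≥0∞ :=
  ((Module.length A
      (saturation 𝒜 (I ^ n) ⧸ (I ^ n).submoduleOf (saturation 𝒜 (I ^ n))) : ℕ∞) : ℝ≥0∞) /
    ((n : ℝ≥0∞) ^ d / (d.factorial : ℝ≥0∞))

/-- The epsilon multiplicity `ε(I)`, an element of `[0, ∞]`. -/
def epsilonMultiplicity {k A : Type*} [Field k] [CommRing A] [Algebra k A]
    (𝒜 : ℕ → Submodule k A) [GradedAlgebra 𝒜] (d : ℕ) (I : Ideal A) : ℝ≥0∞ :=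
  limsup (epsilonSeq 𝒜 d I) atTop

end EpsilonDensity

end

/-! Write `F n` for the saturation of `I ^ n`. The length of `(F n / I ^ n)_m` is `dim (F n)_m - dim
(I ^ n)_m`. A Noetherian filtration satisfies `F (q r) = (F q) ^ r` for some `q` and all `r ≥ 1`, so
what is needed are the Hilbert functions of the powers of one homogeneous ideal `J`.

The degree `m` part of `J ^ n` is spanned by the monomials of bidegree `(n, m)` in variables of
bidegree `(0, 1)` (linear forms) and `(1, e)` (generators of `J`). Its dimension counts the
exponents whose monomial is not a combination of lexicographically smaller ones; these exponents
form a lower set. Lower sets of `ℕ^N` satisfy the descending chain condition, so slicing along one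
variable at a time writes `(1 - s)⁻¹` times the generating function as a finite sum of terms `t^a
s^b (1 - s)^(-p-1) ∏ (1 - s^d t)⁻¹` (`C_mk_one_mul_bidegreeSeries_mem`). Partial fractions reduce
each product to powers of a single `(1 - s^d t)⁻¹`, whose coefficients along `m ~ x n` are
asymptotically `0` for `x < d` and polynomial in `x` for `x > d`
(`piecewiseDensity_partitionSeries`). The factor `(1 - s)⁻¹`, that is, the passage to cumulative
sums in `m`, suppresses periodic oscillation. Since multiplication by a nonzero linear form is
injective, Hilbert functions are nondecreasing in `m`, and the cumulative density may be
differentiated (`PiecewiseDensity.of_cumulative`).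

The limit must also exist at the cut points. Let `e` be the initial degree of `J`. Below slope `e`
everything vanishes. Above it, multiplication by a form of degree `e` in `J` gives a second
monotonicity that excludes jumps (`PiecewiseDensity.exists_hasDensity`). At slope `e`, the graded
part of `J ^ n` is `J_e ^ n`, which is again a span of monomials. For `F` at its lowest slope,
saturatedness makes the dimension one order smaller than maximal
(`IsSaturatedFiltration.mul_dimPart_le`), unless `F` is trivial.

Finally `F n` and `I ^ n` agree in degrees at least `c n`. Hence the density has bounded support,
and the total length is a cumulative sum whose density at a large integer slope is a rational
number. -/

namespace EpsilonDensity

/-! ### Limits along a slope and piecewise polynomial densities. -/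

section Density

/-- The filter of pairs `(n, m)` with `n → ∞` and `m / n → x`. -/
noncomputable def slopeFilter (x : ℝ) : Filter (ℕ × ℕ) :=
  comap Prod.fst atTop ⊓ comap (fun p : ℕ × ℕ => (p.2 : ℝ) / p.1) (𝓝 x)

/-- `g (n, m) / n ^ D` tends to `l` when `n → ∞` and `m / n → x`. -/
def HasDensity (g : ℕ × ℕ → ℝ) (D : ℕ) (x l : ℝ) : Prop :=
  Tendsto (fun p : ℕ × ℕ => g p / (p.1 : ℝ) ^ D) (slopeFilter x) (𝓝 l)

/-- The function `x ↦ ∑_{a < x} Q_a(x)`. -/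
noncomputable def cutEval (Q : ℚ →₀ ℚ[X]) (x : ℝ) : ℝ :=
  Q.sum fun a q => if (a : ℝ) < x then Polynomial.aeval x q else 0

/-- `g` has a piecewise polynomial density of order `D`. -/
def PiecewiseDensity (g : ℕ × ℕ → ℝ) (D : ℕ) : Prop :=
  ∃ (E : Finset ℚ) (Q : ℚ →₀ ℚ[X]), Q.support ⊆ E ∧ (∀ a ∈ E, 0 ≤ a) ∧
    (∀ a, (Q a).natDegree ≤ D) ∧
    ∀ x : ℝ, 0 < x → (∀ a ∈ E, (a : ℝ) ≠ x) → HasDensity g D x (cutEval Q x)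

lemma cutEval_zero (x : ℝ) : cutEval 0 x = 0 := by simp [cutEval]

lemma cutEval_add (P Q : ℚ →₀ ℚ[X]) (x : ℝ) :
    cutEval (P + Q) x = cutEval P x + cutEval Q x := by
  unfold cutEval
  apply Finsupp.sum_add_index'
  · intro a; simp
  · intro a p q; split_ifs <;> simp

lemma cutEval_neg (Q : ℚ →₀ ℚ[X]) (x : ℝ) : cutEval (-Q) x = - cutEval Q x := by
  have := cutEval_add Q (-Q) x
  rw [add_neg_cancel, cutEval_zero] at this
  linarith

lemma cutEval_single (a : ℚ) (q : ℚ[X]) (x : ℝ) :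
    cutEval (Finsupp.single a q) x = if (a : ℝ) < x then Polynomial.aeval x q else 0 := by
  unfold cutEval
  rw [Finsupp.sum_single_index]
  simp

lemma tendsto_fst_slopeFilter (x : ℝ) : Tendsto Prod.fst (slopeFilter x) atTop :=
  tendsto_comap.mono_left inf_le_left

lemma tendsto_fst_real_slopeFilter (x : ℝ) :
    Tendsto (fun p : ℕ × ℕ => (p.1 : ℝ)) (slopeFilter x) atTop :=
  tendsto_natCast_atTop_atTop.comp (tendsto_fst_slopeFilter x)

lemma tendsto_div_slopeFilter (x : ℝ) :
    Tendsto (fun p : ℕ × ℕ => (p.2 : ℝ) / p.1) (slopeFilter x) (𝓝 x) :=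
  tendsto_comap.mono_left inf_le_right

lemma tendsto_slopeFilter {α : Type*} {l : Filter α} {f : α → ℕ × ℕ} {x : ℝ}
    (h1 : Tendsto (fun a => (f a).1) l atTop)
    (h2 : Tendsto (fun a => ((f a).2 : ℝ) / (f a).1) l (𝓝 x)) : Tendsto f l (slopeFilter x) :=
  tendsto_inf.2 ⟨tendsto_comap_iff.2 h1, tendsto_comap_iff.2 h2⟩

lemma eventually_fst_pos (x : ℝ) : ∀ᶠ p in slopeFilter x, 0 < p.1 :=
  (tendsto_fst_slopeFilter x).eventually (eventually_gt_atTop 0)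

/-- If `c < x` then eventually `c n < m` along the slope `x`. -/
lemma eventually_mul_lt {c x : ℝ} (h : c < x) :
    ∀ᶠ p in slopeFilter x, c * (p.1 : ℝ) < p.2 := by
  filter_upwards [eventually_fst_pos x, (tendsto_div_slopeFilter x).eventually (lt_mem_nhds h)]
    with p hp h2
  have : (0 : ℝ) < p.1 := by exact_mod_cast hp
  rwa [lt_div_iff₀ this] at h2

lemma eventually_lt_mul {c x : ℝ} (h : x < c) :
    ∀ᶠ p in slopeFilter x, (p.2 : ℝ) < c * (p.1 : ℝ) := by
  filter_upwards [eventually_fst_pos x, (tendsto_div_slopeFilter x).eventually (gt_mem_nhds h)]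
    with p hp h2
  have : (0 : ℝ) < p.1 := by exact_mod_cast hp
  rwa [div_lt_iff₀ this] at h2

lemma tendsto_snd_slopeFilter {x : ℝ} (hx : 0 < x) : Tendsto Prod.snd (slopeFilter x) atTop := by
  rw [← tendsto_natCast_atTop_iff (R := ℝ)]
  have h := ((tendsto_fst_real_slopeFilter x).const_mul_atTop (half_pos hx))
  refine tendsto_atTop_mono' _ ?_ h
  filter_upwards [eventually_mul_lt (half_lt_self hx)] with p hp using hp.le

lemma slopeFilter_neBot {x : ℝ} (hx : 0 ≤ x) : (slopeFilter x).NeBot := by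
  have : Tendsto (fun n : ℕ => (n, ⌊x * n⌋₊)) atTop (slopeFilter x) := by
    apply tendsto_slopeFilter tendsto_id
    exact (tendsto_nat_floor_mul_div_atTop hx).comp tendsto_natCast_atTop_atTop
  exact this.neBot

lemma tendsto_floor_slopeFilter {x : ℝ} (hx : 0 ≤ x) :
    Tendsto (fun n : ℕ => (n, ⌊x * n⌋₊)) atTop (slopeFilter x) :=
  tendsto_slopeFilter tendsto_id
    ((tendsto_nat_floor_mul_div_atTop hx).comp tendsto_natCast_atTop_atTop)

lemma tendsto_slopeFilter_sub (a b : ℕ) {x : ℝ} (hx : 0 < x) :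
    Tendsto (fun p : ℕ × ℕ => (p.1 - a, p.2 - b)) (slopeFilter x) (slopeFilter x) := by
  have hn : Tendsto (fun p : ℕ × ℕ => p.1 - a) (slopeFilter x) atTop :=
    (tendsto_sub_atTop_nat a).comp (tendsto_fst_slopeFilter x)
  refine tendsto_slopeFilter hn ?_
  have h1 := (tendsto_fst_real_slopeFilter x)
  have h2 : Tendsto (fun p : ℕ × ℕ => (((p.2 : ℝ) / p.1) - b / p.1) / (1 - a / p.1))
      (slopeFilter x) (𝓝 ((x - 0) / (1 - 0))) := by
    refine Tendsto.div ((tendsto_div_slopeFilter x).sub (h1.const_div_atTop _))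
      (tendsto_const_nhds.sub (h1.const_div_atTop _)) (by norm_num)
  simp only [sub_zero, div_one] at h2
  refine h2.congr' ?_
  filter_upwards [(tendsto_fst_slopeFilter x).eventually (eventually_gt_atTop a),
    (tendsto_snd_slopeFilter hx).eventually (eventually_gt_atTop b)] with p hp hq
  have h3 : (0 : ℝ) < p.1 := by exact_mod_cast (Nat.zero_le _).trans_lt hp
  have h4 : (0 : ℝ) < p.1 - a := by rw [sub_pos]; exact_mod_cast hp
  rw [Nat.cast_sub hp.le, Nat.cast_sub hq.le]
  field_simp

lemma HasDensity.add {f g : ℕ × ℕ → ℝ} {D : ℕ} {x l l' : ℝ} (hf : HasDensity f D x l)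
    (hg : HasDensity g D x l') : HasDensity (fun p => f p + g p) D x (l + l') := by
  unfold HasDensity at *
  simpa [add_div] using Tendsto.add hf hg

/-- A bounded translation changes neither the slope nor the leading term. The value `0` outside the
quadrant is what multiplication of a power series by a monomial produces. -/
lemma HasDensity.shift {g : ℕ × ℕ → ℝ} {D : ℕ} {x l : ℝ} (hx : 0 < x) (hg : HasDensity g D x l)
    (a b : ℕ) :
    HasDensity (fun p => if a ≤ p.1 ∧ b ≤ p.2 then g (p.1 - a, p.2 - b) else 0) D x l := by
  unfold HasDensity at *
  have h := hg.comp (tendsto_slopeFilter_sub a b hx)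
  have h1 := (tendsto_fst_real_slopeFilter x)
  have h2 : Tendsto (fun p : ℕ × ℕ => (1 - (a : ℝ) / p.1) ^ D) (slopeFilter x)
      (𝓝 ((1 - 0) ^ D)) := (tendsto_const_nhds.sub (h1.const_div_atTop _)).pow D
  have h3 := h.mul h2
  simp only [sub_zero, one_pow, mul_one] at h3
  refine h3.congr' ?_
  filter_upwards [(tendsto_fst_slopeFilter x).eventually (eventually_gt_atTop a),
    (tendsto_snd_slopeFilter hx).eventually (eventually_gt_atTop b)] with p hp hq
  have h3 : (0 : ℝ) < p.1 := by exact_mod_cast (Nat.zero_le _).trans_lt hp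
  have h4 : (0 : ℝ) < p.1 - a := by rw [sub_pos]; exact_mod_cast hp
  rw [if_pos ⟨hp.le, hq.le⟩]
  simp only [Function.comp]
  rw [Nat.cast_sub hp.le, one_sub_div h3.ne', div_pow]
  field_simp

/-- A function with a density of order `D` has density zero in every larger order. -/
lemma HasDensity.of_lt {g : ℕ × ℕ → ℝ} {D D' : ℕ} {x l : ℝ} (hg : HasDensity g D x l)
    (h : D < D') : HasDensity g D' x 0 := by
  unfold HasDensity at *
  have h1 : Tendsto (fun p : ℕ × ℕ => ((p.1 : ℝ) ^ (D' - D))⁻¹) (slopeFilter x) (𝓝 0) :=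
    ((tendsto_pow_atTop (by omega)).comp (tendsto_fst_real_slopeFilter x)).inv_tendsto_atTop
  have h2 := hg.mul h1
  rw [mul_zero] at h2
  refine h2.congr' ?_
  filter_upwards [eventually_fst_pos x] with p hp
  have h3 : (0 : ℝ) < p.1 := by exact_mod_cast hp
  have : (p.1 : ℝ) ^ D' = p.1 ^ D * p.1 ^ (D' - D) := by rw [← pow_add]; congr 1; omega
  rw [this]
  field_simp

lemma PiecewiseDensity.add {f g : ℕ × ℕ → ℝ} {D : ℕ} (hf : PiecewiseDensity f D)
    (hg : PiecewiseDensity g D) : PiecewiseDensity (fun p => f p + g p) D := by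
  classical
  obtain ⟨E, Q, h1, h2, h3, h4⟩ := hf
  obtain ⟨E', Q', h1', h2', h3', h4'⟩ := hg
  refine ⟨E ∪ E', Q + Q', Finsupp.support_add.trans (Finset.union_subset_union h1 h1'), ?_, ?_, ?_⟩
  · intro a ha
    rcases Finset.mem_union.1 ha with h | h
    exacts [h2 a h, h2' a h]
  · intro a
    exact (Polynomial.natDegree_add_le _ _).trans (max_le (h3 a) (h3' a))
  · intro x hx hxE
    rw [cutEval_add]
    exact (h4 x hx fun a ha => hxE a (Finset.mem_union_left _ ha)).add
      (h4' x hx fun a ha => hxE a (Finset.mem_union_right _ ha))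

lemma PiecewiseDensity.neg {g : ℕ × ℕ → ℝ} {D : ℕ}
    (hg : PiecewiseDensity g D) : PiecewiseDensity (fun p => - g p) D := by
  obtain ⟨E, Q, h1, h2, h3, h4⟩ := hg
  refine ⟨E, -Q, by rwa [Finsupp.support_neg], h2, by simpa using h3, ?_⟩
  intro x hx hxE
  rw [cutEval_neg]
  have := Tendsto.neg (h4 x hx hxE)
  unfold HasDensity
  simpa [neg_div] using this

lemma PiecewiseDensity.sub {f g : ℕ × ℕ → ℝ} {D : ℕ} (hf : PiecewiseDensity f D)
    (hg : PiecewiseDensity g D) : PiecewiseDensity (fun p => f p - g p) D := by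
  simpa [sub_eq_add_neg] using hf.add hg.neg

lemma PiecewiseDensity.shift {g : ℕ × ℕ → ℝ} {D : ℕ}
    (hg : PiecewiseDensity g D) (a b : ℕ) :
    PiecewiseDensity (fun p => if a ≤ p.1 ∧ b ≤ p.2 then g (p.1 - a, p.2 - b) else 0) D := by
  obtain ⟨E, Q, h1, h2, h3, h4⟩ := hg
  exact ⟨E, Q, h1, h2, h3, fun x hx hxE => (h4 x hx hxE).shift hx a b⟩

lemma PiecewiseDensity.of_forall_zero {g : ℕ × ℕ → ℝ} {D : ℕ}
    (h : ∀ x, 0 < x → HasDensity g D x 0) : PiecewiseDensity g D :=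
  ⟨∅, 0, by simp, by simp, by simp, fun x hx _ => by rw [cutEval_zero]; exact h x hx⟩

lemma PiecewiseDensity.zero (D : ℕ) : PiecewiseDensity (fun _ => 0) D :=
  .of_forall_zero fun x _ => by simpa [HasDensity] using tendsto_const_nhds

lemma PiecewiseDensity.of_lt {g : ℕ × ℕ → ℝ} {D D' : ℕ} (hg : PiecewiseDensity g D)
    (h : D < D') : PiecewiseDensity g D' := by
  obtain ⟨E, Q, -, h2, -, h4⟩ := hg
  refine ⟨E, 0, by simp, h2, by simp, fun x hx hxE => ?_⟩
  rw [cutEval_zero]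
  exact (h4 x hx hxE).of_lt h

end Density

end EpsilonDensity

namespace EpsilonDensity

/-! ### Asymptotics of the coefficients of partition series. -/

section Series

open PowerSeries
open scoped PowerSeries

/-- The coefficient of `t ^ n s ^ m` of a power series in `t` over `ℚ⟦s⟧`. -/
noncomputable def bicoeff (g : ℚ⟦X⟧⟦X⟧) (p : ℕ × ℕ) : ℝ := ((coeff p.2 (coeff p.1 g) : ℚ) : ℝ)

lemma bicoeff_add (f g : ℚ⟦X⟧⟦X⟧) (p : ℕ × ℕ) : bicoeff (f + g) p = bicoeff f p + bicoeff g p := by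
  simp [bicoeff]

lemma bicoeff_sub (f g : ℚ⟦X⟧⟦X⟧) (p : ℕ × ℕ) : bicoeff (f - g) p = bicoeff f p - bicoeff g p := by
  simp [bicoeff]

/-- The monomial `t ^ a s ^ b`. -/
noncomputable def bimon (v : ℕ × ℕ) : ℚ⟦X⟧⟦X⟧ := C (X ^ v.2) * X ^ v.1

lemma bimon_add (u v : ℕ × ℕ) : bimon (u + v) = bimon u * bimon v := by
  simp only [bimon, Prod.fst_add, Prod.snd_add, pow_add, map_mul]
  ring

lemma coeff_bimon_mul (v p : ℕ × ℕ) (g : ℚ⟦X⟧⟦X⟧) :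
    coeff p.2 (coeff p.1 (bimon v * g)) =
      if v.1 ≤ p.1 ∧ v.2 ≤ p.2 then coeff (p.2 - v.2) (coeff (p.1 - v.1) g) else 0 := by
  rw [bimon, mul_assoc, coeff_C_mul, coeff_X_pow_mul', coeff_X_pow_mul']
  by_cases h1 : v.1 ≤ p.1 <;> by_cases h2 : v.2 ≤ p.2 <;> simp [h1, h2]

lemma bicoeff_bimon_mul (v p : ℕ × ℕ) (g : ℚ⟦X⟧⟦X⟧) :
    bicoeff (bimon v * g) p =
      if v.1 ≤ p.1 ∧ v.2 ≤ p.2 then bicoeff g (p.1 - v.1, p.2 - v.2) else 0 := by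
  unfold bicoeff
  rw [coeff_bimon_mul]
  split_ifs <;> simp

/-- The geometric series `∑ r ^ n t ^ n`. -/
noncomputable def geomSeries {R : Type*} [CommRing R] (r : R) : R⟦X⟧ := PowerSeries.mk (r ^ ·)

lemma one_sub_mul_geomSeries {R : Type*} [CommRing R] (r : R) :
    (1 - C r * X) * geomSeries r = 1 := by
  ext n
  rw [sub_mul, one_mul, map_sub, mul_assoc, coeff_C_mul]
  cases n with
  | zero => simp [geomSeries]
  | succ n => simp [geomSeries, coeff_succ_X_mul, pow_succ']

lemma coeff_geomSeries_pow {R : Type*} [CommRing R] (r : R) (y n : ℕ) :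
    coeff n (geomSeries r ^ (y + 1)) = ((n + y).choose y : R) * r ^ n := by
  have h : geomSeries r = rescale r (mk 1) := by ext n; simp [geomSeries]
  have h2 : (mk 1 : R⟦X⟧) ^ (y + 1) = mk fun n => (Nat.choose (y + n) y : R) := by
    rw [← invOneSubPow_val_succ_eq_mk_add_choose, invOneSubPow]
    exact mk_one_pow_eq_mk_choose_add R y
  rw [h, ← map_pow, h2, coeff_rescale, coeff_mk, add_comm y n, mul_comm]

/-- A series whose coefficients are asymptotic to `ρ M ^ b`. -/
def CoeffAsymp (q : ℚ⟦X⟧) (b : ℕ) (ρ : ℚ) : Prop :=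
  Tendsto (fun M : ℕ => ((coeff M q : ℚ) : ℝ) / (M : ℝ) ^ b) atTop (𝓝 ρ)

/-- A Stolz–Cesàro argument with step `δ`: increments that are `o(M ^ b)` add up to `o(M ^ (b +
1))`, in all residue classes modulo `δ` at once. -/
lemma tendsto_div_pow_succ_of_tendsto_sub {r : ℕ → ℝ} {δ b : ℕ} (hδ : 0 < δ)
    (h : Tendsto (fun M : ℕ => (r (M + δ) - r M) / (M : ℝ) ^ b) atTop (𝓝 0)) :
    Tendsto (fun M : ℕ => r M / (M : ℝ) ^ (b + 1)) atTop (𝓝 0) := by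
  rw [Metric.tendsto_atTop]
  intro ε hε
  obtain ⟨M0, hM0⟩ := (Metric.tendsto_atTop.1 h) (ε / 2) (half_pos hε)
  set K : ℝ := ∑ i ∈ Finset.range (M0 + 1 + δ), |r i| with hK
  have hK0 : 0 ≤ K := Finset.sum_nonneg fun _ _ => abs_nonneg _
  -- The constant `K` absorbs the initial values. Afterwards each step of length `δ` costs at most
  -- `ε / 2 * N ^ b`, which the growth of `N ^ (b + 1)` to `(N + δ) ^ (b + 1)` pays for. The cutoff
  -- `M0 + 1 + δ` keeps `N` positive.
  have key : ∀ M : ℕ, |r M| ≤ K + ε / 2 * (M : ℝ) ^ (b + 1) := by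
    intro M
    induction M using Nat.strong_induction_on with
    | _ M ih =>
      by_cases hM : M < M0 + 1 + δ
      · have : |r M| ≤ K :=
          Finset.single_le_sum (f := fun i => |r i|) (fun _ _ => abs_nonneg _)
            (Finset.mem_range.2 hM)
        have : 0 ≤ ε / 2 * (M : ℝ) ^ (b + 1) := by positivity
        linarith
      · obtain ⟨N, rfl⟩ : ∃ N, M = N + δ := ⟨M - δ, by omega⟩
        have hN : M0 + 1 ≤ N := by omega
        have h1 := ih N (by omega)
        have h2 := hM0 N (by omega)
        have hNpos : (0 : ℝ) < N := by exact_mod_cast (by omega : 0 < N)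
        rw [Real.dist_eq, sub_zero, abs_div, abs_of_pos (a := (N : ℝ) ^ b) (by positivity),
          div_lt_iff₀ (by positivity)] at h2
        have h3 : |r (N + δ)| ≤ |r (N + δ) - r N| + |r N| := by
          simpa using abs_add_le (r (N + δ) - r N) (r N)
        have h4 : (N : ℝ) ^ (b + 1) + (N : ℝ) ^ b ≤ ((N + δ : ℕ) : ℝ) ^ (b + 1) := by
          have h5 : (N : ℝ) + 1 ≤ ((N + δ : ℕ) : ℝ) := by exact_mod_cast (by omega)
          calc (N : ℝ) ^ (b + 1) + (N : ℝ) ^ b = (N : ℝ) ^ b * (N + 1) := by ring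
            _ ≤ ((N + δ : ℕ) : ℝ) ^ b * ((N + δ : ℕ) : ℝ) := by
              gcongr
              omega
            _ = _ := by ring
        nlinarith
  have h1 : Tendsto (fun M : ℕ => K / (M : ℝ) ^ (b + 1)) atTop (𝓝 0) :=
    ((tendsto_pow_atTop (by omega)).comp tendsto_natCast_atTop_atTop).const_div_atTop _
  obtain ⟨M1, hM1⟩ := eventually_atTop.1
    ((h1.eventually (gt_mem_nhds (half_pos hε))).and (eventually_gt_atTop 0))
  refine ⟨M1, fun M hM => ?_⟩
  obtain ⟨h2, h3⟩ := hM1 M hM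
  have h4 : (0 : ℝ) < (M : ℝ) ^ (b + 1) := by
    have : (0 : ℝ) < M := by exact_mod_cast h3
    positivity
  rw [Real.dist_eq, sub_zero, abs_div, abs_of_pos h4, div_lt_iff₀ h4]
  rw [div_lt_iff₀ h4] at h2
  linarith [key M]

lemma tendsto_add_pow_sub_pow_div (δ b : ℕ) :
    Tendsto (fun M : ℕ => (((M + δ : ℕ) : ℝ) ^ (b + 1) - (M : ℝ) ^ (b + 1)) / (M : ℝ) ^ b)
      atTop (𝓝 (δ * (b + 1))) := by
  have h0 : Tendsto (fun M : ℕ => (M : ℝ)) atTop atTop := tendsto_natCast_atTop_atTop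
  have h1 : Tendsto (fun M : ℕ => 1 + (δ : ℝ) / M) atTop (𝓝 (1 + 0)) :=
    tendsto_const_nhds.add (h0.const_div_atTop _)
  have h2 : Tendsto (fun M : ℕ => (δ : ℝ) * ∑ i ∈ Finset.range (b + 1), (1 + (δ : ℝ) / M) ^ i)
      atTop (𝓝 (δ * ∑ i ∈ Finset.range (b + 1), (1 + 0 : ℝ) ^ i)) :=
    (tendsto_finsetSum _ fun i _ => h1.pow i).const_mul _
  have h3 : (δ : ℝ) * ∑ i ∈ Finset.range (b + 1), (1 + 0 : ℝ) ^ i = δ * (b + 1) := by simp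
  rw [h3] at h2
  refine h2.congr' ?_
  filter_upwards [eventually_gt_atTop 0] with M hM
  have hM' : (0 : ℝ) < M := by exact_mod_cast hM
  by_cases hδ : (δ : ℝ) = 0
  · have : δ = 0 := by exact_mod_cast hδ
    simp [this]
  rw [geom_sum_eq (by simp [hδ, hM'.ne'])]
  push_cast
  have : (1 + (δ : ℝ) / M) = (M + δ) / M := by field_simp
  have h5 : ((M : ℝ) + δ) / M - 1 = δ / M := by field_simp; ring
  rw [this, div_pow, h5]
  field_simp
  ring

/-- The coefficients of `q'` have increments of step `δ` equal to coefficients of `q`, hence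
asymptotic to `ρ M ^ b`. The same holds for `σ M ^ (b + 1)` exactly when `σ δ (b + 1) = ρ`. As `q`
has one leading constant for all residues, so has `q'`. -/
lemma CoeffAsymp.of_one_sub_X_pow_mul {q q' : ℚ⟦X⟧} {b δ : ℕ} {ρ : ℚ} (hδ : 0 < δ)
    (hq : CoeffAsymp q b ρ) (h : (1 - X ^ δ) * q' = q) :
    CoeffAsymp q' (b + 1) (ρ / (δ * (b + 1))) := by
  have hδ' : (δ : ℝ) ≠ 0 := by exact_mod_cast hδ.ne'
  have hb : (b + 1 : ℝ) ≠ 0 := by positivity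
  set σ : ℝ := ((ρ / (δ * (b + 1)) : ℚ) : ℝ) with hσ
  have hσ' : σ * (δ * (b + 1)) = ρ := by
    rw [hσ]; push_cast; field_simp
  have hrec : ∀ M, (coeff (M + δ) q' : ℚ) - coeff M q' = coeff (M + δ) q := by
    intro M
    rw [← h, sub_mul, one_mul, map_sub, coeff_X_pow_mul]
  have h1 : Tendsto (fun M : ℕ => ((coeff (M + δ) q : ℚ) : ℝ) / (M : ℝ) ^ b) atTop (𝓝 ρ) := by
    have h2 := hq.comp (tendsto_add_atTop_nat δ)
    have h3 : Tendsto (fun M : ℕ => (1 + (δ : ℝ) / M) ^ b) atTop (𝓝 ((1 + 0) ^ b)) :=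
      (tendsto_const_nhds.add (tendsto_natCast_atTop_atTop.const_div_atTop _)).pow b
    have h4 := h2.mul h3
    simp only [add_zero, one_pow, mul_one] at h4
    refine h4.congr' ?_
    filter_upwards [eventually_gt_atTop 0] with M hM
    have hM' : (0 : ℝ) < M := by exact_mod_cast hM
    have : (1 + (δ : ℝ) / M) = (M + δ) / M := by field_simp
    simp only [Function.comp]
    rw [this, div_pow]
    push_cast
    field_simp
  have h5 := tendsto_div_pow_succ_of_tendsto_sub (b := b)
    (r := fun M => ((coeff M q' : ℚ) : ℝ) - σ * (M : ℝ) ^ (b + 1)) hδ (by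
      have := h1.sub ((tendsto_add_pow_sub_pow_div δ b).const_mul σ)
      rw [hσ', sub_self] at this
      refine this.congr fun M => ?_
      rw [← hrec M]
      push_cast
      ring)
  have h6 := h5.add_const σ
  rw [zero_add] at h6
  refine h6.congr' ?_
  filter_upwards [eventually_gt_atTop 0] with M hM
  have hM' : (0 : ℝ) < M := by exact_mod_cast hM
  field_simp
  ring

/-- The product `(1 - s)⁻¹ ∏_{δ ∈ Δ} (1 - s ^ δ)⁻¹`. -/
noncomputable def denumSeries (Δ : Multiset ℕ) : ℚ⟦X⟧ :=
  (1 - X)⁻¹ * (Δ.map fun δ => (1 - X ^ δ : ℚ⟦X⟧)⁻¹).prod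

lemma one_sub_X_pow_mul_inv {δ : ℕ} (hδ : 0 < δ) : (1 - X ^ δ : ℚ⟦X⟧) * (1 - X ^ δ)⁻¹ = 1 := by
  apply PowerSeries.mul_inv_cancel
  simp [hδ.ne']

lemma one_sub_X_pow_mul_denumSeries_cons {δ : ℕ} (hδ : 0 < δ) (Δ : Multiset ℕ) :
    (1 - X ^ δ) * denumSeries (δ ::ₘ Δ) = denumSeries Δ := by
  unfold denumSeries
  rw [Multiset.map_cons, Multiset.prod_cons]
  linear_combination ((1 - X)⁻¹ * (Δ.map fun δ => (1 - X ^ δ : ℚ⟦X⟧)⁻¹).prod) *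
    one_sub_X_pow_mul_inv hδ

/-- The factor `(1 - s)⁻¹` starts the induction with constant coefficients. Without it a single `(1
- s ^ δ)⁻¹` would already have periodic ones. -/
lemma coeffAsymp_denumSeries (Δ : Multiset ℕ) (hΔ : ∀ δ ∈ Δ, 0 < δ) :
    ∃ ρ : ℚ, 0 < ρ ∧ CoeffAsymp (denumSeries Δ) Δ.card ρ := by
  induction Δ using Multiset.induction_on with
  | empty =>
    refine ⟨1, one_pos, ?_⟩
    have h : denumSeries 0 = mk 1 := by
      have h1 := mk_one_mul_one_sub_eq_one ℚ
      have h2 := one_sub_X_pow_mul_inv one_pos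
      rw [pow_one] at h2
      simp only [denumSeries, Multiset.map_zero, Multiset.prod_zero, mul_one]
      linear_combination (mk 1 : ℚ⟦X⟧) * h2 - (1 - X : ℚ⟦X⟧)⁻¹ * h1
    simp [CoeffAsymp, h]
  | cons δ Δ ih =>
    obtain ⟨ρ, hρ, h⟩ := ih fun d hd => hΔ d (by simp [hd])
    have hδ := hΔ δ (by simp)
    refine ⟨ρ / (δ * (Δ.card + 1)), by positivity, ?_⟩
    rw [Multiset.card_cons]
    exact h.of_one_sub_X_pow_mul hδ (one_sub_X_pow_mul_denumSeries_cons hδ Δ)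

/-- The series `(1 - s)⁻¹ ∏_{δ ∈ Δ} (1 - s ^ δ)⁻¹ ∏_{d ∈ Y} (1 - s ^ d t)⁻¹`. -/
noncomputable def partitionSeries (Δ Y : Multiset ℕ) : ℚ⟦X⟧⟦X⟧ :=
  C (denumSeries Δ) * (Y.map fun d => geomSeries (X ^ d : ℚ⟦X⟧)).prod

lemma bicoeff_partitionSeries_replicate (Δ : Multiset ℕ) (d y : ℕ) (p : ℕ × ℕ) :
    bicoeff (partitionSeries Δ (Multiset.replicate (y + 1) d)) p =
      if d * p.1 ≤ p.2 then
        ((p.1 + y).choose y : ℝ) * ((coeff (p.2 - d * p.1) (denumSeries Δ) : ℚ) : ℝ) else 0 := by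
  unfold bicoeff partitionSeries
  have h : (((p.1 + y).choose y : ℕ) : ℚ⟦X⟧) = C (((p.1 + y).choose y : ℕ) : ℚ) := by simp
  rw [Multiset.map_replicate, Multiset.prod_replicate, coeff_C_mul, coeff_geomSeries_pow, h,
    ← pow_mul, mul_left_comm, coeff_C_mul, coeff_mul_X_pow']
  split_ifs <;> simp

lemma tendsto_choose_div_pow (y : ℕ) :
    Tendsto (fun n : ℕ => ((n + y).choose y : ℝ) / (n : ℝ) ^ y) atTop (𝓝 (1 / y.factorial)) := by
  have h1 : Tendsto (fun n : ℕ => (n.choose y : ℝ) / (n : ℝ) ^ y) atTop (𝓝 (1 / y.factorial)) := by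
    have h := (isEquivalent_choose y)
    have h2 := (Asymptotics.isEquivalent_iff_tendsto_one (by
      filter_upwards [eventually_gt_atTop 0] with n hn
      have : (0 : ℝ) < n := by exact_mod_cast hn
      positivity)).1 h
    have h3 := h2.mul_const (1 / (y.factorial : ℝ))
    rw [one_mul] at h3
    refine h3.congr' ?_
    filter_upwards [eventually_gt_atTop 0] with n hn
    have : (0 : ℝ) < n := by exact_mod_cast hn
    have h4 : (0 : ℝ) < y.factorial := by positivity
    simp only [Pi.div_apply]
    field_simp
  have h2 := h1.comp (tendsto_add_atTop_nat y)
  have h3 : Tendsto (fun M : ℕ => (1 + (y : ℝ) / M) ^ y) atTop (𝓝 ((1 + 0) ^ y)) :=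
    (tendsto_const_nhds.add (tendsto_natCast_atTop_atTop.const_div_atTop _)).pow y
  have h4 := h2.mul h3
  simp only [add_zero, one_pow, mul_one] at h4
  refine h4.congr' ?_
  filter_upwards [eventually_gt_atTop 0] with M hM
  have hM' : (0 : ℝ) < M := by exact_mod_cast hM
  have : (1 + (y : ℝ) / M) = (M + y) / M := by field_simp
  simp only [Function.comp]
  rw [this, div_pow]
  push_cast
  field_simp

/-- The coefficient is a binomial coefficient, of order `n ^ y / y!`, times a coefficient of
`denumSeries Δ` at `m - d n`, which is asymptotically `(x - d) n`. -/
lemma hasDensity_partitionSeries_replicate (Δ : Multiset ℕ) (d y : ℕ) {ρ : ℚ}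
    (hρ : CoeffAsymp (denumSeries Δ) Δ.card ρ) {x : ℝ} (hxd : (d : ℝ) < x) :
    HasDensity (bicoeff (partitionSeries Δ (Multiset.replicate (y + 1) d))) (Δ.card + y) x
      (ρ / y.factorial * (x - d) ^ Δ.card) := by
  have h1 := (tendsto_choose_div_pow y).comp (tendsto_fst_slopeFilter x)
  have hM : Tendsto (fun p : ℕ × ℕ => p.2 - d * p.1) (slopeFilter x) atTop := by
    rw [← tendsto_natCast_atTop_iff (R := ℝ)]
    have h := ((tendsto_fst_real_slopeFilter x).const_mul_atTop (half_pos (sub_pos.2 hxd)))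
    refine tendsto_atTop_mono' _ ?_ h
    filter_upwards [eventually_mul_lt (show (x + d) / 2 < x by linarith)] with p hp
    have h2 : ((p.2 : ℕ) : ℝ) ≤ ((p.2 - d * p.1 : ℕ) : ℝ) + d * p.1 := by
      exact_mod_cast (by omega)
    linarith
  have h2 := hρ.comp hM
  have h3 : Tendsto (fun p : ℕ × ℕ => (((p.2 : ℝ) / p.1) - d) ^ Δ.card) (slopeFilter x)
      (𝓝 ((x - d) ^ Δ.card)) := ((tendsto_div_slopeFilter x).sub_const _).pow _
  have h4 := (h1.mul h2).mul h3
  unfold HasDensity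
  rw [show (ρ : ℝ) / y.factorial * (x - d) ^ Δ.card = 1 / y.factorial * ρ * (x - d) ^ Δ.card by
    ring]
  refine h4.congr' ?_
  filter_upwards [eventually_mul_lt hxd, eventually_fst_pos x] with p hp hp1
  have hp' : d * p.1 < p.2 := by exact_mod_cast hp
  have hp1' : (0 : ℝ) < p.1 := by exact_mod_cast hp1
  have hpos : (0 : ℝ) < (p.2 : ℝ) - d * p.1 := by linarith
  rw [bicoeff_partitionSeries_replicate, if_pos hp'.le]
  simp only [Function.comp]
  have e1 : (p.2 : ℝ) / p.1 - d = (p.2 - d * p.1) / p.1 := by field_simp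
  rw [Nat.cast_sub hp'.le, e1, div_pow, pow_add]
  push_cast
  field_simp

lemma piecewiseDensity_partitionSeries_replicate (Δ : Multiset ℕ) (hΔ : ∀ δ ∈ Δ, 0 < δ)
    (d y : ℕ) : PiecewiseDensity
      (bicoeff (partitionSeries Δ (Multiset.replicate (y + 1) d))) (Δ.card + y) := by
  obtain ⟨ρ, hρ, h⟩ := coeffAsymp_denumSeries Δ hΔ
  refine ⟨{(d : ℚ)}, Finsupp.single (d : ℚ)
    (Polynomial.C (ρ / y.factorial) * (Polynomial.X - Polynomial.C (d : ℚ)) ^ Δ.card),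
    Finsupp.support_single_subset, by simp, ?_, ?_⟩
  · intro a
    rw [Finsupp.single_apply]
    split_ifs
    · refine Polynomial.natDegree_C_mul_le _ _ |>.trans ?_
      rw [Polynomial.natDegree_pow, Polynomial.natDegree_X_sub_C]
      omega
    · simp
  · intro x hx hxE
    have hne : (d : ℝ) ≠ x := by simpa using hxE d (by simp)
    rw [cutEval_single]
    rcases lt_or_gt_of_ne hne with hlt | hgt
    · rw [if_pos (by simpa using hlt)]
      have := hasDensity_partitionSeries_replicate Δ d y h hlt
      convert this using 1
      simp
    · rw [if_neg (by simpa using hgt.le)]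
      refine tendsto_const_nhds.congr' ?_
      filter_upwards [eventually_lt_mul hgt] with p hp
      have : ¬ d * p.1 ≤ p.2 := by
        intro hh
        have : (d : ℝ) * p.1 ≤ p.2 := by exact_mod_cast hh
        linarith
      rw [bicoeff_partitionSeries_replicate, if_neg this, zero_div]

/-- Partial fractions reduce the number of factors `1 - s ^ d t`. -/
lemma partitionSeries_cons_cons (Δ Y : Multiset ℕ) (d δ : ℕ) (hδ : 0 < δ) :
    partitionSeries Δ (d ::ₘ (d + δ) ::ₘ Y) =
      partitionSeries (δ ::ₘ Δ) (d ::ₘ Y) -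
        bimon (0, δ) * partitionSeries (δ ::ₘ Δ) ((d + δ) ::ₘ Y) := by
  -- With `z = s ^ d` and `w = s ^ δ` the identity is `(1 - w) / ((1 - z t) (1 - z w t)) = 1 / (1 -
  -- z t) - w / (1 - z w t)`; the factor `1 - w` is borrowed from the enlarged denominator.
  have h0 : C (denumSeries Δ) =
      (1 - C (X ^ δ : ℚ⟦X⟧)) * (C (denumSeries (δ ::ₘ Δ)) : ℚ⟦X⟧⟦X⟧) := by
    rw [← one_sub_X_pow_mul_denumSeries_cons hδ, map_mul, map_sub, map_one]
  have h1 := one_sub_mul_geomSeries (X ^ d : ℚ⟦X⟧)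
  have h2 := one_sub_mul_geomSeries (X ^ (d + δ) : ℚ⟦X⟧)
  unfold partitionSeries
  simp only [Multiset.map_cons, Multiset.prod_cons, bimon, pow_zero, mul_one]
  rw [h0]
  set P := (Y.map fun d => geomSeries (X ^ d : ℚ⟦X⟧)).prod
  rw [pow_add, map_mul] at h2
  rw [pow_add]
  set G := geomSeries (X ^ d : ℚ⟦X⟧)
  set G' := geomSeries (X ^ d * X ^ δ : ℚ⟦X⟧)
  set c := (C (denumSeries (δ ::ₘ Δ)) : ℚ⟦X⟧⟦X⟧)
  set z := (C (X ^ d : ℚ⟦X⟧) : ℚ⟦X⟧⟦X⟧)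
  set w := (C (X ^ δ : ℚ⟦X⟧) : ℚ⟦X⟧⟦X⟧)
  linear_combination (c * P * G) * h2 - (c * P * w * G') * h1

/-- Two distinct factors `1 - s ^ d t` are traded for one by partial fractions, at the price of one
more element in `Δ`, so the order `Δ.card + y` is unchanged. The induction on `y` stops early when
all factors coincide. -/
lemma piecewiseDensity_partitionSeries (y : ℕ) : ∀ (Δ Y : Multiset ℕ), (∀ δ ∈ Δ, 0 < δ) →
    Y.card = y + 1 → PiecewiseDensity (bicoeff (partitionSeries Δ Y)) (Δ.card + y) := by
  induction y with
  | zero =>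
    intro Δ Y hΔ hY
    obtain ⟨d, rfl⟩ := Multiset.card_eq_one.1 hY
    exact piecewiseDensity_partitionSeries_replicate Δ hΔ d 0
  | succ y ih =>
    intro Δ Y hΔ hY
    have step : ∀ (d δ : ℕ) (Y' : Multiset ℕ), 0 < δ → Y'.card = y →
        PiecewiseDensity (bicoeff (partitionSeries Δ (d ::ₘ (d + δ) ::ₘ Y')))
          (Δ.card + (y + 1)) := by
      intro d δ Y' hδ hY'
      have hΔ' : ∀ e ∈ δ ::ₘ Δ, 0 < e := by
        intro e he
        rcases Multiset.mem_cons.1 he with rfl | h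
        exacts [hδ, hΔ e h]
      have e1 := ih (δ ::ₘ Δ) (d ::ₘ Y') hΔ' (by simp [hY'])
      have e2 := (ih (δ ::ₘ Δ) ((d + δ) ::ₘ Y') hΔ' (by simp [hY'])).shift 0 δ
      have e3 := e1.sub e2
      rw [Multiset.card_cons, add_right_comm, add_assoc] at e3
      convert e3 using 2 with p
      rw [partitionSeries_cons_cons _ _ _ _ hδ, bicoeff_sub, bicoeff_bimon_mul]
    obtain ⟨d, hd⟩ := Multiset.card_pos_iff_exists_mem.1 (by omega : 0 < Y.card)
    obtain ⟨Y1, rfl⟩ := Multiset.exists_cons_of_mem hd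
    rw [Multiset.card_cons] at hY
    by_cases hall : ∀ e ∈ Y1, e = d
    · have : d ::ₘ Y1 = Multiset.replicate (y + 1 + 1) d := by
        rw [Multiset.eq_replicate]
        refine ⟨by simpa using hY, fun e he => ?_⟩
        rcases Multiset.mem_cons.1 he with h | h
        exacts [h, hall e h]
      rw [this]
      exact piecewiseDensity_partitionSeries_replicate Δ hΔ d (y + 1)
    · push Not at hall
      obtain ⟨e, he, hed⟩ := hall
      obtain ⟨Y2, rfl⟩ := Multiset.exists_cons_of_mem he
      have hY2 : Y2.card = y := by simpa using hY
      rcases lt_or_gt_of_ne hed with h | h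
      · obtain ⟨δ, rfl⟩ := Nat.exists_eq_add_of_lt h
        rw [Multiset.cons_swap]
        exact step e (δ + 1) Y2 (by omega) hY2
      · obtain ⟨δ, rfl⟩ := Nat.exists_eq_add_of_lt h
        exact step d (δ + 1) Y2 (by omega) hY2

/-- The series with nonnegative coefficients. -/
def nonnegSeries : Subsemiring ℚ⟦X⟧⟦X⟧ where
  carrier := {f | ∀ n m, 0 ≤ coeff m (coeff n f)}
  zero_mem' := by simp
  one_mem' := by
    intro n m
    rw [coeff_one]
    split_ifs
    · rw [coeff_one]; split_ifs <;> simp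
    · simp
  add_mem' := by
    intro f g hf hg n m
    rw [map_add, map_add]
    exact add_nonneg (hf n m) (hg n m)
  mul_mem' := by
    intro f g hf hg n m
    rw [coeff_mul, map_sum]
    refine Finset.sum_nonneg fun i _ => ?_
    rw [coeff_mul]
    exact Finset.sum_nonneg fun j _ => mul_nonneg (hf _ _) (hg _ _)

lemma bicoeff_nonneg {f : ℚ⟦X⟧⟦X⟧} (hf : f ∈ nonnegSeries) (p : ℕ × ℕ) : 0 ≤ bicoeff f p := by
  unfold bicoeff
  exact_mod_cast hf p.1 p.2

lemma geomSeries_mem_nonnegSeries (d : ℕ) : geomSeries (X ^ d : ℚ⟦X⟧) ∈ nonnegSeries := by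
  intro n m
  rw [geomSeries, coeff_mk, ← pow_mul, coeff_X_pow]
  split_ifs <;> simp

lemma inv_one_sub_X : (1 - X : ℚ⟦X⟧)⁻¹ = mk 1 := by
  have h1 := mk_one_mul_one_sub_eq_one ℚ
  have h2 := one_sub_X_pow_mul_inv one_pos
  rw [pow_one] at h2
  linear_combination (mk 1 : ℚ⟦X⟧) * h2 - (1 - X : ℚ⟦X⟧)⁻¹ * h1

lemma C_mk_one_mem_nonnegSeries : C (mk 1 : ℚ⟦X⟧) ∈ nonnegSeries := by
  intro n m
  rw [coeff_C]
  split_ifs <;> simp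

lemma denumSeries_replicate (p : ℕ) : denumSeries (Multiset.replicate p 1) = mk 1 * mk 1 ^ p := by
  rw [denumSeries, Multiset.map_replicate, Multiset.prod_replicate, pow_one, inv_one_sub_X]

lemma bimon_mem_nonnegSeries (v : ℕ × ℕ) : bimon v ∈ nonnegSeries := by
  intro n m
  have := coeff_bimon_mul v (n, m) 1
  simp only [mul_one] at this
  rw [this]
  split_ifs
  · exact one_mem nonnegSeries _ _
  · exact le_rfl

lemma partitionSeries_mem_nonnegSeries (p : ℕ) (Y : Multiset ℕ) :
    partitionSeries (Multiset.replicate p 1) Y ∈ nonnegSeries := by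
  unfold partitionSeries
  refine mul_mem ?_ (Subsemiring.multiset_prod_mem _ _ ?_)
  · rw [denumSeries_replicate, map_mul, map_pow]
    exact mul_mem C_mk_one_mem_nonnegSeries (pow_mem C_mk_one_mem_nonnegSeries _)
  · intro f hf
    obtain ⟨d, -, rfl⟩ := Multiset.mem_map.1 hf
    exact geomSeries_mem_nonnegSeries d

/-- After multiplication by `(1 - s)⁻¹` the coefficient of `t ^ n` of the geometric series is the
indicator of `d n ≤ m`, which decreases as `d` grows. -/
lemma C_mk_one_mul_geomSeries_sub_mem_nonnegSeries {d D : ℕ} (h : d ≤ D) :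
    C (mk 1 : ℚ⟦X⟧) * (geomSeries (X ^ d) - geomSeries (X ^ D)) ∈ nonnegSeries := by
  intro n m
  rw [coeff_C_mul, map_sub, geomSeries, geomSeries, coeff_mk, coeff_mk, mul_sub, map_sub,
    ← pow_mul, ← pow_mul, coeff_mul_X_pow', coeff_mul_X_pow']
  have : d * n ≤ D * n := Nat.mul_le_mul_right _ h
  split_ifs with h1 h2
  · simp
  · simp
  · omega
  · simp

/-- This comparison bounds a partition series from below by one with equal factors, whose density is
explicit and positive. -/
lemma partitionSeries_sub_replicate_mem_nonnegSeries (p D : ℕ) (Y : Multiset ℕ)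
    (hY : ∀ d ∈ Y, d ≤ D) :
    partitionSeries (Multiset.replicate p 1) Y -
      partitionSeries (Multiset.replicate p 1) (Multiset.replicate Y.card D) ∈ nonnegSeries := by
  induction Y using Multiset.induction_on with
  | empty => simp [zero_mem]
  | cons d Y ih =>
    have ih' := ih fun e he => hY e (by simp [he])
    have hd := hY d (by simp)
    have h1 := mul_mem (geomSeries_mem_nonnegSeries D) ih'
    have h2 : C ((mk 1 : ℚ⟦X⟧) ^ p) * (Y.map fun d => geomSeries (X ^ d : ℚ⟦X⟧)).prod
        ∈ nonnegSeries := by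
      refine mul_mem ?_ (Subsemiring.multiset_prod_mem _ _ ?_)
      · rw [map_pow]
        exact pow_mem C_mk_one_mem_nonnegSeries _
      · intro f hf
        obtain ⟨d, -, rfl⟩ := Multiset.mem_map.1 hf
        exact geomSeries_mem_nonnegSeries d
    have h3 := add_mem (mul_mem (C_mk_one_mul_geomSeries_sub_mem_nonnegSeries hd) h2) h1
    convert h3 using 1
    simp only [partitionSeries, denumSeries_replicate, Multiset.map_cons, Multiset.prod_cons,
      Multiset.card_cons, Multiset.replicate_succ, map_mul]
    ring

lemma hasDensity_const_mul_pow (K : ℝ) (d : ℕ) (x : ℝ) :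
    HasDensity (fun p => K * ((p.2 : ℝ) + 1) ^ d) d x (K * x ^ d) := by
  have h1 : Tendsto (fun p : ℕ × ℕ => K * ((p.2 : ℝ) / p.1 + 1 / p.1) ^ d) (slopeFilter x)
      (𝓝 (K * (x + 0) ^ d)) :=
    (((tendsto_div_slopeFilter x).add
      ((tendsto_fst_real_slopeFilter x).const_div_atTop 1)).pow d).const_mul K
  rw [add_zero] at h1
  refine h1.congr fun p => ?_
  rw [← add_div, div_pow, mul_div_assoc]

/-- The sums of the series `t ^ a s ^ b (1 - s) ^ (-p - 1) ∏ (1 - s ^ d t)⁻¹`. -/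
noncomputable def partitionSums : AddSubmonoid ℚ⟦X⟧⟦X⟧ :=
  AddSubmonoid.closure {f | ∃ (v : ℕ × ℕ) (p : ℕ) (Y : Multiset ℕ),
    f = bimon v * partitionSeries (Multiset.replicate p 1) Y}

lemma bimon_mul_partitionSeries_mem (v : ℕ × ℕ) (p : ℕ) (Y : Multiset ℕ) :
    bimon v * partitionSeries (Multiset.replicate p 1) Y ∈ partitionSums :=
  AddSubmonoid.subset_closure ⟨v, p, Y, rfl⟩

/-- The natural order of the series is `p + y`, where `y + 1` is the number of factors. A bound by
`K (m + 1) ^ d` forces `p + y ≤ d`: otherwise, at a slope above all the `d` in `Y`, a positive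
density of order `p + y` would lie below a density that is zero in this order. -/
lemma piecewiseDensity_bimon_mul_partitionSeries {d : ℕ} {K : ℝ} (v : ℕ × ℕ) (p : ℕ)
    (Y : Multiset ℕ)
    (hK : ∀ q : ℕ × ℕ, bicoeff (bimon v * partitionSeries (Multiset.replicate p 1) Y) q
      ≤ K * ((q.2 : ℝ) + 1) ^ d) :
    PiecewiseDensity (bicoeff (bimon v * partitionSeries (Multiset.replicate p 1) Y)) d := by
  have hshift : ∀ (Z : Multiset ℕ), bicoeff (bimon v * partitionSeries (Multiset.replicate p 1) Z) =
      fun q => if v.1 ≤ q.1 ∧ v.2 ≤ q.2 then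
        bicoeff (partitionSeries (Multiset.replicate p 1) Z) (q.1 - v.1, q.2 - v.2) else 0 := by
    intro Z
    funext q
    exact bicoeff_bimon_mul v q _
  have hΔ : ∀ δ ∈ Multiset.replicate p 1, 0 < δ := by
    intro δ hδ
    rw [Multiset.eq_of_mem_replicate hδ]
    exact one_pos
  rcases Nat.eq_zero_or_pos Y.card with h0 | hpos
  · rw [Multiset.card_eq_zero] at h0
    subst h0
    -- Without factors `1 - s ^ d t` the series is concentrated in the single `t`-degree `v.1`.
    refine .of_forall_zero fun x hx => tendsto_const_nhds.congr' ?_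
    filter_upwards [(tendsto_fst_slopeFilter x).eventually (eventually_gt_atTop v.1)] with q hq
    rw [hshift]
    have : q.1 - v.1 ≠ 0 := by omega
    simp [bicoeff, partitionSeries, coeff_C, this]
  · obtain ⟨y, hy⟩ : ∃ y, Y.card = y + 1 := ⟨Y.card - 1, by omega⟩
    have h1 := (piecewiseDensity_partitionSeries y _ Y hΔ hy).shift v.1 v.2
    rw [← hshift, Multiset.card_replicate] at h1
    rcases lt_trichotomy (p + y) d with h | h | h
    · exact h1.of_lt h
    · rwa [h] at h1
    · exfalso
      obtain ⟨D, hD⟩ : ∃ D : ℕ, ∀ e ∈ Y, e ≤ D :=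
        ⟨Y.sup, fun e he => Multiset.le_sup he⟩
      obtain ⟨ρ, hρ, hq⟩ := coeffAsymp_denumSeries _ hΔ
      have hx : (0 : ℝ) < D + 1 := by positivity
      have h2 := (hasDensity_partitionSeries_replicate _ D y hq (lt_add_one (D : ℝ))).shift hx
        v.1 v.2
      rw [← hshift] at h2
      have h3 := (hasDensity_const_mul_pow K d (D + 1)).of_lt h
      have := slopeFilter_neBot hx.le
      rw [Multiset.card_replicate] at h2
      have h4 := le_of_tendsto_of_tendsto h2 h3 (Eventually.of_forall fun q => by
        refine div_le_div_of_nonneg_right ?_ (by positivity)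
        refine le_trans ?_ (hK q)
        have h5 := bicoeff_nonneg (mul_mem (bimon_mem_nonnegSeries v)
          (partitionSeries_sub_replicate_mem_nonnegSeries p D Y hD)) q
        rw [mul_sub, bicoeff_sub, hy] at h5
        linarith)
      have h5 : (0 : ℝ) < ρ / y.factorial * ((D : ℝ) + 1 - D) ^ p := by
        have : (0 : ℝ) < ρ := by exact_mod_cast hρ
        rw [add_sub_cancel_left]
        positivity
      linarith

/-- A sum of partition series whose coefficients grow at most like `m ^ d` has a piecewise
polynomial density of order `d`. -/
lemma piecewiseDensity_of_mem_partitionSums {d : ℕ} {K : ℝ} {f : ℚ⟦X⟧⟦X⟧}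
    (hf : f ∈ partitionSums) (hK : ∀ q : ℕ × ℕ, bicoeff f q ≤ K * ((q.2 : ℝ) + 1) ^ d) :
    PiecewiseDensity (bicoeff f) d := by
  -- Nonnegativity is carried through the induction because only then does the growth bound on a sum
  -- pass to its summands.
  suffices h : f ∈ nonnegSeries ∧ ((∀ q : ℕ × ℕ, bicoeff f q ≤ K * ((q.2 : ℝ) + 1) ^ d) →
      PiecewiseDensity (bicoeff f) d) from h.2 hK
  clear hK
  induction hf using AddSubmonoid.closure_induction with
  | mem f hf =>
    obtain ⟨v, p, Y, rfl⟩ := hf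
    exact ⟨mul_mem (bimon_mem_nonnegSeries v) (partitionSeries_mem_nonnegSeries p Y),
      piecewiseDensity_bimon_mul_partitionSeries v p Y⟩
  | zero =>
    refine ⟨zero_mem _, fun _ => ?_⟩
    convert PiecewiseDensity.zero d using 2
    simp [bicoeff]
  | add f g _ _ hf hg =>
    refine ⟨add_mem hf.1 hg.1, fun hK => ?_⟩
    have e : bicoeff (f + g) = fun q => bicoeff f q + bicoeff g q := funext (bicoeff_add f g)
    rw [e]
    refine (hf.2 fun q => ?_).add (hg.2 fun q => ?_)
    · have := hK q
      rw [bicoeff_add] at this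
      linarith [bicoeff_nonneg hg.1 q]
    · have := hK q
      rw [bicoeff_add] at this
      linarith [bicoeff_nonneg hf.1 q]

end Series

end EpsilonDensity

namespace EpsilonDensity

/-! ### Generating functions of lower sets of exponents. -/

section LowerSets

open PowerSeries
open scoped PowerSeries

/-- Lower sets of a well quasi-order satisfy the descending chain condition. -/
lemma wellFoundedLT_lowerSet (α : Type*) [PartialOrder α] [WellQuasiOrderedLE α] :
    WellFoundedLT (LowerSet α) := by
  constructor
  rw [wellFounded_iff_isEmpty_descending_chain]
  constructor
  rintro ⟨f, hf⟩
  have hanti : Antitone f := antitone_nat_of_succ_le fun n => (hf n).le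
  have hex : ∀ n, ∃ u, u ∈ f n ∧ u ∉ f (n + 1) := fun n => by
    obtain ⟨u, hu, hu'⟩ := Set.exists_of_ssubset (LowerSet.coe_ssubset_coe.2 (hf n))
    exact ⟨u, hu, hu'⟩
  choose u hu hu' using hex
  obtain ⟨i, j, hij, h⟩ := wellQuasiOrdered_le u
  exact hu' i ((f (i + 1)).lower h (hanti (Nat.succ_le_of_lt hij) (hu j)))

/-- The bidegrees of the variables: `(0, 1)` or `(1, d)`. -/
def IsGeneratorDegree (v : ℕ × ℕ) : Prop := v = (0, 1) ∨ v.1 = 1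

lemma bimon_mul_mem_partitionSums (v : ℕ × ℕ) {f : ℚ⟦X⟧⟦X⟧} (hf : f ∈ partitionSums) :
    bimon v * f ∈ partitionSums := by
  induction hf using AddSubmonoid.closure_induction with
  | mem f hf =>
    obtain ⟨w, p, Y, rfl⟩ := hf
    rw [← mul_assoc, ← bimon_add]
    exact bimon_mul_partitionSeries_mem _ _ _
  | zero => simp [zero_mem]
  | add f g _ _ hf hg => rw [mul_add]; exact add_mem hf hg

lemma C_mk_one_mul_mem_partitionSums {f : ℚ⟦X⟧⟦X⟧} (hf : f ∈ partitionSums) :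
    C (mk 1 : ℚ⟦X⟧) * f ∈ partitionSums := by
  induction hf using AddSubmonoid.closure_induction with
  | mem f hf =>
    obtain ⟨w, p, Y, rfl⟩ := hf
    convert bimon_mul_partitionSeries_mem w (p + 1) Y using 1
    simp only [partitionSeries, denumSeries_replicate, pow_succ, map_mul]
    ring
  | zero => simp [zero_mem]
  | add f g _ _ hf hg => rw [mul_add]; exact add_mem hf hg

lemma geomSeries_mul_mem_partitionSums (d : ℕ) {f : ℚ⟦X⟧⟦X⟧} (hf : f ∈ partitionSums) :
    geomSeries (X ^ d : ℚ⟦X⟧) * f ∈ partitionSums := by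
  induction hf using AddSubmonoid.closure_induction with
  | mem f hf =>
    obtain ⟨w, p, Y, rfl⟩ := hf
    convert bimon_mul_partitionSeries_mem w p (d ::ₘ Y) using 1
    simp only [partitionSeries, Multiset.map_cons, Multiset.prod_cons]
    ring
  | zero => simp [zero_mem]
  | add f g _ _ hf hg => rw [mul_add]; exact add_mem hf hg

/-- The inverse of `1 - s` raises `p` and that of `1 - s ^ d t` enlarges `Y`; this is why only
variables of these bidegrees are admitted. -/
lemma mem_partitionSums_of_one_sub_bimon_mul_mem {v : ℕ × ℕ} (hv : IsGeneratorDegree v)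
    {g : ℚ⟦X⟧⟦X⟧} (hg : (1 - bimon v) * g ∈ partitionSums) : g ∈ partitionSums := by
  rcases hv with rfl | hv
  · have h := C_mk_one_mul_mem_partitionSums hg
    have h1 : C (mk 1 : ℚ⟦X⟧) * (1 - bimon (0, 1)) = (1 : ℚ⟦X⟧⟦X⟧) := by
      have h2 := congrArg (C (R := ℚ⟦X⟧)) (mk_one_mul_one_sub_eq_one ℚ)
      simpa [bimon] using h2
    rwa [← mul_assoc, h1, one_mul] at h
  · have h := geomSeries_mul_mem_partitionSums v.2 hg
    have h1 := one_sub_mul_geomSeries (X ^ v.2 : ℚ⟦X⟧)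
    have h2 : bimon v = C (X ^ v.2 : ℚ⟦X⟧) * X := by rw [bimon, hv, pow_one]
    rwa [← mul_assoc, h2, mul_comm (geomSeries _), h1, one_mul] at h

variable {N : ℕ}

/-- The bidegree of a monomial with exponent `u`. -/
def bidegree (deg : Fin N → ℕ × ℕ) (u : Fin N → ℕ) : ℕ × ℕ := ∑ i, u i • deg i

lemma bidegree_add (deg : Fin N → ℕ × ℕ) (u v : Fin N → ℕ) :
    bidegree deg (u + v) = bidegree deg u + bidegree deg v := by
  simp [bidegree, add_smul, Finset.sum_add_distrib]

lemma bidegree_single (deg : Fin N → ℕ × ℕ) (i : Fin N) :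
    bidegree deg (Pi.single i 1) = deg i := by
  unfold bidegree
  rw [Finset.sum_eq_single i]
  · simp
  · intro j _ hj
    simp [hj]
  · simp

/-- Every variable contributes `1` to one of the two degrees, so each exponent is bounded by their
sum. -/
lemma finite_bidegree_eq {deg : Fin N → ℕ × ℕ} (hdeg : ∀ i, IsGeneratorDegree (deg i))
    (p : ℕ × ℕ) : {u | bidegree deg u = p}.Finite := by
  refine (Set.finite_Iic (fun _ : Fin N => p.1 + p.2)).subset ?_
  rintro u rfl i
  have h1 : u i • deg i ≤ bidegree deg u :=
    Finset.single_le_sum (f := fun i => u i • deg i) (fun _ _ => zero_le) (Finset.mem_univ i)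
  have h2 : u i * (deg i).1 ≤ (bidegree deg u).1 := by simpa using h1.1
  have h3 : u i * (deg i).2 ≤ (bidegree deg u).2 := by simpa using h1.2
  rcases hdeg i with h | h
  · rw [h] at h3
    simp only at h3 ⊢
    omega
  · rw [h] at h2
    simp only at h2 ⊢
    omega

/-- The generating function of the bidegrees of the elements of `L`. -/
noncomputable def bidegreeSeries (deg : Fin N → ℕ × ℕ) (L : Set (Fin N → ℕ)) : ℚ⟦X⟧⟦X⟧ :=
  PowerSeries.mk fun n => PowerSeries.mk fun m =>
    (({u ∈ L | bidegree deg u = (n, m)}.ncard : ℕ) : ℚ)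

lemma coeff_bidegreeSeries (deg : Fin N → ℕ × ℕ) (L : Set (Fin N → ℕ)) (n m : ℕ) :
    coeff m (coeff n (bidegreeSeries deg L)) = ({u ∈ L | bidegree deg u = (n, m)}.ncard : ℚ) := by
  simp [bidegreeSeries]

/-- Exponents with `u i ≠ 0` are translated by one unit in direction `i`; the others lie in a
coordinate hyperplane. -/
lemma bidegreeSeries_eq_add {deg : Fin N → ℕ × ℕ} (hdeg : ∀ i, IsGeneratorDegree (deg i))
    (L : LowerSet (Fin N → ℕ)) (i : Fin N) :
    bidegreeSeries deg L = bimon (deg i) * bidegreeSeries deg {u | u + Pi.single i 1 ∈ L} +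
      bidegreeSeries deg {u ∈ L | u i = 0} := by
  ext n m
  have h1 := coeff_bimon_mul (deg i) (n, m) (bidegreeSeries deg {u | u + Pi.single i 1 ∈ L})
  simp only at h1
  rw [map_add, map_add, h1]
  simp only [coeff_bidegreeSeries]
  have hfin : ∀ s : Set (Fin N → ℕ), {u ∈ s | bidegree deg u = (n, m)}.Finite := fun s =>
    (finite_bidegree_eq hdeg (n, m)).subset fun u hu => hu.2
  have hsplit : {u ∈ (L : Set (Fin N → ℕ)) | bidegree deg u = (n, m)} =
      {u ∈ {u ∈ (L : Set (Fin N → ℕ)) | u i ≠ 0} | bidegree deg u = (n, m)} ∪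
      {u ∈ {u ∈ (L : Set (Fin N → ℕ)) | u i = 0} | bidegree deg u = (n, m)} := by
    ext u
    simp only [Set.mem_ofPred_eq, Set.mem_union]
    tauto
  have hdisj : Disjoint
      {u ∈ {u ∈ (L : Set (Fin N → ℕ)) | u i ≠ 0} | bidegree deg u = (n, m)}
      {u ∈ {u ∈ (L : Set (Fin N → ℕ)) | u i = 0} | bidegree deg u = (n, m)} := by
    rw [Set.disjoint_left]
    intro u hu hu'
    exact hu.1.2 hu'.1.2
  rw [hsplit, Set.ncard_union_eq hdisj (hfin _) (hfin _), Nat.cast_add]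
  congr 1
  have hmap : ∀ u ∈ {u ∈ {u ∈ (L : Set (Fin N → ℕ)) | u i ≠ 0} | bidegree deg u = (n, m)},
      ∃ w, u = w + Pi.single i 1 ∧ w + Pi.single i 1 ∈ L ∧ bidegree deg w + deg i = (n, m) := by
    rintro u ⟨⟨hu, hui⟩, hub⟩
    have hle : Pi.single i 1 ≤ u := by
      intro j
      rw [Pi.single_apply]
      split_ifs with h
      · subst h
        exact Nat.one_le_iff_ne_zero.2 hui
      · exact Nat.zero_le _
    have e : u = (u - Pi.single i 1) + Pi.single i 1 := (tsub_add_cancel_of_le hle).symm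
    refine ⟨_, e, by rwa [← e], ?_⟩
    rw [← bidegree_single deg i, ← bidegree_add, ← e, hub]
  split_ifs with hle
  · congr 1
    refine Eq.trans ?_ (Set.ncard_image_of_injective
      {u ∈ {u | u + Pi.single i 1 ∈ L} | bidegree deg u = (n - (deg i).1, m - (deg i).2)}
      (add_left_injective (Pi.single i 1)))
    congr 1
    ext u
    constructor
    · intro hu
      obtain ⟨w, rfl, hw, hwb⟩ := hmap u hu
      refine ⟨w, ⟨hw, ?_⟩, rfl⟩
      rw [Prod.ext_iff] at hwb ⊢
      simp only [Prod.fst_add, Prod.snd_add] at hwb ⊢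
      omega
    · rintro ⟨w, ⟨hw, hwb⟩, rfl⟩
      refine ⟨⟨hw, by simp⟩, ?_⟩
      rw [bidegree_add, bidegree_single, hwb]
      ext <;> simp [hle.1, hle.2]
  · rw [Nat.cast_eq_zero, Set.ncard_eq_zero (hfin _), Set.eq_empty_iff_forall_notMem]
    intro u hu
    obtain ⟨w, rfl, hw, hwb⟩ := hmap u hu
    rw [Prod.ext_iff] at hwb
    simp only [Prod.fst_add, Prod.snd_add] at hwb
    omega

/-- The generating function of a lower set of exponents is a sum of partition series. -/
lemma C_mk_one_mul_bidegreeSeries_mem {deg : Fin N → ℕ × ℕ}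
    (hdeg : ∀ i, IsGeneratorDegree (deg i)) (S : Finset (Fin N)) :
    ∀ L : LowerSet (Fin N → ℕ), (∀ u ∈ L, ∀ i ∉ S, u i = 0) →
      C (mk 1 : ℚ⟦X⟧) * bidegreeSeries deg L ∈ partitionSums := by
  induction S using Finset.induction_on with
  | empty =>
    intro L hL
    have hsub : ∀ u ∈ L, u = 0 := fun u hu => funext fun i => hL u hu i (by simp)
    by_cases h0 : (0 : Fin N → ℕ) ∈ L
    · have hL0 : (L : Set (Fin N → ℕ)) = {0} := by
        ext u
        exact ⟨fun hu => hsub u hu, fun hu => by rw [Set.mem_singleton_iff.1 hu]; exact h0⟩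
      have h1 : bidegreeSeries deg (L : Set (Fin N → ℕ)) = 1 := by
        ext n m
        rw [coeff_bidegreeSeries, hL0]
        have hb : bidegree deg (0 : Fin N → ℕ) = 0 := by simp [bidegree]
        by_cases h : (n, m) = (0, 0)
        · obtain ⟨rfl, rfl⟩ := Prod.mk.inj h
          have : {u ∈ ({0} : Set (Fin N → ℕ)) | bidegree deg u = (0, 0)} = {0} := by
            ext u
            simp only [Set.mem_singleton_iff, Set.mem_ofPred_eq, and_iff_left_iff_imp]
            rintro rfl
            exact hb
          rw [this]
          simp
        · have : {u ∈ ({0} : Set (Fin N → ℕ)) | bidegree deg u = (n, m)} = ∅ := by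
            ext u
            simp only [Set.mem_singleton_iff, Set.mem_ofPred_eq, Set.mem_empty_iff_false, iff_false,
              not_and]
            rintro rfl h2
            exact h (h2.symm.trans hb)
          rw [this, Set.ncard_empty, coeff_one]
          split_ifs with hn
          · rw [coeff_one, if_neg]
            · simp
            · rintro rfl
              exact h (by rw [hn])
          · simp
      rw [h1]
      have := bimon_mul_partitionSeries_mem (0, 0) 0 0
      simpa [partitionSeries, denumSeries, bimon, inv_one_sub_X] using this
    · have hL0 : (L : Set (Fin N → ℕ)) = ∅ := by
        ext u
        simp only [SetLike.mem_coe, Set.mem_empty_iff_false, iff_false]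
        intro hu
        exact h0 (hsub u hu ▸ hu)
      have h1 : bidegreeSeries deg (L : Set (Fin N → ℕ)) = 0 := by
        ext n m
        rw [coeff_bidegreeSeries, hL0]
        simp
      rw [h1, mul_zero]
      exact zero_mem _
  | insert i S hi ih =>
    have := wellFoundedLT_lowerSet (Fin N → ℕ)
    intro L
    induction L using WellFoundedLT.induction with
    | ind L ihL =>
    intro hL
    set L' : LowerSet (Fin N → ℕ) := ⟨{u | u + Pi.single i 1 ∈ L}, fun u v huv hu =>
      L.lower (add_le_add_left huv _) hu⟩ with hL'
    set L0 : LowerSet (Fin N → ℕ) := ⟨{u ∈ L | u i = 0}, fun u v huv hu =>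
      ⟨L.lower huv hu.1, Nat.le_zero.1 (hu.2 ▸ huv i)⟩⟩ with hL0
    have key : bidegreeSeries deg L =
        bimon (deg i) * bidegreeSeries deg L' + bidegreeSeries deg L0 :=
      bidegreeSeries_eq_add hdeg L i
    have hle : L' ≤ L := fun u hu => L.lower le_self_add hu
    have h0 : C (mk 1 : ℚ⟦X⟧) * bidegreeSeries deg L0 ∈ partitionSums := by
      refine ih L0 fun u hu j hj => ?_
      by_cases hji : j = i
      · rw [hji]; exact hu.2
      · exact hL u hu.1 j (by simp [hji, hj])
    -- If the translate equals `L`, the recursion is solved by dividing by `1 - bimon (deg i)`.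
    -- Otherwise `L'` is strictly smaller and the descending chain condition applies. The slice `L0`
    -- has one active variable fewer.
    rcases hle.eq_or_lt with heq | hlt
    · rw [heq] at key
      refine mem_partitionSums_of_one_sub_bimon_mul_mem (hdeg i) ?_
      convert h0 using 1
      linear_combination C (mk 1 : ℚ⟦X⟧) * key
    · have h1 := ihL L' hlt fun u hu => hL u (hle hu)
      rw [key, mul_add, mul_left_comm]
      exact add_mem (bimon_mul_mem_partitionSums _ h1) h0

end LowerSets

/-! ### Standard monomials and dimensions of spans. -/

section StandardMonomials

open PowerSeries
open scoped PowerSeries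

/-- Greedy choice of a basis: adjoining the largest index raises the rank by one exactly when its
vector is not in the span of the earlier ones. -/
lemma finrank_span_image_finset {K V ι : Type*} [Field K] [AddCommGroup V] [Module K V]
    [LinearOrder ι] (v : ι → V) (S : Finset ι) :
    Module.finrank K (Submodule.span K (v '' (S : Set ι))) =
      {i ∈ (S : Set ι) | v i ∉ Submodule.span K (v '' {j ∈ (S : Set ι) | j < i})}.ncard := by
  classical
  induction S using Finset.induction_on_max with
  | empty =>
    rw [Finset.coe_empty, Set.image_empty, Submodule.span_empty, finrank_bot]
    simp
  | insert a S ha ih =>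
    have haS : a ∉ S := fun h => lt_irrefl a (ha a h)
    have hlow : {j ∈ ((insert a S : Finset ι) : Set ι) | j < a} = (S : Set ι) := by
      ext j
      simp only [Finset.coe_insert, Set.mem_insert_iff, Set.mem_ofPred_eq, Finset.mem_coe]
      constructor
      · rintro ⟨rfl | h, h2⟩
        · exact absurd h2 (lt_irrefl _)
        · exact h
      · exact fun h => ⟨Or.inr h, ha j h⟩
    have hlow' : ∀ i ∈ S, {j ∈ ((insert a S : Finset ι) : Set ι) | j < i} =
        {j ∈ (S : Set ι) | j < i} := by
      intro i hi
      ext j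
      simp only [Finset.coe_insert, Set.mem_insert_iff, Set.mem_ofPred_eq, Finset.mem_coe]
      constructor
      · rintro ⟨rfl | h, h2⟩
        · exact absurd h2 (ha i hi).not_gt
        · exact ⟨h, h2⟩
      · exact fun h => ⟨Or.inr h.1, h.2⟩
    have hspan : Submodule.span K (v '' ((insert a S : Finset ι) : Set ι)) =
        Submodule.span K {v a} ⊔ Submodule.span K (v '' (S : Set ι)) := by
      rw [Finset.coe_insert, Set.image_insert_eq, Submodule.span_insert]
    have hfin : FiniteDimensional K (Submodule.span K (v '' (S : Set ι))) :=
      FiniteDimensional.span_of_finite K (S.finite_toSet.image v)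
    by_cases hmem : v a ∈ Submodule.span K (v '' (S : Set ι))
    · rw [hspan, sup_eq_right.2 (by simpa using hmem), ih]
      congr 1
      ext i
      simp only [Set.mem_ofPred_eq]
      constructor
      · rintro ⟨h1, h2⟩
        exact ⟨by simp [Finset.mem_coe.1 h1], by rwa [hlow' i h1]⟩
      · rintro ⟨h1, h2⟩
        rcases Finset.mem_insert.1 (Finset.mem_coe.1 h1) with rfl | h
        · rw [hlow] at h2
          exact absurd hmem h2
        · exact ⟨h, by rwa [hlow' i h] at h2⟩
    · have hset : {i ∈ ((insert a S : Finset ι) : Set ι) | v i ∉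
          Submodule.span K (v '' {j ∈ ((insert a S : Finset ι) : Set ι) | j < i})} =
          insert a {i ∈ (S : Set ι) | v i ∉ Submodule.span K (v '' {j ∈ (S : Set ι) | j < i})} := by
        ext i
        simp only [Set.mem_ofPred_eq, Set.mem_insert_iff]
        constructor
        · rintro ⟨h1, h2⟩
          rcases Finset.mem_insert.1 (Finset.mem_coe.1 h1) with rfl | h
          · exact Or.inl rfl
          · exact Or.inr ⟨h, by rwa [hlow' i h] at h2⟩
        · rintro (rfl | ⟨h1, h2⟩)
          · exact ⟨by simp, by rwa [hlow]⟩
          · exact ⟨by simp [Finset.mem_coe.1 h1], by rwa [hlow' i h1]⟩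
      rw [hset, Set.ncard_insert_of_notMem (fun h => haS h.1)
        (S.finite_toSet.subset fun i hi => hi.1), hspan, ← ih]
      have h1 := Submodule.finrank_sup_add_finrank_inf_eq (Submodule.span K {v a})
        (Submodule.span K (v '' (S : Set ι)))
      have hva : v a ≠ 0 := fun h => hmem (h ▸ zero_mem _)
      have h2 : Submodule.span K {v a} ⊓ Submodule.span K (v '' (S : Set ι)) = ⊥ :=
        ((Submodule.disjoint_span_singleton' hva).2 hmem).symm.eq_bot
      rw [h2, finrank_bot, add_zero, finrank_span_singleton hva] at h1
      rw [h1, add_comm]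

variable {K B : Type*} [Field K] [CommRing B] [Algebra K B] {N : ℕ}

/-- The value of the monomial with exponent `u` at the point `x`. -/
def monomialValue (x : Fin N → B) (u : Fin N → ℕ) : B := ∏ i, x i ^ u i

lemma monomialValue_add (x : Fin N → B) (u v : Fin N → ℕ) :
    monomialValue x (u + v) = monomialValue x u * monomialValue x v := by
  simp [monomialValue, pow_add, Finset.prod_mul_distrib]

lemma monomialValue_single (x : Fin N → B) (i : Fin N) :
    monomialValue x (Pi.single i 1) = x i := by
  unfold monomialValue
  rw [Finset.prod_eq_single i]
  · simp
  · intro j _ hj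
    simp [hj]
  · simp

variable (K) in
/-- The span of the monomials of bidegree `p`. -/
def monomialSpan (deg : Fin N → ℕ × ℕ) (x : Fin N → B) (p : ℕ × ℕ) : Submodule K B :=
  Submodule.span K (monomialValue x '' {u | bidegree deg u = p})

variable (K) in
/-- The exponents of the monomials that are not in the span of the smaller monomials of the same
bidegree, in the lexicographic order. -/
def standardExponents (deg : Fin N → ℕ × ℕ) (x : Fin N → B) : LowerSet (Fin N → ℕ) where
  carrier := {u | monomialValue x u ∉ Submodule.span K
    (monomialValue x '' {w | bidegree deg w = bidegree deg u ∧ toLex w < toLex u})}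
  lower' := by
    intro u v huv hu hv
    refine hu ?_
    obtain ⟨c, rfl⟩ := exists_add_of_le huv
    -- A relation expressing the smaller monomial by still smaller ones, multiplied by the monomial
    -- with exponent `c`, is such a relation for the larger one, since the lexicographic order is
    -- compatible with addition.
    have h1 := Submodule.mem_map_of_mem (f := LinearMap.mulLeft K (monomialValue x c)) hv
    rw [Submodule.map_span, LinearMap.mulLeft_apply, mul_comm, ← monomialValue_add] at h1
    refine Submodule.span_mono ?_ h1
    rintro _ ⟨_, ⟨w, ⟨hw1, hw2⟩, rfl⟩, rfl⟩
    refine ⟨w + c, ⟨by rw [bidegree_add, bidegree_add, hw1], ?_⟩, ?_⟩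
    · exact add_lt_add_left hw2 (toLex c)
    · rw [LinearMap.mulLeft_apply, monomialValue_add, mul_comm]

lemma finrank_monomialSpan {deg : Fin N → ℕ × ℕ} (hdeg : ∀ i, IsGeneratorDegree (deg i))
    (x : Fin N → B) (p : ℕ × ℕ) : Module.finrank K (monomialSpan K deg x p) =
      {u ∈ (standardExponents K deg x : Set (Fin N → ℕ)) | bidegree deg u = p}.ncard := by
  have hfin := finite_bidegree_eq hdeg p
  have h := finrank_span_image_finset (K := K) (ι := Lex (Fin N → ℕ))
    (fun u => monomialValue x (ofLex u)) (hfin.toFinset.map toLex.toEmbedding)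
  have e1 : (fun u => monomialValue x (ofLex u)) ''
      ((hfin.toFinset.map toLex.toEmbedding : Finset (Lex (Fin N → ℕ))) : Set (Lex (Fin N → ℕ))) =
      monomialValue x '' {u | bidegree deg u = p} := by
    ext b
    simp
  rw [e1] at h
  rw [monomialSpan, h, ← Set.ncard_image_of_injective _ (toLex (α := Fin N → ℕ)).injective]
  congr 1
  ext u
  simp only [Finset.coe_map, Set.Finite.coe_toFinset, Set.mem_ofPred_eq, Set.mem_image]
  constructor
  · rintro ⟨⟨w, hw, rfl⟩, hu⟩
    refine ⟨w, ⟨fun hmem => hu ?_, hw⟩, rfl⟩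
    refine Submodule.span_mono ?_ hmem
    rintro _ ⟨z, ⟨hz1, hz2⟩, rfl⟩
    exact ⟨toLex z, ⟨⟨z, hz1.trans hw, rfl⟩, hz2⟩, rfl⟩
  · rintro ⟨w, ⟨hw, hwp⟩, rfl⟩
    refine ⟨⟨w, hwp, rfl⟩, fun hmem => hw ?_⟩
    refine Submodule.span_mono ?_ hmem
    rintro _ ⟨_, ⟨⟨z, hz1, rfl⟩, hz2⟩, rfl⟩
    exact ⟨z, ⟨Eq.trans hz1 hwp.symm, hz2⟩, rfl⟩

/-- Piecewise polynomial asymptotics of the cumulative dimensions of the spans of monomials. -/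
theorem piecewiseDensity_monomialSpan {deg : Fin N → ℕ × ℕ}
    (hdeg : ∀ i, IsGeneratorDegree (deg i)) (x : Fin N → B) {d : ℕ} {c : ℝ}
    (hc : ∀ q : ℕ × ℕ, ((∑ j ∈ Finset.range (q.2 + 1),
      Module.finrank K (monomialSpan K deg x (q.1, j)) : ℕ) : ℝ) ≤ c * ((q.2 : ℝ) + 1) ^ d) :
    PiecewiseDensity (fun q : ℕ × ℕ => ((∑ j ∈ Finset.range (q.2 + 1),
      Module.finrank K (monomialSpan K deg x (q.1, j)) : ℕ) : ℝ)) d := by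
  have h1 := C_mk_one_mul_bidegreeSeries_mem hdeg Finset.univ (standardExponents K deg x)
    (by simp)
  -- Multiplication by `(1 - s)⁻¹` forms the partial sums in `m`.
  have h2 : bicoeff (C (mk 1 : ℚ⟦X⟧) * bidegreeSeries deg (standardExponents K deg x)) =
      fun q : ℕ × ℕ => ((∑ j ∈ Finset.range (q.2 + 1),
        Module.finrank K (monomialSpan K deg x (q.1, j)) : ℕ) : ℝ) := by
    funext q
    unfold bicoeff
    rw [coeff_C_mul, mul_comm, coeff_mul,
      Finset.Nat.sum_antidiagonal_eq_sum_range_succ_mk]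
    push_cast
    refine Finset.sum_congr rfl fun j _ => ?_
    rw [coeff_bidegreeSeries, ← finrank_monomialSpan hdeg]
    simp
  rw [← h2]
  refine piecewiseDensity_of_mem_partitionSums h1 (K := c) fun q => ?_
  rw [h2]
  exact hc q

end StandardMonomials

end EpsilonDensity

namespace EpsilonDensity

/-! ### Derivatives of densities, jumps at cut points, and passage to multiples. -/

section OneSided

/-- The polynomial describing `cutEval Q` immediately to the left of `x`. -/
noncomputable def leftPoly (Q : ℚ →₀ ℚ[X]) (x : ℝ) : ℚ[X] :=
  Q.sum fun a q => by classical exact if (a : ℝ) < x then q else 0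

/-- The polynomial describing `cutEval Q` immediately to the right of `x`. -/
noncomputable def rightPoly (Q : ℚ →₀ ℚ[X]) (x : ℝ) : ℚ[X] :=
  Q.sum fun a q => by classical exact if (a : ℝ) ≤ x then q else 0

lemma cutEval_eq_aeval_leftPoly (Q : ℚ →₀ ℚ[X]) {x y : ℝ}
    (h : ∀ a ∈ Q.support, (a : ℝ) < y ↔ (a : ℝ) < x) :
    cutEval Q y = Polynomial.aeval y (leftPoly Q x) := by
  unfold cutEval leftPoly Finsupp.sum
  rw [map_sum]
  refine Finset.sum_congr rfl fun a ha => ?_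
  simp only [h a ha]
  split_ifs <;> simp

lemma cutEval_eq_aeval_rightPoly (Q : ℚ →₀ ℚ[X]) {x y : ℝ}
    (h : ∀ a ∈ Q.support, (a : ℝ) < y ↔ (a : ℝ) ≤ x) :
    cutEval Q y = Polynomial.aeval y (rightPoly Q x) := by
  unfold cutEval rightPoly Finsupp.sum
  rw [map_sum]
  refine Finset.sum_congr rfl fun a ha => ?_
  simp only [h a ha]
  split_ifs <;> simp

/-- Finitely many cut points leave a punctured neighbourhood of `x` free, so `cutEval` is polynomial
on either side of `x`. -/
lemma eventually_nhdsGT_avoid (E : Finset ℚ) (x : ℝ) : ∀ᶠ δ : ℝ in 𝓝[>] 0, ∀ a ∈ E,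
    ((a : ℝ) < x - δ ↔ (a : ℝ) < x) ∧ ((a : ℝ) < x + δ ↔ (a : ℝ) ≤ x) ∧
      (a : ℝ) ≠ x - δ ∧ (a : ℝ) ≠ x + δ := by
  rw [Finset.eventually_all]
  intro a _
  rcases lt_trichotomy (a : ℝ) x with h | h | h
  · filter_upwards [Ioo_mem_nhdsGT (sub_pos.2 h)] with δ hδ
    obtain ⟨h1, h2⟩ := hδ
    refine ⟨?_, ?_, ?_, ?_⟩
    · constructor <;> intro <;> linarith
    · constructor <;> intro <;> linarith
    · intro; linarith
    · intro; linarith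
  · filter_upwards [self_mem_nhdsWithin] with δ hδ
    have hδ' : (0 : ℝ) < δ := hδ
    refine ⟨?_, ?_, ?_, ?_⟩
    · constructor <;> intro <;> linarith
    · constructor <;> intro <;> linarith
    · intro; linarith
    · intro; linarith
  · filter_upwards [Ioo_mem_nhdsGT (sub_pos.2 h)] with δ hδ
    obtain ⟨h1, h2⟩ := hδ
    refine ⟨?_, ?_, ?_, ?_⟩
    · constructor <;> intro <;> linarith
    · constructor <;> intro <;> linarith
    · intro; linarith
    · intro; linarith

lemma tendsto_slopeFilter_add_floor {x δ : ℝ} (hδ : 0 ≤ δ) :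
    Tendsto (fun p : ℕ × ℕ => (p.1, p.2 + ⌊δ * p.1⌋₊)) (slopeFilter x) (slopeFilter (x + δ)) := by
  refine tendsto_slopeFilter (tendsto_fst_slopeFilter x) ?_
  have h1 := (tendsto_nat_floor_mul_div_atTop hδ).comp (tendsto_fst_real_slopeFilter x)
  refine ((tendsto_div_slopeFilter x).add h1).congr fun p => ?_
  simp only [Function.comp]
  push_cast
  rw [add_div]

lemma tendsto_slopeFilter_sub_floor {x δ : ℝ} (hδ : 0 ≤ δ) (hδx : δ < x) :
    (∀ᶠ p in slopeFilter x, ⌊δ * p.1⌋₊ < p.2) ∧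
    Tendsto (fun p : ℕ × ℕ => (p.1, p.2 - ⌊δ * p.1⌋₊)) (slopeFilter x) (slopeFilter (x - δ)) := by
  have h0 : ∀ᶠ p in slopeFilter x, ⌊δ * p.1⌋₊ < p.2 := by
    filter_upwards [eventually_mul_lt hδx] with p hp
    have : (⌊δ * p.1⌋₊ : ℝ) < p.2 := (Nat.floor_le (by positivity)).trans_lt hp
    exact_mod_cast this
  refine ⟨h0, tendsto_slopeFilter (tendsto_fst_slopeFilter x) ?_⟩
  have h1 := (tendsto_nat_floor_mul_div_atTop hδ).comp (tendsto_fst_real_slopeFilter x)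
  refine ((tendsto_div_slopeFilter x).sub h1).congr' ?_
  filter_upwards [h0] with p hp
  simp only [Function.comp]
  rw [Nat.cast_sub hp.le, sub_div]

lemma tendsto_aeval (P : ℚ[X]) {α : Type*} {l : Filter α} {f : α → ℝ} {x : ℝ}
    (hf : Tendsto f l (𝓝 x)) :
    Tendsto (fun a => Polynomial.aeval (f a) P) l (𝓝 (Polynomial.aeval x P)) :=
  (P.continuous_aeval.tendsto x).comp hf

lemma tendsto_slope_aeval_add (P : ℚ[X]) (x : ℝ) :
    Tendsto (fun δ : ℝ => (Polynomial.aeval (x + δ) P - Polynomial.aeval x P) / δ) (𝓝[>] 0)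
      (𝓝 (Polynomial.aeval x P.derivative)) := by
  have h := (P.hasDerivAt_aeval x).tendsto_slope_zero_right
  refine h.congr fun δ => ?_
  rw [smul_eq_mul, inv_mul_eq_div]

lemma tendsto_slope_aeval_sub (P : ℚ[X]) (x : ℝ) :
    Tendsto (fun δ : ℝ => (Polynomial.aeval x P - Polynomial.aeval (x - δ) P) / δ) (𝓝[>] 0)
      (𝓝 (Polynomial.aeval x P.derivative)) := by
  have h := (P.hasDerivAt_aeval x).tendsto_slope_zero_left
  have hneg : Tendsto (fun δ : ℝ => -δ) (𝓝[>] 0) (𝓝[<] 0) := by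
    simpa using tendsto_neg_nhdsGT (a := (0 : ℝ))
  refine (h.comp hneg).congr fun δ => ?_
  simp only [Function.comp, smul_eq_mul]
  rw [← sub_eq_add_neg, ← neg_sub, inv_neg, neg_mul_neg, inv_mul_eq_div]

lemma mapRange_derivative_sum (Q : ℚ →₀ ℚ[X]) (x : ℝ) :
    cutEval (Q.mapRange Polynomial.derivative Polynomial.derivative_zero) x =
      Polynomial.aeval x (leftPoly Q x).derivative := by
  rw [cutEval, Finsupp.sum_mapRange_index (by simp), leftPoly, Finsupp.sum, Finsupp.sum,
    Polynomial.derivative_sum, map_sum]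
  refine Finset.sum_congr rfl fun a _ => ?_
  split_ifs <;> simp

/-- The density of a nondecreasing function is the derivative of the density of its sums. -/
theorem PiecewiseDensity.of_cumulative {h : ℕ × ℕ → ℝ} {d : ℕ}
    (hmono : ∀ n, Monotone fun m => h (n, m))
    (hH : PiecewiseDensity (fun p => ∑ j ∈ Finset.range (p.2 + 1), h (p.1, j)) (d + 1)) :
    PiecewiseDensity h d := by
  set H : ℕ × ℕ → ℝ := fun p => ∑ j ∈ Finset.range (p.2 + 1), h (p.1, j) with hHdef
  obtain ⟨E, Q, h1, h2, h3, h4⟩ := hH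
  refine ⟨E, Q.mapRange Polynomial.derivative Polynomial.derivative_zero,
    Finsupp.support_mapRange.trans h1, h2, fun a => ?_, fun x hx hxE => ?_⟩
  · rw [Finsupp.mapRange_apply]
    exact (Polynomial.natDegree_derivative_le _).trans (Nat.sub_le_of_le_add (h3 a))
  rw [mapRange_derivative_sum]
  have hsum : ∀ n m k : ℕ, H (n, m + k) - H (n, m) = ∑ i ∈ Finset.range k, h (n, m + 1 + i) := by
    intro n m k
    simp only [hHdef]
    rw [show m + k + 1 = (m + 1) + k by ring, Finset.sum_range_add, add_sub_cancel_left]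
  -- Monotonicity places `h` between the backward and the forward difference quotient of `H` with
  -- step `k = ⌊δ n⌋`. Their limits are difference quotients of the cumulative density, which tend
  -- to its derivative as `δ → 0`.
  have hup : ∀ n m k : ℕ, (k : ℝ) * h (n, m) ≤ H (n, m + k) - H (n, m) := by
    intro n m k
    rw [hsum]
    calc (k : ℝ) * h (n, m) = ∑ i ∈ Finset.range k, h (n, m) := by simp
      _ ≤ _ := Finset.sum_le_sum fun i _ => hmono n (by omega)
  have hlow : ∀ n m k : ℕ, H (n, m + k) - H (n, m) ≤ (k : ℝ) * h (n, m + k) := by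
    intro n m k
    rw [hsum]
    calc _ ≤ ∑ i ∈ Finset.range k, h (n, m + k) :=
        Finset.sum_le_sum fun i hi => hmono n (by have := Finset.mem_range.1 hi; omega)
      _ = _ := by simp
  have hk : ∀ δ : ℝ, 0 < δ → Tendsto (fun p : ℕ × ℕ => (p.1 : ℝ) / (⌊δ * p.1⌋₊ : ℝ))
      (slopeFilter x) (𝓝 δ⁻¹) := by
    intro δ hδ
    have := ((tendsto_nat_floor_mul_div_atTop hδ.le).comp
      (tendsto_fst_real_slopeFilter x)).inv₀ hδ.ne'
    simpa [Function.comp_def] using this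
  have hkpos : ∀ δ : ℝ, 0 < δ → ∀ᶠ p in slopeFilter x, 0 < ⌊δ * p.1⌋₊ := by
    intro δ hδ
    filter_upwards [(tendsto_fst_real_slopeFilter x).eventually (eventually_ge_atTop (1 / δ))]
      with p hp
    rw [Nat.floor_pos]
    rwa [div_le_iff₀' hδ] at hp
  have hx0 := h4 x hx hxE
  have hev := (eventually_nhdsGT_avoid E x).and
    ((Ioo_mem_nhdsGT hx : Set.Ioo (0 : ℝ) x ∈ 𝓝[>] 0))
  -- At a slope that is not a cut point both one-sided polynomials coincide, so both difference
  -- quotients have the same limit.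
  have heq : rightPoly Q x = leftPoly Q x := by
    unfold rightPoly leftPoly
    refine Finsupp.sum_congr fun a ha => ?_
    have : (a : ℝ) ≤ x ↔ (a : ℝ) < x :=
      ⟨fun h => lt_of_le_of_ne h (hxE a (h1 ha)), le_of_lt⟩
    simp only [this]
  have hcx : cutEval Q x = Polynomial.aeval x (leftPoly Q x) :=
    cutEval_eq_aeval_leftPoly Q fun a _ => Iff.rfl
  rw [hcx] at hx0
  unfold HasDensity at hx0
  refine tendsto_order.2 ⟨fun b hb => ?_, fun b hb => ?_⟩
  · obtain ⟨δ, ⟨hδ1, hδ2, hδ3⟩, hδ4⟩ := (hev.and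
      ((tendsto_slope_aeval_sub (leftPoly Q x) x).eventually (lt_mem_nhds hb))).exists
    have hy := h4 (x - δ) (by linarith) fun a ha => (hδ1 a ha).2.2.1
    rw [cutEval_eq_aeval_leftPoly Q (x := x) fun a ha => (hδ1 a (h1 ha)).1] at hy
    unfold HasDensity at hy
    obtain ⟨e1, e2⟩ := tendsto_slopeFilter_sub_floor hδ2.le hδ3
    have h5 := (hx0.sub (hy.comp e2)).mul (hk δ hδ2)
    rw [← div_eq_mul_inv] at h5
    filter_upwards [h5.eventually (lt_mem_nhds hδ4), e1, hkpos δ hδ2, eventually_fst_pos x]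
      with p hp1 hp2 hp3 hp4
    refine hp1.trans_le ?_
    have hp3' : (0 : ℝ) < ⌊δ * p.1⌋₊ := by exact_mod_cast hp3
    have hp4' : (0 : ℝ) < p.1 := by exact_mod_cast hp4
    have h6 := hlow p.1 (p.2 - ⌊δ * p.1⌋₊) ⌊δ * p.1⌋₊
    rw [Nat.sub_add_cancel hp2.le] at h6
    simp only [Function.comp]
    rw [← sub_div, pow_succ, div_mul_div_comm, div_le_div_iff₀ (by positivity) (by positivity)]
    calc _ = (H (p.1, p.2) - H (p.1, p.2 - ⌊δ * p.1⌋₊)) * ((p.1 : ℝ) ^ d * p.1) := by ring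
      _ ≤ (⌊δ * p.1⌋₊ * h (p.1, p.2)) * ((p.1 : ℝ) ^ d * p.1) := by gcongr
      _ = _ := by ring
  · obtain ⟨δ, ⟨hδ1, hδ2, hδ3⟩, hδ4⟩ := (hev.and
      ((tendsto_slope_aeval_add (leftPoly Q x) x).eventually (gt_mem_nhds hb))).exists
    have hy := h4 (x + δ) (by linarith) fun a ha => (hδ1 a ha).2.2.2
    rw [cutEval_eq_aeval_rightPoly Q (x := x) fun a ha => (hδ1 a (h1 ha)).2.1, heq] at hy
    unfold HasDensity at hy
    have e2 := tendsto_slopeFilter_add_floor (x := x) hδ2.le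
    have h5 := ((hy.comp e2).sub hx0).mul (hk δ hδ2)
    rw [← div_eq_mul_inv] at h5
    filter_upwards [h5.eventually (gt_mem_nhds hδ4), hkpos δ hδ2, eventually_fst_pos x]
      with p hp1 hp3 hp4
    refine lt_of_le_of_lt ?_ hp1
    have hp3' : (0 : ℝ) < ⌊δ * p.1⌋₊ := by exact_mod_cast hp3
    have hp4' : (0 : ℝ) < p.1 := by exact_mod_cast hp4
    have h6 := hup p.1 p.2 ⌊δ * p.1⌋₊
    simp only [Function.comp]
    rw [← sub_div, pow_succ, div_mul_div_comm, div_le_div_iff₀ (by positivity) (by positivity)]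
    calc _ = (⌊δ * p.1⌋₊ * h (p.1, p.2)) * ((p.1 : ℝ) ^ d * p.1) := by ring
      _ ≤ (H (p.1, p.2 + ⌊δ * p.1⌋₊) - H (p.1, p.2)) * ((p.1 : ℝ) ^ d * p.1) := by gcongr
      _ = _ := by ring

/-- A function which is nondecreasing in the directions `(0, 1)` and `(1, e)` has a density at
every slope larger than `e`. -/
theorem PiecewiseDensity.exists_hasDensity {h : ℕ × ℕ → ℝ} {d e : ℕ}
    (hmono : ∀ n, Monotone fun m => h (n, m)) (hmono' : ∀ n m, h (n, m) ≤ h (n + 1, m + e))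
    (hh : PiecewiseDensity h d) {x : ℝ} (hx : (e : ℝ) < x) : ∃ l, HasDensity h d x l := by
  obtain ⟨E, Q, h1, h2, h3, h4⟩ := hh
  have hx0 : 0 < x := (Nat.cast_nonneg e).trans_lt hx
  have hev := (eventually_nhdsGT_avoid E x).and
    ((Ioo_mem_nhdsGT (sub_pos.2 hx) : Set.Ioo (0 : ℝ) (x - e) ∈ 𝓝[>] 0))
  have hleft : ∀ᶠ δ : ℝ in 𝓝[>] 0,
      HasDensity h d (x - δ) (Polynomial.aeval (x - δ) (leftPoly Q x)) := by
    filter_upwards [hev] with δ hδ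
    have he : (0 : ℝ) ≤ e := Nat.cast_nonneg e
    have hy := h4 (x - δ) (by linarith [hδ.2.2]) fun a ha => (hδ.1 a ha).2.2.1
    rwa [cutEval_eq_aeval_leftPoly Q (x := x) fun a ha => (hδ.1 a (h1 ha)).1] at hy
  have hright : ∀ᶠ δ : ℝ in 𝓝[>] 0,
      HasDensity h d (x + δ) (Polynomial.aeval (x + δ) (rightPoly Q x)) := by
    filter_upwards [hev] with δ hδ
    have hy := h4 (x + δ) (by linarith [hδ.2.1]) fun a ha => (hδ.1 a ha).2.2.2
    rwa [cutEval_eq_aeval_rightPoly Q (x := x) fun a ha => (hδ.1 a (h1 ha)).2.1] at hy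
  have hid : Tendsto (fun δ : ℝ => δ) (𝓝[>] 0) (𝓝 0) := tendsto_nhdsWithin_of_tendsto_nhds tendsto_id
  have tl : Tendsto (fun δ : ℝ => Polynomial.aeval (x - δ) (leftPoly Q x)) (𝓝[>] 0)
      (𝓝 (Polynomial.aeval x (leftPoly Q x))) := by
    refine tendsto_aeval _ ?_
    simpa using hid.const_sub x
  have tr : Tendsto (fun δ : ℝ => Polynomial.aeval (x + δ) (rightPoly Q x)) (𝓝[>] 0)
      (𝓝 (Polynomial.aeval x (rightPoly Q x))) := by
    refine tendsto_aeval _ ?_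
    simpa using hid.const_add x
  have hle1 : Polynomial.aeval x (leftPoly Q x) ≤ Polynomial.aeval x (rightPoly Q x) := by
    refine le_of_tendsto_of_tendsto tl tr ?_
    filter_upwards [hleft, hright, hev] with δ hl hr hδ
    have he : (0 : ℝ) ≤ e := Nat.cast_nonneg e
    have hl' := hl.comp (tendsto_floor_slopeFilter (x := x - δ) (by linarith [hδ.2.2]))
    have hr' := hr.comp (tendsto_floor_slopeFilter (x := x + δ) (by linarith [hδ.2.1]))
    refine le_of_tendsto_of_tendsto' hl' hr' fun n => ?_
    simp only [Function.comp]
    refine div_le_div_of_nonneg_right (hmono n ?_) (by positivity)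
    exact Nat.floor_mono (mul_le_mul_of_nonneg_right (by linarith [hδ.2.1]) (Nat.cast_nonneg n))
  have hiter : ∀ i n m, h (n, m) ≤ h (n + i, m + e * i) := by
    intro i
    induction i with
    | zero => intro n m; simp
    | succ i ih =>
      intro n m
      refine (ih n m).trans ((hmono' _ _).trans (le_of_eq ?_))
      congr 2
      ring
  -- From slope `x + δ`, about `η n` steps in the direction `(1, e)` lead to slope `x - δ`. Solving
  -- `(x + δ + e η) / (1 + η) = x - δ` gives this `η`, which uses `x - δ > e`. The larger value of
  -- `n` costs a factor `(1 + η) ^ d`, which tends to `1`.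
  have hle2 : Polynomial.aeval x (rightPoly Q x) ≤ Polynomial.aeval x (leftPoly Q x) := by
    set η : ℝ → ℝ := fun δ => 2 * δ / (x - δ - e) with hη
    have tη : Tendsto η (𝓝[>] 0) (𝓝 0) := by
      have t1 : Tendsto (fun δ : ℝ => 2 * δ / (x - δ - e)) (𝓝[>] 0)
          (𝓝 (2 * 0 / (x - 0 - e))) := by
        refine Tendsto.div (hid.const_mul 2) ((hid.const_sub x).sub_const _) ?_
        rw [sub_zero]
        exact (sub_pos.2 hx).ne'
      simpa using t1
    have t2 : Tendsto (fun δ : ℝ => (1 + η δ) ^ d * Polynomial.aeval (x - δ) (leftPoly Q x))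
        (𝓝[>] 0) (𝓝 ((1 + 0) ^ d * Polynomial.aeval x (leftPoly Q x))) :=
      ((tη.const_add 1).pow d).mul tl
    rw [add_zero, one_pow, one_mul] at t2
    refine le_of_tendsto_of_tendsto tr t2 ?_
    filter_upwards [hleft, hright, hev] with δ hl hr hδ
    have he : (0 : ℝ) ≤ e := Nat.cast_nonneg e
    obtain ⟨hδ1, hδ2, hδ3⟩ := hδ
    have hpos : 0 < x - δ - e := by linarith
    have hη0 : 0 ≤ η δ := by simp only [hη]; positivity
    have hr' := hr.comp (tendsto_floor_slopeFilter (x := x + δ) (by linarith))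
    have f1 := (tendsto_nat_floor_mul_div_atTop (R := ℝ) hη0).comp tendsto_natCast_atTop_atTop
    have f2 := (tendsto_nat_floor_mul_div_atTop (R := ℝ) (a := x + δ) (by linarith)).comp
      tendsto_natCast_atTop_atTop
    have hmap : Tendsto (fun n : ℕ => (n + ⌊η δ * n⌋₊, ⌊(x + δ) * n⌋₊ + e * ⌊η δ * n⌋₊)) atTop
        (slopeFilter (x - δ)) := by
      refine tendsto_slopeFilter (tendsto_atTop_mono (fun n => Nat.le_add_right _ _) tendsto_id) ?_
      have f3 := (f2.add (f1.const_mul (e : ℝ))).div (f1.const_add 1) (by positivity)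
      have e1 : (x + δ + e * η δ) / (1 + η δ) = x - δ := by
        simp only [hη]
        field_simp
        ring
      rw [e1] at f3
      refine f3.congr' ?_
      filter_upwards [eventually_gt_atTop 0] with n hn
      have hn' : (0 : ℝ) < n := by exact_mod_cast hn
      simp only [Function.comp]
      push_cast
      simp only [Pi.div_apply]
      field_simp
    have hl' := (hl.comp hmap).mul ((f1.const_add 1).pow d)
    rw [mul_comm] at hl'
    refine le_of_tendsto_of_tendsto hr' hl' ?_
    filter_upwards [eventually_gt_atTop 0] with n hn
    have hn' : (0 : ℝ) < n := by exact_mod_cast hn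
    simp only [Function.comp]
    have e2 : (1 + (⌊η δ * n⌋₊ : ℝ) / n) = ((n + ⌊η δ * n⌋₊ : ℕ) : ℝ) / n := by
      push_cast
      field_simp
    rw [e2, div_pow, div_mul_div_cancel₀ (by positivity)]
    exact div_le_div_of_nonneg_right (hiter _ _ _) (by positivity)
  have heq := le_antisymm hle1 hle2
  refine ⟨Polynomial.aeval x (leftPoly Q x), tendsto_order.2 ⟨fun b hb => ?_, fun b hb => ?_⟩⟩
  · obtain ⟨δ, ⟨h5, h6⟩, h7⟩ := ((tl.eventually (lt_mem_nhds hb)).and hleft |>.and hev).exists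
    have he : (0 : ℝ) ≤ e := Nat.cast_nonneg e
    obtain ⟨e1, e2⟩ := tendsto_slopeFilter_sub_floor (x := x) h7.2.1.le (by linarith [h7.2.2])
    filter_upwards [(h6.comp e2).eventually (lt_mem_nhds h5)] with p hp
    exact hp.trans_le (div_le_div_of_nonneg_right (hmono p.1 (Nat.sub_le _ _)) (by positivity))
  · rw [heq] at hb
    obtain ⟨δ, ⟨h5, h6⟩, h7⟩ := ((tr.eventually (gt_mem_nhds hb)).and hright |>.and hev).exists
    have e2 := tendsto_slopeFilter_add_floor (x := x) h7.2.1.le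
    filter_upwards [(h6.comp e2).eventually (gt_mem_nhds h5)] with p hp
    exact lt_of_le_of_lt
      (div_le_div_of_nonneg_right (hmono p.1 (Nat.le_add_right _ _)) (by positivity)) hp

/-- A function nonincreasing in `n` has a density as soon as it has one along the multiples
of `r`. -/
theorem HasDensity.of_multiples {g g' : ℕ × ℕ → ℝ} {D r : ℕ} (hr : 0 < r)
    (hanti : ∀ n n' j, n ≤ n' → g (n', j) ≤ g (n, j))
    (hg : ∀ k j, 1 ≤ k → g (r * k, j) = g' (k, j)) {x l : ℝ}
    (h : HasDensity g' D (r * x) l) : HasDensity g D x (l / r ^ D) := by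
  have hr' : (0 : ℝ) < r := by exact_mod_cast hr
  have hdiv : Tendsto (fun p : ℕ × ℕ => ((p.1 / r : ℕ) : ℝ) / p.1) (slopeFilter x)
      (𝓝 (r : ℝ)⁻¹) := by
    have h1 := ((tendsto_nat_floor_mul_div_atTop (R := ℝ) (a := (r : ℝ)⁻¹) (by positivity)).comp
      (tendsto_fst_real_slopeFilter x))
    refine h1.congr fun p => ?_
    simp only [Function.comp]
    rw [inv_mul_eq_div, Nat.floor_div_natCast, Nat.floor_natCast]
  have hdiv' : Tendsto (fun p : ℕ × ℕ => ((p.1 / r + 1 : ℕ) : ℝ) / p.1) (slopeFilter x)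
      (𝓝 (r : ℝ)⁻¹) := by
    have h1 := hdiv.add ((tendsto_fst_real_slopeFilter x).const_div_atTop 1)
    rw [add_zero] at h1
    refine h1.congr fun p => ?_
    push_cast
    rw [add_div]
  have hbig : Tendsto (fun p : ℕ × ℕ => p.1 / r) (slopeFilter x) atTop :=
    (Nat.tendsto_div_const_atTop hr.ne').comp (tendsto_fst_slopeFilter x)
  have key : ∀ f : ℕ × ℕ → ℕ, Tendsto f (slopeFilter x) atTop →
      Tendsto (fun p => (f p : ℝ) / p.1) (slopeFilter x) (𝓝 (r : ℝ)⁻¹) →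
      Tendsto (fun p => g' (f p, p.2) / (p.1 : ℝ) ^ D) (slopeFilter x) (𝓝 (l / r ^ D)) := by
    intro f hf1 hf2
    have hmap : Tendsto (fun p : ℕ × ℕ => (f p, p.2)) (slopeFilter x) (slopeFilter (r * x)) := by
      refine tendsto_slopeFilter hf1 ?_
      have h1 := (tendsto_div_slopeFilter x).div hf2 (by positivity)
      rw [div_inv_eq_mul, mul_comm] at h1
      refine h1.congr' ?_
      filter_upwards [eventually_fst_pos x] with p hp
      have hp' : (0 : ℝ) < p.1 := by exact_mod_cast hp
      simp only [Pi.div_apply]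
      rw [div_div_div_cancel_right₀ hp'.ne']
    have h1 := (h.comp hmap).mul (hf2.pow D)
    rw [inv_pow, ← div_eq_mul_inv] at h1
    refine h1.congr' ?_
    filter_upwards [hf1.eventually (eventually_gt_atTop 0)] with p hp
    have hp' : (0 : ℝ) < f p := by exact_mod_cast hp
    simp only [Function.comp]
    rw [div_pow, div_mul_div_cancel₀ (by positivity)]
  -- The index `n` is enclosed between the consecutive multiples `r ⌊n / r⌋` and `r (⌊n / r⌋ + 1)`,
  -- at which `g` is given by `g'`.
  refine tendsto_of_tendsto_of_tendsto_of_le_of_le' (key (fun p => p.1 / r + 1) ?_ hdiv')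
    (key (fun p => p.1 / r) hbig hdiv) ?_ ?_
  · exact tendsto_atTop_mono (fun p => Nat.le_add_right _ _) hbig
  · refine Eventually.of_forall fun p => div_le_div_of_nonneg_right ?_ (by positivity)
    rw [← hg (p.1 / r + 1) _ (Nat.le_add_left _ _)]
    exact hanti _ _ _ (Nat.lt_mul_div_succ p.1 hr).le
  · filter_upwards [hbig.eventually (eventually_ge_atTop 1)] with p hp
    refine div_le_div_of_nonneg_right ?_ (by positivity)
    rw [← hg _ _ hp]
    exact hanti _ _ _ (Nat.mul_div_le p.1 r)

/-- The substitution `x ↦ r x` moves the cut point `a` to `a / r`; the factor `r ^ D` comes from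
normalizing by `n ^ D` instead of `(n / r) ^ D`. -/
lemma cutEval_scale (Q : ℚ →₀ ℚ[X]) {r : ℕ} (hr : 0 < r) (D : ℕ) (x : ℝ) :
    cutEval (Finsupp.mapRange
      (fun q => Polynomial.C ((1 / (r : ℚ) ^ D : ℚ)) * q.comp (Polynomial.C (r : ℚ) * Polynomial.X))
      (by simp) (Q.mapDomain fun a => a / r)) x = cutEval Q (r * x) / (r : ℝ) ^ D := by
  have hr' : (0 : ℝ) < r := by exact_mod_cast hr
  have hinj : Function.Injective fun a : ℚ => a / r := fun a b hab => by
    have : (r : ℚ) ≠ 0 := by exact_mod_cast hr.ne'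
    simpa [div_left_inj' this] using hab
  rw [cutEval, Finsupp.sum_mapRange_index (by simp), Finsupp.sum_mapDomain_index_inj hinj,
    cutEval, Finsupp.sum, Finsupp.sum, Finset.sum_div]
  refine Finset.sum_congr rfl fun a _ => ?_
  have : ((a / r : ℚ) : ℝ) < x ↔ (a : ℝ) < r * x := by
    push_cast
    rw [div_lt_iff₀' hr']
  simp only [this]
  split_ifs
  · simp only [map_mul, Polynomial.aeval_C, Polynomial.aeval_comp, Polynomial.aeval_X]
    push_cast [eq_ratCast]
    simp
    ring
  · simp

theorem PiecewiseDensity.of_multiples {g g' : ℕ × ℕ → ℝ} {D r : ℕ} (hr : 0 < r)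
    (hanti : ∀ n n' j, n ≤ n' → g (n', j) ≤ g (n, j))
    (hg : ∀ k j, 1 ≤ k → g (r * k, j) = g' (k, j))
    (h : PiecewiseDensity g' D) : PiecewiseDensity g D := by
  classical
  have hr' : (0 : ℝ) < r := by exact_mod_cast hr
  obtain ⟨E, Q, h1, h2, h3, h4⟩ := h
  refine ⟨E.image fun a => a / r, Finsupp.mapRange
      (fun q => Polynomial.C ((1 / (r : ℚ) ^ D : ℚ)) * q.comp (Polynomial.C (r : ℚ) * Polynomial.X))
      (by simp) (Q.mapDomain fun a => a / r), ?_, ?_, ?_, ?_⟩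
  · exact (Finsupp.support_mapRange.trans Finsupp.mapDomain_support).trans
      (Finset.image_subset_image h1)
  · intro a ha
    obtain ⟨b, hb, rfl⟩ := Finset.mem_image.1 ha
    exact div_nonneg (h2 b hb) (Nat.cast_nonneg r)
  · intro a
    have hinj : Function.Injective fun a : ℚ => a / r := fun a b hab => by
      have : (r : ℚ) ≠ 0 := by exact_mod_cast hr.ne'
      simpa [div_left_inj' this] using hab
    have ha : a = (fun a : ℚ => a / r) (a * r) := by
      have : (r : ℚ) ≠ 0 := by exact_mod_cast hr.ne'
      simp [this]
    rw [Finsupp.mapRange_apply]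
    nth_rewrite 1 [ha]
    rw [Finsupp.mapDomain_apply hinj]
    refine (Polynomial.natDegree_C_mul_le _ _).trans ?_
    refine (Polynomial.natDegree_comp_le).trans ?_
    calc _ ≤ D * 1 := Nat.mul_le_mul (h3 _) ((Polynomial.natDegree_C_mul_le _ _).trans
        Polynomial.natDegree_X_le)
      _ = D := mul_one D
  · intro x hx hxE
    rw [cutEval_scale Q hr]
    refine HasDensity.of_multiples hr hanti hg (h4 _ (by positivity) fun a ha hax => ?_)
    refine hxE (a / r) (Finset.mem_image_of_mem _ ha) ?_
    push_cast
    rw [hax]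
    field_simp

end OneSided

end EpsilonDensity

namespace EpsilonDensity

/-! ### Polynomial growth bounded by the Krull dimension. -/

section Growth

/-- Lying over lifts the first prime of a chain, and going up lifts the rest with the same length.
-/
lemma ringKrullDim_le_of_isIntegral_of_injective {R S : Type*} [CommRing R] [CommRing S]
    [Algebra R S] [Algebra.IsIntegral R S] (hinj : Function.Injective (algebraMap R S)) :
    ringKrullDim R ≤ ringKrullDim S := by
  unfold ringKrullDim Order.krullDim
  refine iSup_le fun l => ?_
  obtain ⟨Q, -, hQ, hQc⟩ := Ideal.exists_ideal_over_prime_of_isIntegral l.head.asIdeal (⊥ : Ideal S)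
    (by rw [← RingHom.ker_eq_comap_bot, (RingHom.injective_iff_ker_eq_bot _).1 hinj]; exact bot_le)
  have : Q.LiesOver l.head.asIdeal := ⟨hQc.symm⟩
  obtain ⟨L, hL, -⟩ := Ideal.exists_ltSeries_of_hasGoingUp l Q
  rw [← hL]
  exact le_iSup (fun p : LTSeries (PrimeSpectrum S) => (p.length : WithBot ℕ∞)) L

/-- A finitely generated algebra of dimension `d` has an exhaustive filtration with polynomial
growth of degree at most `d`. -/
lemma exists_filtration_growth (k : Type*) {A : Type*} [Field k] [CommRing A] [Nontrivial A]
    [Algebra k A] [Algebra.FiniteType k A] {d : ℕ} (hd : ringKrullDim A = (d : WithBot ℕ∞)) :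
    ∃ (V : ℕ → Submodule k A) (c : ℕ), Monotone V ∧ (∀ a, ∃ D, a ∈ V D) ∧
      (∀ x : A, ∃ D, ∀ n, ∀ y ∈ V n, x * y ∈ V (n + D)) ∧ (∀ n, (V n).FG) ∧
      ∀ n, Module.finrank k (V n) ≤ c * (n + 1) ^ d := by
  classical
  obtain ⟨s, g, hg, hfin⟩ := exists_finite_inj_algHom_of_fg k A
  -- Noether normalization embeds a polynomial ring in `s` variables with `A` finite over it, so `s`
  -- cannot exceed the dimension of `A`.
  have hs : s ≤ d := by
    let := g.toRingHom.toAlgebra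
    have hfin' : Module.Finite (MvPolynomial (Fin s) k) A := hfin
    have h1 := ringKrullDim_le_of_isIntegral_of_injective
      (R := MvPolynomial (Fin s) k) (S := A) hg
    rw [MvPolynomial.ringKrullDim_of_isNoetherianRing, ringKrullDim_eq_zero_of_field, hd,
      zero_add, Nat.card_fin] at h1
    exact_mod_cast h1
  obtain ⟨T, hT⟩ : ∃ T : Finset A, ∀ S : AddSubmonoid A, (T : Set A) ⊆ S →
      (∀ b : MvPolynomial (Fin s) k, ∀ a ∈ S, g b * a ∈ S) → S = ⊤ := by
    let := g.toRingHom.toAlgebra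
    have hfin' : Module.Finite (MvPolynomial (Fin s) k) A := hfin
    obtain ⟨T, hT⟩ := hfin'.fg_top
    refine ⟨T, fun S hS hS' => ?_⟩
    let S' : Submodule (MvPolynomial (Fin s) k) A := { S with smul_mem' := fun b a ha => hS' b a ha }
    have h1 : Submodule.span (MvPolynomial (Fin s) k) (T : Set A) ≤ S' := Submodule.span_le.2 hS
    rw [hT] at h1
    exact eq_top_iff.2 fun a _ => h1 (Submodule.mem_top (x := a))
  set y : Fin s → A := fun i => g (MvPolynomial.X i) with hy
  -- The space `V n` uses all monomials with every exponent at most `n`, times the module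
  -- generators; there are at most `(n + 1) ^ s` times `T.card` of them.
  set gen : ℕ → Finset A := fun n =>
    (Finset.Iic (fun _ : Fin s => n) ×ˢ T).image fun p => monomialValue y p.1 * p.2 with hgen
  set V : ℕ → Submodule k A := fun n => Submodule.span k (gen n : Set A) with hV
  have hgenmem : ∀ n u w, u ≤ (fun _ : Fin s => n) → w ∈ T → monomialValue y u * w ∈ V n := by
    intro n u w hu hw
    refine Submodule.subset_span (Finset.mem_coe.2 (Finset.mem_image.2 ⟨(u, w), ?_, rfl⟩))
    exact Finset.mem_product.2 ⟨Finset.mem_Iic.2 hu, hw⟩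
  have hind : ∀ (n : ℕ) (P : Submodule k A),
      (∀ u w, u ≤ (fun _ : Fin s => n) → w ∈ T → monomialValue y u * w ∈ P) → V n ≤ P := by
    intro n P hP
    refine Submodule.span_le.2 fun a ha => ?_
    obtain ⟨⟨u, w⟩, h1, rfl⟩ := Finset.mem_image.1 (Finset.mem_coe.1 ha)
    obtain ⟨h2, h3⟩ := Finset.mem_product.1 h1
    exact hP u w (Finset.mem_Iic.1 h2) h3
  have hmono : Monotone V := fun m n hmn => hind m _ fun u w hu hw =>
    hgenmem n u w (hu.trans fun _ => hmn) hw
  have hmon : ∀ u a n D, u ≤ (fun _ : Fin s => n) → a ∈ V D → monomialValue y u * a ∈ V (n + D) := by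
    intro u a n D hu ha
    have : V D ≤ (V (n + D)).comap (LinearMap.mulLeft k (monomialValue y u)) := by
      refine hind D _ fun v w hv hw => ?_
      rw [Submodule.mem_comap, LinearMap.mulLeft_apply, ← mul_assoc, ← monomialValue_add]
      exact hgenmem _ _ _ (add_le_add hu hv) hw
    exact this ha
  have hexh : ∀ a, ∃ D, a ∈ V D := by
    let S : AddSubmonoid A :=
      { carrier := {a | ∃ D, a ∈ V D}
        zero_mem' := ⟨0, zero_mem _⟩
        add_mem' := by
          rintro a b ⟨D, ha⟩ ⟨D', hb⟩
          exact ⟨max D D', add_mem (hmono (le_max_left _ _) ha) (hmono (le_max_right _ _) hb)⟩ }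
    have hS : S = ⊤ := by
      refine hT S (fun w hw => ⟨0, ?_⟩) fun b => ?_
      · have := hgenmem 0 0 w (fun _ => le_rfl) hw
        simpa [monomialValue] using this
      · induction b using MvPolynomial.induction_on with
        | C c =>
          rintro a ⟨D, ha⟩
          refine ⟨D, ?_⟩
          have : g (MvPolynomial.C c) = algebraMap k A c := g.commutes c
          rw [this, ← Algebra.smul_def]
          exact Submodule.smul_mem _ _ ha
        | add p q hp hq =>
          intro a ha
          rw [map_add, add_mul]
          exact add_mem (hp a ha) (hq a ha)
        | mul_X p i hp =>
          rintro a ⟨D, ha⟩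
          rw [map_mul, mul_assoc]
          refine hp _ ⟨1 + D, ?_⟩
          have := hmon (Pi.single i 1) a 1 D (fun j => by
            rw [Pi.single_apply]; split_ifs <;> simp) ha
          rwa [monomialValue_single] at this
    intro a
    have : a ∈ S := hS ▸ AddSubmonoid.mem_top a
    exact this
  refine ⟨V, T.card, hmono, hexh, fun x => ?_, fun n => ⟨gen n, rfl⟩, fun n => ?_⟩
  · choose D hD using fun w : A => hexh (x * w)
    refine ⟨T.sup D, fun n a ha => ?_⟩
    have : V n ≤ (V (n + T.sup D)).comap (LinearMap.mulLeft k x) := by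
      refine hind n _ fun u w hu hw => ?_
      rw [Submodule.mem_comap, LinearMap.mulLeft_apply, mul_left_comm]
      exact hmon _ _ _ _ hu (hmono (Finset.le_sup hw) (hD w))
    exact this ha
  · calc Module.finrank k (V n) ≤ (gen n).card := finrank_span_finset_le_card (gen n)
      _ ≤ (Finset.Iic (fun _ : Fin s => n) ×ˢ T).card := Finset.card_image_le
      _ = T.card * (n + 1) ^ s := by
        rw [Finset.card_product, Pi.card_Iic, mul_comm]
        simp
      _ ≤ T.card * (n + 1) ^ d :=
        Nat.mul_le_mul_left _ (Nat.pow_le_pow_right (Nat.succ_pos n) hs)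

end Growth

/-! ### Hilbert functions of standard graded algebras. -/

section Graded

variable {k A : Type*} [Field k] [CommRing A] [Algebra k A]
  {𝒜 : ℕ → Submodule k A} [GradedAlgebra 𝒜]

lemma IsStandardGraded.eq_pow (hA : IsStandardGraded 𝒜) (m : ℕ) : 𝒜 m = 𝒜 1 ^ m := by
  apply le_antisymm
  · have key : ∀ a : A, ∀ m, (DirectSum.decompose 𝒜 a m : A) ∈ 𝒜 1 ^ m := by
      intro a
      have ha : a ∈ Algebra.adjoin k (𝒜 1 : Set A) := hA.adjoin_one ▸ Algebra.mem_top
      induction ha using Algebra.adjoin_induction with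
      | mem x hx =>
        intro m
        by_cases hm : 1 = m
        · subst hm
          rw [DirectSum.decompose_of_mem_same 𝒜 hx, pow_one]
          exact hx
        · rw [DirectSum.decompose_of_mem_ne 𝒜 hx hm]
          exact zero_mem _
      | algebraMap r =>
        intro m
        have hx : algebraMap k A r ∈ 𝒜 0 := SetLike.algebraMap_mem_graded 𝒜 r
        by_cases hm : 0 = m
        · subst hm
          rw [DirectSum.decompose_of_mem_same 𝒜 hx, pow_zero]
          exact Submodule.algebraMap_mem r
        · rw [DirectSum.decompose_of_mem_ne 𝒜 hx hm]
          exact zero_mem _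
      | add x y _ _ hx hy =>
        intro m
        rw [DirectSum.decompose_add, DirectSum.add_apply, Submodule.coe_add]
        exact add_mem (hx m) (hy m)
      | mul x y _ _ hx hy =>
        intro m
        rw [DirectSum.decompose_mul, DirectSum.coe_mul_apply_eq_sum_antidiagonal]
        refine sum_mem fun ij hij => ?_
        rw [← Finset.HasAntidiagonal.mem_antidiagonal.1 hij, pow_add]
        exact Submodule.mul_mem_mul (hx _) (hy _)
    intro a ha
    have := key a m
    rwa [DirectSum.decompose_of_mem_same 𝒜 ha] at this
  · induction m with
    | zero =>
      rw [pow_zero, hA.zero_eq]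
    | succ m ih =>
      rw [pow_succ, Submodule.mul_le]
      intro a ha b hb
      exact SetLike.mul_mem_graded (ih ha) hb

lemma IsStandardGraded.fg (hA : IsStandardGraded 𝒜) (m : ℕ) : (𝒜 m).FG := by
  have := hA.finite_one
  rw [hA.eq_pow]
  exact (Module.Finite.iff_fg.1 hA.finite_one).pow m

lemma IsStandardGraded.finite (hA : IsStandardGraded 𝒜) (m : ℕ) : Module.Finite k (𝒜 m) :=
  Module.Finite.iff_fg.2 (hA.fg m)

lemma IsStandardGraded.finiteType (hA : IsStandardGraded 𝒜) : Algebra.FiniteType k A := by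
  obtain ⟨T, hT⟩ := Module.Finite.iff_fg.1 hA.finite_one
  refine ⟨⟨T, ?_⟩⟩
  rw [← Algebra.adjoin_span, hT, hA.adjoin_one]

lemma sum_finrank_le_of_forall_le (𝒜 : ℕ → Submodule k A) [GradedAlgebra 𝒜]
    {V : Submodule k A} (hV : V.FG) (j : ℕ) (h : ∀ i ≤ j, 𝒜 i ≤ V) :
    ∑ i ∈ Finset.range (j + 1), Module.finrank k (𝒜 i) ≤ Module.finrank k V := by
  have hVf : Module.Finite k V := Module.Finite.iff_fg.2 hV
  have hfin : ∀ i : Fin (j + 1), Module.Finite k (𝒜 i) := fun i =>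
    Submodule.finiteDimensional_of_le (h i (by omega))
  rw [Finset.sum_range, ← Module.finrank_pi_fintype k (M := fun i : Fin (j + 1) => 𝒜 i)]
  let f : (Π i : Fin (j + 1), 𝒜 i) →ₗ[k] V :=
    { toFun := fun a => ⟨∑ i, (a i : A), sum_mem fun i _ => h i (by omega) (a i).2⟩
      map_add' := fun a b => by ext; simp [Finset.sum_add_distrib]
      map_smul' := fun c a => by ext; simp [Finset.smul_sum] }
  refine LinearMap.finrank_le_finrank_of_injective (f := f) ?_
  rw [← LinearMap.ker_eq_bot, LinearMap.ker_eq_bot']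
  intro a ha
  have ha' : ∑ i, (a i : A) = 0 := congrArg Subtype.val ha
  funext i
  have h1 := congrArg (fun b => (DirectSum.decompose 𝒜 b i : A)) ha'
  simp only [DirectSum.decompose_sum, DirectSum.decompose_zero] at h1
  rw [DirectSum.sum_apply, AddSubmonoidClass.coe_finsetSum, Finset.sum_eq_single i] at h1
  · rw [DirectSum.decompose_of_mem_same 𝒜 (a i).2] at h1
    ext
    simpa using h1
  · intro l _ hl
    exact DirectSum.decompose_of_mem_ne 𝒜 (a l).2 fun h => hl (Fin.ext h)
  · simp

/-- Multiplication by a linear form shifts the filtration by at most a constant `E`, so all degrees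
up to `j` fit into `V (E (j + 1))`. -/
lemma IsStandardGraded.exists_sum_finrank_le [Nontrivial A] (hA : IsStandardGraded 𝒜) {d : ℕ}
    (hd : ringKrullDim A = (d : WithBot ℕ∞)) : ∃ c : ℕ, ∀ j,
      ∑ i ∈ Finset.range (j + 1), Module.finrank k (𝒜 i) ≤ c * (j + 1) ^ d := by
  have := hA.finiteType
  obtain ⟨V, c, hmono, hexh, hmul, hfg, hgrow⟩ := exists_filtration_growth k hd
  obtain ⟨D0, hD0⟩ := hexh 1
  obtain ⟨T, hT⟩ := Module.Finite.iff_fg.1 hA.finite_one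
  choose D hD using hmul
  set E := max D0 (T.sup D) with hE
  have h1 : ∀ x ∈ 𝒜 1, ∀ n, ∀ y ∈ V n, x * y ∈ V (n + E) := by
    intro x hx n y hy
    rw [← hT] at hx
    have : Submodule.span k (T : Set A) ≤ (V (n + E)).comap (LinearMap.mulRight k y) := by
      refine Submodule.span_le.2 fun z hz => ?_
      refine hmono (Nat.add_le_add_left ?_ n) (hD z n y hy)
      exact (Finset.le_sup (f := D) hz).trans (le_max_right _ _)
    exact this hx
  have h2 : ∀ m, 𝒜 m ≤ V (E * (m + 1)) := by
    intro m
    rw [hA.eq_pow]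
    induction m with
    | zero =>
      rw [pow_zero, Submodule.one_le]
      exact hmono (by rw [zero_add, mul_one]; exact le_max_left _ _) hD0
    | succ m ih =>
      rw [pow_succ', Submodule.mul_le]
      intro x hx y hy
      rw [mul_add_one]
      exact h1 x hx _ y (ih hy)
  refine ⟨c * (E + 1) ^ d, fun j => ?_⟩
  calc _ ≤ Module.finrank k (V (E * (j + 1))) := by
        refine sum_finrank_le_of_forall_le 𝒜 (hfg _) j fun i hi => (h2 i).trans (hmono ?_)
        gcongr
    _ ≤ c * (E * (j + 1) + 1) ^ d := hgrow _
    _ ≤ c * ((E + 1) * (j + 1)) ^ d := by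
        gcongr
        nlinarith
    _ = _ := by rw [mul_pow, mul_assoc]

end Graded

end EpsilonDensity

namespace EpsilonDensity

/-! ### Spans of monomials and powers of a finite-dimensional space. -/

section MonomialSpans

variable {k A : Type*} [Field k] [CommRing A] [Algebra k A]

lemma mul_mem_monomialSpan {N : ℕ} (deg : Fin N → ℕ × ℕ) (x : Fin N → A) (i : Fin N)
    {p q : ℕ × ℕ} (hq : p + deg i = q) {a : A} (ha : a ∈ monomialSpan k deg x p) :
    a * x i ∈ monomialSpan k deg x q := by
  subst hq
  have : monomialSpan k deg x p ≤
      (monomialSpan k deg x (p + deg i)).comap (LinearMap.mulRight k (x i)) := by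
    refine Submodule.span_le.2 ?_
    rintro _ ⟨u, rfl, rfl⟩
    refine Submodule.subset_span ⟨u + Pi.single i 1, ?_, ?_⟩
    · exact (bidegree_add deg u _).trans (by rw [bidegree_single])
    · rw [monomialValue_add, monomialValue_single, LinearMap.mulRight_apply]
  exact this ha

lemma one_mem_monomialSpan {N : ℕ} (deg : Fin N → ℕ × ℕ) (x : Fin N → A) :
    (1 : A) ∈ monomialSpan k deg x 0 :=
  Submodule.subset_span ⟨0, by simp [bidegree], by simp [monomialValue]⟩

lemma exists_range_eq_finset {α : Type*} (T : Finset α) :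
    ∃ (N : ℕ) (x : Fin N → α), Set.range x = (T : Set α) :=
  ⟨T.card, fun i => (T.equivFin.symm i : α), by
    ext a
    constructor
    · rintro ⟨i, rfl⟩
      exact (T.equivFin.symm i).2
    · intro ha
      exact ⟨T.equivFin ⟨a, ha⟩, by simp⟩⟩

/-- The powers of a finite-dimensional subspace as spans of monomials of bidegree `(n, n)`. -/
lemma exists_monomialSpan_eq_pow {W : Submodule k A} (hW : W.FG) :
    ∃ (N : ℕ) (x : Fin N → A), ∀ n j,
      monomialSpan k (fun _ => (1, 1)) x (n, j) = if n = j then W ^ n else ⊥ := by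
  obtain ⟨T, rfl⟩ := hW
  obtain ⟨N, x, hx⟩ := exists_range_eq_finset T
  refine ⟨N, x, fun n j => ?_⟩
  have hb : ∀ u : Fin N → ℕ, bidegree (fun _ => (1, 1)) u = (∑ i, u i, ∑ i, u i) := by
    intro u
    ext <;> simp [bidegree, Prod.fst_sum, Prod.snd_sum]
  split_ifs with h
  · subst h
    apply le_antisymm
    · refine Submodule.span_le.2 ?_
      rintro _ ⟨u, hu, rfl⟩
      have hu' : ∑ i, u i = n := by
        have : bidegree (fun _ => (1, 1)) u = (n, n) := hu
        rw [hb] at this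
        exact (Prod.mk.inj this).1
      have := SetLike.prod_pow_mem_graded (fun n : ℕ => Submodule.span k (T : Set A) ^ n)
        (fun _ => 1) x u (F := Finset.univ) fun i _ => by
          rw [pow_one]
          exact Submodule.subset_span (hx ▸ Set.mem_range_self i)
      simpa [hu', monomialValue] using this
    · induction n with
      | zero =>
        rw [pow_zero, Submodule.one_le]
        exact one_mem_monomialSpan _ _
      | succ n ih =>
        rw [pow_succ, Submodule.mul_le]
        intro a ha b hb
        have : Submodule.span k (T : Set A) ≤
            (monomialSpan k (fun _ => (1, 1)) x (n + 1, n + 1)).comap (LinearMap.mulLeft k a) := by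
          refine Submodule.span_le.2 fun z hz => ?_
          rw [← hx] at hz
          obtain ⟨i, rfl⟩ := hz
          have h1 := mul_mem_monomialSpan (k := k) (fun _ => (1, 1)) x i (p := (n, n))
            (q := (n + 1, n + 1)) (by simp) (ih ha)
          rwa [SetLike.mem_coe, Submodule.mem_comap, LinearMap.mulLeft_apply]
        exact this hb
  · rw [monomialSpan, Submodule.span_eq_bot]
    rintro _ ⟨u, hu, -⟩
    exfalso
    have : bidegree (fun _ => (1, 1)) u = (n, j) := hu
    rw [hb] at this
    exact h ((Prod.mk.inj this).1.symm.trans (Prod.mk.inj this).2)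

/-- If `dim W ^ n` grows at most like `n ^ d` then it is asymptotic to a multiple of `n ^ d`. -/
lemma exists_tendsto_finrank_pow {W : Submodule k A} (hW : W.FG) {d : ℕ} {c : ℝ}
    (hc : ∀ n : ℕ, (Module.finrank k (W ^ n : Submodule k A) : ℝ) ≤ c * ((n : ℝ) + 1) ^ d) :
    ∃ l : ℝ, Tendsto (fun n : ℕ => (Module.finrank k (W ^ n : Submodule k A) : ℝ) / (n : ℝ) ^ d)
      atTop (𝓝 l) := by
  obtain ⟨N, x, hx⟩ := exists_monomialSpan_eq_pow hW
  have hc0 : 0 ≤ c := by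
    have := (Nat.cast_nonneg _).trans (hc 0)
    simpa using this
  -- The dimension of `W ^ n` sits in the single bidegree `(n, n)`, so at every slope above `1` the
  -- cumulative sum is `dim W ^ n`. The required limit is thus the density at any slope beyond `1`
  -- and all cut points.
  have hsum : ∀ q : ℕ × ℕ, ((∑ j ∈ Finset.range (q.2 + 1),
      Module.finrank k (monomialSpan k (fun _ => (1, 1)) x (q.1, j)) : ℕ) : ℝ) =
      if q.1 ≤ q.2 then (Module.finrank k (W ^ q.1 : Submodule k A) : ℝ) else 0 := by
    intro q
    have h1 : ∀ j, Module.finrank k (monomialSpan k (fun _ => (1, 1)) x (q.1, j)) =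
        if q.1 = j then Module.finrank k (W ^ q.1 : Submodule k A) else 0 := by
      intro j
      by_cases h : q.1 = j
      · rw [hx, if_pos h, if_pos h]
      · rw [hx, if_neg h, if_neg h, finrank_bot]
    rw [Finset.sum_congr rfl fun j _ => h1 j]
    simp only [Finset.sum_ite_eq, Finset.mem_range, Nat.lt_succ_iff]
    split_ifs <;> simp
  obtain ⟨E, Q, -, -, -, h4⟩ := piecewiseDensity_monomialSpan (K := k)
    (deg := fun _ : Fin N => (1, 1)) (fun _ => Or.inr rfl) x (d := d) (c := c) fun q => by
      rw [hsum]
      split_ifs with h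
      · refine (hc q.1).trans ?_
        have : (q.1 : ℝ) ≤ q.2 := by exact_mod_cast h
        gcongr
      · positivity
  obtain ⟨M, hM⟩ := E.bddAbove
  obtain ⟨y, hy⟩ := exists_nat_gt (max (M : ℝ) 1)
  have hy1 : (1 : ℝ) < y := (le_max_right _ _).trans_lt hy
  have h5 := h4 y (by linarith) fun a ha hay => by
    have h6 : (a : ℝ) ≤ M := by exact_mod_cast hM ha
    have h7 := (le_max_left (M : ℝ) 1).trans_lt hy
    linarith
  refine ⟨cutEval Q y, (h5.comp (tendsto_floor_slopeFilter (x := (y : ℝ)) (by linarith))).congr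
    fun n => ?_⟩
  simp only [Function.comp]
  rw [hsum (n, ⌊(y : ℝ) * n⌋₊), if_pos]
  refine Nat.le_floor ?_
  have : (0 : ℝ) ≤ n := Nat.cast_nonneg n
  nlinarith

lemma mem_gradedPart {𝒜 : ℕ → Submodule k A} {J : Ideal A} {m : ℕ} {a : A} :
    a ∈ gradedPart 𝒜 J m ↔ a ∈ J ∧ a ∈ 𝒜 m := by
  simp [gradedPart]

end MonomialSpans

/-! ### Densities of the powers of a homogeneous ideal. -/

section GradedParts

variable {k A : Type*} [Field k] [CommRing A] [Algebra k A]
  {𝒜 : ℕ → Submodule k A} [GradedAlgebra 𝒜]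

lemma exists_homogeneous_generators [IsNoetherianRing A] {J : Ideal A} (hJ : J.IsHomogeneous 𝒜) :
    ∃ (r : ℕ) (e : Fin r → ℕ) (f : Fin r → A), (∀ j, f j ∈ 𝒜 (e j)) ∧
      Ideal.span (Set.range f) = J := by
  classical
  obtain ⟨T, hT⟩ := (isNoetherianRing_iff_ideal_fg A).1 inferInstance J
  -- Enumerating pairs of a component and its index keeps the degree of each generator available.
  obtain ⟨r, x, hx⟩ := exists_range_eq_finset
    (T.biUnion fun a => (DirectSum.decompose 𝒜 a).support.image
      fun i => ((DirectSum.decompose 𝒜 a i : A), i))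
  have hmem : ∀ p : A × ℕ, p ∈ Set.range x ↔
      ∃ a ∈ T, ∃ i ∈ (DirectSum.decompose 𝒜 a).support, ((DirectSum.decompose 𝒜 a i : A), i) = p := by
    intro p
    rw [hx]
    simp only [Finset.mem_coe, Finset.mem_biUnion, Finset.mem_image]
  refine ⟨r, fun j => (x j).2, fun j => (x j).1, fun j => ?_, le_antisymm ?_ ?_⟩
  · obtain ⟨a, -, i, -, h⟩ := (hmem (x j)).1 ⟨j, rfl⟩
    simp only [← h]
    exact SetLike.coe_mem _
  · refine Ideal.span_le.2 ?_
    rintro _ ⟨j, rfl⟩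
    obtain ⟨a, ha, i, -, h⟩ := (hmem (x j)).1 ⟨j, rfl⟩
    simp only [← h]
    exact hJ i (hT ▸ Ideal.subset_span ha)
  · rw [← hT]
    refine Ideal.span_le.2 fun a ha => ?_
    rw [← DirectSum.sum_support_decompose 𝒜 a]
    refine sum_mem fun i hi => Ideal.subset_span ?_
    obtain ⟨j, hj⟩ := (hmem _).2 ⟨a, ha, i, hi, rfl⟩
    exact ⟨j, by simp only [hj]⟩

lemma decompose_mul_mem_of_forall {y a : A} {i : ℕ} (hy : y ∈ 𝒜 i) {U U' : ℕ → Submodule k A}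
    (ha : ∀ m, (DirectSum.decompose 𝒜 a m : A) ∈ U m)
    (h : ∀ m, ∀ b ∈ U m, b * y ∈ U' (m + i)) (m : ℕ) :
    (DirectSum.decompose 𝒜 (a * y) m : A) ∈ U' m := by
  classical
  rw [DirectSum.coe_decompose_mul_of_right_mem 𝒜 m hy]
  split_ifs with hi
  · have := h _ _ (ha (m - i))
    rwa [Nat.sub_add_cancel hi] at this
  · exact zero_mem _

/-- The graded parts of the powers of a homogeneous ideal are spanned by the monomials in the
generators of the algebra and of the ideal. -/
lemma IsStandardGraded.exists_monomialSpan_eq (hA : IsStandardGraded 𝒜) {J : Ideal A}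
    (hJ : J.IsHomogeneous 𝒜) :
    ∃ (N : ℕ) (deg : Fin N → ℕ × ℕ) (x : Fin N → A), (∀ i, IsGeneratorDegree (deg i)) ∧
      ∀ n m, gradedPart 𝒜 (J ^ n) m = monomialSpan k deg x (n, m) := by
  have := hA.finiteType
  have : IsNoetherianRing A := Algebra.FiniteType.isNoetherianRing k A
  obtain ⟨r, e, f, hf, hspan⟩ := exists_homogeneous_generators hJ
  obtain ⟨T, hT⟩ := Module.Finite.iff_fg.1 hA.finite_one
  obtain ⟨N, b, hb⟩ := exists_range_eq_finset T
  have hb1 : ∀ i, b i ∈ 𝒜 1 := fun i => by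
    rw [← hT]
    exact Submodule.subset_span (hb ▸ Set.mem_range_self i)
  set deg : Fin (N + r) → ℕ × ℕ := Fin.append (fun _ => (0, 1)) (fun j => (1, e j)) with hdeg
  set x : Fin (N + r) → A := Fin.append b f with hx
  have hxmem : ∀ i, x i ∈ 𝒜 (deg i).2 := by
    intro i
    refine Fin.addCases (fun i => ?_) (fun i => ?_) i
    · simpa [hx, hdeg] using hb1 i
    · simpa [hx, hdeg] using hf i
  have hxJ : ∀ i, x i ∈ J ^ (deg i).1 := by
    intro i
    refine Fin.addCases (fun i => ?_) (fun i => ?_) i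
    · simp [hx, hdeg]
    · simpa [hx, hdeg, ← hspan] using Ideal.subset_span (Set.mem_range_self i)
  refine ⟨N + r, deg, x, fun i => ?_, fun n m => le_antisymm ?_ ?_⟩
  · refine Fin.addCases (fun i => ?_) (fun i => ?_) i
    · left; simp [hdeg]
    · right; simp [hdeg]
  · have hone : ∀ m, (DirectSum.decompose 𝒜 (1 : A) m : A) ∈ monomialSpan k deg x (0, m) := by
      intro m
      by_cases hm : 0 = m
      · subst hm
        rw [DirectSum.decompose_of_mem_same 𝒜 SetLike.GradedOne.one_mem]
        exact one_mem_monomialSpan deg x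
      · rw [DirectSum.decompose_of_mem_ne 𝒜 SetLike.GradedOne.one_mem hm]
        exact zero_mem _
    -- The coefficients `c` need not be homogeneous, so the condition is imposed on all components
    -- of an element simultaneously; it is then stable under multiplication by `A`.
    have hmul : ∀ n (c a : A), (∀ m, (DirectSum.decompose 𝒜 a m : A) ∈ monomialSpan k deg x (n, m)) →
        ∀ m, (DirectSum.decompose 𝒜 (a * c) m : A) ∈ monomialSpan k deg x (n, m) := by
      intro n c
      have hc : c ∈ Algebra.adjoin k (𝒜 1 : Set A) := hA.adjoin_one ▸ Algebra.mem_top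
      induction hc using Algebra.adjoin_induction with
      | mem y hy =>
        intro a ha
        refine decompose_mul_mem_of_forall hy ha fun m z hz => ?_
        have : 𝒜 1 ≤ (monomialSpan k deg x (n, m + 1)).comap (LinearMap.mulLeft k z) := by
          rw [← hT]
          refine Submodule.span_le.2 fun w hw => ?_
          rw [← hb] at hw
          obtain ⟨i, rfl⟩ := hw
          have h1 := mul_mem_monomialSpan deg x (Fin.castAdd r i) (q := (n, m + 1))
            (by simp [hdeg]) hz
          simpa [hx] using h1
        exact this hy
      | algebraMap t =>
        intro a ha m
        rw [mul_comm, ← Algebra.smul_def, DirectSum.decompose_smul]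
        exact Submodule.smul_mem _ t (ha m)
      | add y z _ _ hy hz =>
        intro a ha m
        rw [mul_add, DirectSum.decompose_add, DirectSum.add_apply, Submodule.coe_add]
        exact add_mem (hy a ha m) (hz a ha m)
      | mul y z _ _ hy hz =>
        intro a ha
        rw [← mul_assoc]
        exact hz _ (hy a ha)
    have key : ∀ n, ∀ a ∈ J ^ n, ∀ m,
        (DirectSum.decompose 𝒜 a m : A) ∈ monomialSpan k deg x (n, m) := by
      intro n
      induction n with
      | zero =>
        intro a _
        simpa using hmul 0 a 1 hone
      | succ n ih =>
        intro a ha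
        rw [pow_succ] at ha
        induction ha using Submodule.mul_induction_on' with
        | mem_mul_mem y hy z hz =>
          rw [← hspan] at hz
          obtain ⟨c, rfl⟩ := (Ideal.mem_span_range_iff_exists_fun).1 hz
          intro m
          rw [Finset.mul_sum, DirectSum.decompose_sum, DirectSum.sum_apply,
            AddSubmonoidClass.coe_finsetSum]
          refine sum_mem fun j _ => ?_
          rw [← mul_assoc]
          refine decompose_mul_mem_of_forall (U := fun m => monomialSpan k deg x (n, m))
            (U' := fun m => monomialSpan k deg x (n + 1, m)) (hf j) (hmul n (c j) y (ih y hy))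
            (fun m z hz => ?_) m
          have h1 := mul_mem_monomialSpan deg x (Fin.natAdd N j) (q := (n + 1, m + e j))
            (by simp [hdeg]) hz
          simpa [hx] using h1
        | add y _ z _ hy hz =>
          intro m
          rw [DirectSum.decompose_add, DirectSum.add_apply, Submodule.coe_add]
          exact add_mem (hy m) (hz m)
    intro a ha
    obtain ⟨h1, h2⟩ := mem_gradedPart.1 ha
    have := key n a h1 m
    rwa [DirectSum.decompose_of_mem_same 𝒜 h2] at this
  · refine Submodule.span_le.2 ?_
    rintro _ ⟨u, hu, rfl⟩
    have hu1 : ∑ i, u i • (deg i).1 = n := by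
      have := congrArg Prod.fst hu
      simpa [bidegree, Prod.fst_sum] using this
    have hu2 : ∑ i, u i • (deg i).2 = m := by
      have := congrArg Prod.snd hu
      simpa [bidegree, Prod.snd_sum] using this
    refine mem_gradedPart.2 ⟨?_, ?_⟩
    · have := Ideal.prod_mem_prod (s := Finset.univ) (I := fun i => J ^ (u i * (deg i).1))
        (x := fun i => x i ^ u i) fun i _ => by
          rw [mul_comm, pow_mul]
          exact Ideal.pow_mem_pow (hxJ i) _
      rw [Finset.prod_pow_eq_pow_sum] at this
      simp only [smul_eq_mul] at hu1
      rwa [hu1] at this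
    · rw [← hu2]
      exact SetLike.prod_pow_mem_graded 𝒜 (fun i => (deg i).2) x u fun i _ => hxmem i

/-- The dimension of the degree `m` part of an ideal. -/
noncomputable def dimPart (𝒜 : ℕ → Submodule k A) (J : Ideal A) (m : ℕ) : ℕ :=
  Module.finrank k (gradedPart 𝒜 J m)

lemma IsStandardGraded.finite_gradedPart (hA : IsStandardGraded 𝒜) (J : Ideal A) (m : ℕ) :
    Module.Finite k (gradedPart 𝒜 J m) := by
  have := hA.finite m
  exact Submodule.finiteDimensional_of_le inf_le_right

lemma IsStandardGraded.dimPart_le_finrank (hA : IsStandardGraded 𝒜) (J : Ideal A) (m : ℕ) :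
    dimPart 𝒜 J m ≤ Module.finrank k (𝒜 m) := by
  have := hA.finite m
  exact Submodule.finrank_mono inf_le_right

lemma IsStandardGraded.dimPart_mono (hA : IsStandardGraded 𝒜) {J K : Ideal A} (h : J ≤ K)
    (m : ℕ) : dimPart 𝒜 J m ≤ dimPart 𝒜 K m := by
  have := hA.finite_gradedPart K m
  exact Submodule.finrank_mono fun a ha =>
    mem_gradedPart.2 ⟨h (mem_gradedPart.1 ha).1, (mem_gradedPart.1 ha).2⟩

lemma finrank_le_of_mul_mem [IsDomain A] {U V : Submodule k A} (hV : V.FG) {c : A} (hc : c ≠ 0)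
    (h : ∀ a ∈ U, c * a ∈ V) : Module.finrank k U ≤ Module.finrank k V := by
  have : Module.Finite k V := Module.Finite.iff_fg.2 hV
  refine LinearMap.finrank_le_finrank_of_injective (f := (LinearMap.mulLeft k c).restrict h) ?_
  intro a b hab
  have h1 : c * (a : A) = c * b := congrArg Subtype.val hab
  exact Subtype.ext (mul_left_cancel₀ hc h1)

lemma IsStandardGraded.dimPart_le_of_mul_mem [IsDomain A] (hA : IsStandardGraded 𝒜) {J K : Ideal A}
    {c : A} (hc : c ≠ 0) {i : ℕ} (hci : c ∈ 𝒜 i) (h : ∀ a ∈ J, c * a ∈ K) (m : ℕ) :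
    dimPart 𝒜 J m ≤ dimPart 𝒜 K (m + i) := by
  have := hA.finite_gradedPart K (m + i)
  refine finrank_le_of_mul_mem (Module.Finite.iff_fg.1 this) hc fun a ha => ?_
  obtain ⟨h1, h2⟩ := mem_gradedPart.1 ha
  refine mem_gradedPart.2 ⟨h a h1, ?_⟩
  rw [add_comm]
  exact SetLike.mul_mem_graded hci h2

/-- If there were no nonzero linear form, `A` would be `k`, of dimension zero. -/
lemma IsStandardGraded.exists_ne_zero (hA : IsStandardGraded 𝒜) {d : ℕ}
    (hd : ringKrullDim A = (d : WithBot ℕ∞)) (hd1 : 1 ≤ d) : ∃ y ∈ 𝒜 1, y ≠ 0 := by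
  by_contra! h
  have h1 : (𝒜 1 : Set A) ⊆ (⊥ : Subalgebra k A) := fun y hy => by
    rw [h y hy]; exact zero_mem _
  have h2 : (⊥ : Subalgebra k A) = ⊤ := by
    rw [eq_top_iff, ← hA.adjoin_one]
    exact Algebra.adjoin_le h1
  have h3 : Function.Surjective (algebraMap k A) := by
    intro a
    have : a ∈ (⊥ : Subalgebra k A) := h2 ▸ Algebra.mem_top
    exact Algebra.mem_bot.1 this
  have h4 := ringKrullDim_le_of_surjective _ h3
  rw [hd, ringKrullDim_eq_zero_of_field] at h4
  have : d ≤ 0 := by exact_mod_cast h4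
  omega

/-- In a domain a nonzero linear form embeds each graded part into the next one. -/
lemma IsStandardGraded.monotone_dimPart [IsDomain A] (hA : IsStandardGraded 𝒜) {d : ℕ}
    (hd : ringKrullDim A = (d : WithBot ℕ∞)) (hd1 : 1 ≤ d) (J : Ideal A) :
    Monotone (dimPart 𝒜 J) := by
  obtain ⟨y, hy, hy0⟩ := hA.exists_ne_zero hd hd1
  exact monotone_nat_of_le_succ fun m => hA.dimPart_le_of_mul_mem hy0 hy
    (fun a ha => J.mul_mem_left y ha) m

lemma IsStandardGraded.exists_sum_dimPart_le [Nontrivial A] (hA : IsStandardGraded 𝒜) {d : ℕ}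
    (hd : ringKrullDim A = (d : WithBot ℕ∞)) : ∃ c : ℕ, ∀ (J : Ideal A) j,
      ∑ i ∈ Finset.range (j + 1), dimPart 𝒜 J i ≤ c * (j + 1) ^ d := by
  obtain ⟨c, hc⟩ := hA.exists_sum_finrank_le hd
  exact ⟨c, fun J j => (Finset.sum_le_sum fun i _ => hA.dimPart_le_finrank J i).trans (hc j)⟩

/-- By monotonicity `m + 1` copies of the part of degree `m` fit into the degrees from `m` to `2 m`,
so the cumulative bound of order `d` gives a pointwise one of order `d - 1`. -/
lemma IsStandardGraded.exists_dimPart_le [IsDomain A] (hA : IsStandardGraded 𝒜) {d : ℕ}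
    (hd : ringKrullDim A = (d : WithBot ℕ∞)) (hd1 : 1 ≤ d) : ∃ c : ℕ, ∀ (J : Ideal A) m,
      dimPart 𝒜 J m ≤ c * (m + 1) ^ (d - 1) := by
  obtain ⟨c, hc⟩ := hA.exists_sum_dimPart_le hd
  refine ⟨c * 2 ^ d, fun J m => ?_⟩
  have h1 := hc J (m + m)
  rw [add_assoc, Finset.sum_range_add] at h1
  have h2 : (m + 1) * dimPart 𝒜 J m ≤
      ∑ i ∈ Finset.range (m + 1), dimPart 𝒜 J (m + i) := by
    calc (m + 1) * dimPart 𝒜 J m = ∑ i ∈ Finset.range (m + 1), dimPart 𝒜 J m := by simp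
      _ ≤ _ := Finset.sum_le_sum fun i _ => hA.monotone_dimPart hd hd1 J (Nat.le_add_right _ _)
  have h3 : (m + 1) * dimPart 𝒜 J m ≤ (m + 1) * (c * 2 ^ d * (m + 1) ^ (d - 1)) := by
    calc _ ≤ c * (m + (m + 1)) ^ d := by omega
      _ ≤ c * (2 * (m + 1)) ^ d := by gcongr; omega
      _ = _ := by
        obtain ⟨d', rfl⟩ := Nat.exists_eq_add_of_le' hd1
        rw [mul_pow, Nat.add_sub_cancel, pow_succ (m + 1)]
        ring
  exact Nat.le_of_mul_le_mul_left h3 (Nat.succ_pos m)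

/-- Piecewise polynomial asymptotics of the cumulative Hilbert functions of `J ^ n`. -/
theorem IsStandardGraded.piecewiseDensity_sum_pow [Nontrivial A] (hA : IsStandardGraded 𝒜) {d : ℕ}
    (hd : ringKrullDim A = (d : WithBot ℕ∞)) {J : Ideal A} (hJ : J.IsHomogeneous 𝒜) :
    PiecewiseDensity (fun p : ℕ × ℕ =>
      ∑ j ∈ Finset.range (p.2 + 1), (dimPart 𝒜 (J ^ p.1) j : ℝ)) d := by
  obtain ⟨N, deg, x, hdeg, hx⟩ := hA.exists_monomialSpan_eq hJ
  obtain ⟨c, hc⟩ := hA.exists_sum_dimPart_le hd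
  have e : ∀ q : ℕ × ℕ, ∑ j ∈ Finset.range (q.2 + 1),
      Module.finrank k (monomialSpan k deg x (q.1, j)) =
      ∑ j ∈ Finset.range (q.2 + 1), dimPart 𝒜 (J ^ q.1) j :=
    fun q => Finset.sum_congr rfl fun j _ => by rw [dimPart, hx]
  have h := piecewiseDensity_monomialSpan (K := k) hdeg x (d := d) (c := c) fun q => by
    rw [e]
    exact_mod_cast hc (J ^ q.1) q.2
  convert h using 2 with q
  rw [e]
  push_cast
  rfl

/-- Piecewise polynomial asymptotics of the Hilbert functions of `J ^ n`. -/
theorem IsStandardGraded.piecewiseDensity_pow [IsDomain A] (hA : IsStandardGraded 𝒜) {d : ℕ}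
    (hd : ringKrullDim A = (d : WithBot ℕ∞)) (hd1 : 1 ≤ d) {J : Ideal A}
    (hJ : J.IsHomogeneous 𝒜) :
    PiecewiseDensity (fun p : ℕ × ℕ => (dimPart 𝒜 (J ^ p.1) p.2 : ℝ)) (d - 1) := by
  obtain ⟨d', rfl⟩ := Nat.exists_eq_add_of_le' hd1
  exact PiecewiseDensity.of_cumulative
    (fun n i j hij => Nat.cast_le.2 (hA.monotone_dimPart hd hd1 (J ^ n) hij))
    (hA.piecewiseDensity_sum_pow hd hJ)

/-- Multiplication by `f` embeds the degree `m` part of `J ^ n` into the degree `m + e` part of `J ^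
(n + 1)`, which is the second monotonicity needed to exclude jumps. -/
theorem IsStandardGraded.exists_hasDensity_pow [IsDomain A] (hA : IsStandardGraded 𝒜) {d : ℕ}
    (hd : ringKrullDim A = (d : WithBot ℕ∞)) (hd1 : 1 ≤ d) {J : Ideal A}
    (hJ : J.IsHomogeneous 𝒜) {f : A} {e : ℕ} (hf0 : f ≠ 0) (hf : f ∈ gradedPart 𝒜 J e)
    {x : ℝ} (hx : (e : ℝ) < x) :
    ∃ l, HasDensity (fun p : ℕ × ℕ => (dimPart 𝒜 (J ^ p.1) p.2 : ℝ)) (d - 1) x l := by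
  obtain ⟨h1, h2⟩ := mem_gradedPart.1 hf
  refine PiecewiseDensity.exists_hasDensity (e := e)
    (fun n i j hij => Nat.cast_le.2 (hA.monotone_dimPart hd hd1 (J ^ n) hij))
    (fun n m => ?_) (hA.piecewiseDensity_pow hd hd1 hJ) hx
  have := hA.dimPart_le_of_mul_mem (J := J ^ n) (K := J ^ (n + 1)) hf0 h2 (fun a ha => by
    rw [pow_succ']
    exact Ideal.mul_mem_mul h1 ha) m
  exact_mod_cast this

end GradedParts

end EpsilonDensity

namespace EpsilonDensity

/-! ### Saturation with respect to the irrelevant ideal. -/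

section Saturation

variable {k A : Type*} [Field k] [CommRing A] [Algebra k A]
  {𝒜 : ℕ → Submodule k A} [GradedAlgebra 𝒜]

lemma IsStandardGraded.mul_eq (hA : IsStandardGraded 𝒜) (i j : ℕ) : 𝒜 i * 𝒜 j = 𝒜 (i + j) := by
  rw [hA.eq_pow i, hA.eq_pow j, hA.eq_pow (i + j), pow_add]

/-- It suffices to test membership in an ideal of the products with `𝒜 (i + j)` on products. -/
lemma IsStandardGraded.mul_mem_of_add (hA : IsStandardGraded 𝒜) {J : Ideal A} {a : A} {i j : ℕ}
    (h : ∀ b ∈ 𝒜 i, ∀ c ∈ 𝒜 j, a * b * c ∈ J) : ∀ b ∈ 𝒜 (i + j), a * b ∈ J := by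
  have : 𝒜 (i + j) ≤ (J.restrictScalars k).comap (LinearMap.mulLeft k a) := by
    rw [← hA.mul_eq, Submodule.mul_le]
    intro b hb c hc
    have := h b hb c hc
    rw [mul_assoc] at this
    exact this
  exact this

lemma IsStandardGraded.mul_mem_of_le (hA : IsStandardGraded 𝒜) {J : Ideal A} {a : A} {i j : ℕ}
    (hij : i ≤ j) (h : ∀ b ∈ 𝒜 i, a * b ∈ J) : ∀ b ∈ 𝒜 j, a * b ∈ J := by
  obtain ⟨j, rfl⟩ := Nat.exists_eq_add_of_le hij
  exact hA.mul_mem_of_add fun b hb c _ => J.mul_mem_right c (h b hb)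

lemma IsStandardGraded.irrelevant_pow_le (hA : IsStandardGraded 𝒜) (i : ℕ) :
    (HomogeneousIdeal.irrelevant 𝒜).toIdeal ^ i ≤ Ideal.span (𝒜 i : Set A) := by
  induction i with
  | zero =>
    have : (1 : A) ∈ Ideal.span (𝒜 0 : Set A) := Ideal.subset_span SetLike.GradedOne.one_mem
    rw [(Ideal.eq_top_iff_one _).2 this]
    exact le_top
  | succ i ih =>
    rw [pow_succ]
    have h1 : (HomogeneousIdeal.irrelevant 𝒜).toIdeal ≤ Ideal.span (𝒜 1 : Set A) := by
      rw [HomogeneousIdeal.irrelevant_eq_span, Ideal.span_le]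
      refine Set.iUnion₂_subset fun j hj b hb => ?_
      obtain ⟨j, rfl⟩ := Nat.exists_eq_add_of_le' hj
      have := hA.mul_mem_of_add (J := Ideal.span (𝒜 1 : Set A)) (a := 1) (i := j) (j := 1)
        (fun b _ c hc => Ideal.mul_mem_left _ _ (Ideal.subset_span hc)) b hb
      rwa [one_mul] at this
    refine (Ideal.mul_mono ih h1).trans ?_
    rw [Ideal.span_mul_span', Ideal.span_le]
    rintro _ ⟨a, ha, b, hb, rfl⟩
    exact Ideal.subset_span (SetLike.mul_mem_graded ha hb)

lemma IsStandardGraded.le_irrelevant_pow (hA : IsStandardGraded 𝒜) (i : ℕ) :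
    𝒜 i ≤ ((HomogeneousIdeal.irrelevant 𝒜).toIdeal ^ i).restrictScalars k := by
  induction i with
  | zero => exact fun b _ => by simp
  | succ i ih =>
    rw [← hA.mul_eq, Submodule.mul_le]
    intro b hb c hc
    rw [Submodule.restrictScalars_mem, pow_succ]
    exact Ideal.mul_mem_mul (ih hb) (HomogeneousIdeal.mem_irrelevant_of_mem 𝒜 one_pos hc)

/-- The `i`-th power of the irrelevant ideal contains `𝒜 i` and is contained in the ideal it
generates, and the colon ideals increase with `i`. -/
lemma IsStandardGraded.mem_saturation (hA : IsStandardGraded 𝒜) {J : Ideal A} {a : A} :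
    a ∈ saturation 𝒜 J ↔ ∃ i, ∀ b ∈ 𝒜 i, a * b ∈ J := by
  have hmono : Monotone fun i : ℕ =>
      J.colon (((HomogeneousIdeal.irrelevant 𝒜).toIdeal ^ i : Ideal A) : Set A) := by
    intro i j hij b hb
    rw [Submodule.mem_colon] at hb ⊢
    exact fun s hs => hb s (Ideal.pow_le_pow_right hij hs)
  rw [saturation, Submodule.mem_iSup_of_directed _ hmono.directed_le]
  refine exists_congr fun i => ?_
  rw [Submodule.mem_colon]
  constructor
  · intro h b hb
    refine h b ?_
    exact hA.le_irrelevant_pow i hb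
  · intro h s hs
    have h1 : Ideal.span (𝒜 i : Set A) ≤ J.colon {a} := by
      refine Ideal.span_le.2 fun b hb => ?_
      rw [SetLike.mem_coe, Submodule.mem_colon_singleton, smul_eq_mul, mul_comm]
      exact h b hb
    have := h1 (hA.irrelevant_pow_le i hs)
    rwa [Submodule.mem_colon_singleton, smul_eq_mul, mul_comm] at this

lemma IsStandardGraded.le_saturation (hA : IsStandardGraded 𝒜) (J : Ideal A) :
    J ≤ saturation 𝒜 J := fun _ ha =>
  hA.mem_saturation.2 ⟨0, fun b _ => J.mul_mem_right b ha⟩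

/-- A uniform exponent for a finitely generated ideal contained in the saturation. -/
lemma IsStandardGraded.exists_forall_mul_mem [IsNoetherianRing A] (hA : IsStandardGraded 𝒜)
    {J K : Ideal A} (h : K ≤ saturation 𝒜 J) : ∃ t, ∀ a ∈ K, ∀ b ∈ 𝒜 t, a * b ∈ J := by
  obtain ⟨T, hT⟩ := (isNoetherianRing_iff_ideal_fg A).1 inferInstance K
  have h1 : ∀ x : T, ∃ i, ∀ b ∈ 𝒜 i, (x : A) * b ∈ J := fun x =>
    hA.mem_saturation.1 (h (hT ▸ Ideal.subset_span x.2))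
  choose i hi using h1
  obtain ⟨t, ht⟩ := (Set.finite_range i).bddAbove
  refine ⟨t, fun a ha b hb => ?_⟩
  have h2 : K ≤ J.colon {b} := by
    rw [← hT]
    refine Ideal.span_le.2 fun x hx => ?_
    rw [SetLike.mem_coe, Submodule.mem_colon_singleton, smul_eq_mul]
    exact hA.mul_mem_of_le (ht ⟨⟨x, hx⟩, rfl⟩) (hi ⟨x, hx⟩) b hb
  have := h2 ha
  rwa [Submodule.mem_colon_singleton] at this

/-- The products `a b` with `b ∈ 𝒜 i` generate a finitely generated ideal, so one exponent `t`
serves for all of them, and `i + t` serves for `a`. -/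
lemma IsStandardGraded.saturation_saturation [IsNoetherianRing A] (hA : IsStandardGraded 𝒜)
    (J : Ideal A) : saturation 𝒜 (saturation 𝒜 J) = saturation 𝒜 J := by
  refine le_antisymm (fun a ha => ?_) (hA.le_saturation _)
  obtain ⟨i, hi⟩ := hA.mem_saturation.1 ha
  have h1 : Ideal.span ((fun b => a * b) '' (𝒜 i : Set A)) ≤ saturation 𝒜 J := by
    refine Ideal.span_le.2 ?_
    rintro _ ⟨b, hb, rfl⟩
    exact hi b hb
  obtain ⟨t, ht⟩ := hA.exists_forall_mul_mem h1
  exact hA.mem_saturation.2 ⟨i + t, hA.mul_mem_of_add fun b hb c hc =>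
    ht _ (Ideal.subset_span ⟨b, hb, rfl⟩) c hc⟩

lemma IsStandardGraded.isHomogeneous_saturation (hA : IsStandardGraded 𝒜) {J : Ideal A}
    (hJ : J.IsHomogeneous 𝒜) : (saturation 𝒜 J).IsHomogeneous 𝒜 := by
  classical
  intro m a ha
  obtain ⟨i, hi⟩ := hA.mem_saturation.1 ha
  refine hA.mem_saturation.2 ⟨i, fun b hb => ?_⟩
  have := hJ (m + i) (hi b hb)
  rwa [DirectSum.coe_decompose_mul_add_of_right_mem 𝒜 hb] at this

lemma IsStandardGraded.saturation_bot [IsDomain A] (hA : IsStandardGraded 𝒜) {d : ℕ}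
    (hd : ringKrullDim A = (d : WithBot ℕ∞)) (hd1 : 1 ≤ d) : saturation 𝒜 (⊥ : Ideal A) = ⊥ := by
  rw [eq_bot_iff]
  intro a ha
  obtain ⟨i, hi⟩ := hA.mem_saturation.1 ha
  obtain ⟨y, hy, hy0⟩ := hA.exists_ne_zero hd hd1
  have h1 : y ^ i ∈ 𝒜 i := by simpa using SetLike.pow_mem_graded i hy
  have := hi _ h1
  rw [Ideal.mem_bot, mul_eq_zero] at this
  exact this.resolve_right (pow_ne_zero i hy0)

end Saturation

/-! ### Degrees of generators and initial degrees. -/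

section GeneratedInDegree

variable {k A : Type*} [Field k] [CommRing A] [Algebra k A] {𝒜 : ℕ → Submodule k A}

/-- `K` is generated by homogeneous elements of degree at most `δ`. -/
def GeneratedInDegreeLE (𝒜 : ℕ → Submodule k A) (K : Ideal A) (δ : ℕ) : Prop :=
  K ≤ Ideal.span {a | a ∈ K ∧ ∃ i ≤ δ, a ∈ 𝒜 i}

lemma GeneratedInDegreeLE.mono {K : Ideal A} {δ δ' : ℕ} (h : GeneratedInDegreeLE 𝒜 K δ)
    (hδ : δ ≤ δ') : GeneratedInDegreeLE 𝒜 K δ' :=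
  h.trans (Ideal.span_mono fun _ ⟨h1, i, hi, h2⟩ => ⟨h1, i, hi.trans hδ, h2⟩)

end GeneratedInDegree

section Degrees

variable {k A : Type*} [Field k] [CommRing A] [Algebra k A]
  {𝒜 : ℕ → Submodule k A} [GradedAlgebra 𝒜]

lemma decompose_mul_eq_zero {a : A} {r : ℕ} (ha : ∀ i < r, (DirectSum.decompose 𝒜 a i : A) = 0)
    (c : A) : ∀ i < r, (DirectSum.decompose 𝒜 (c * a) i : A) = 0 := by
  classical
  intro i hi
  refine DirectSum.Decomposition.inductionOn 𝒜 (motive := fun c =>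
    (DirectSum.decompose 𝒜 (c * a) i : A) = 0) ?_ ?_ ?_ c
  · simp
  · intro j b
    rw [DirectSum.coe_decompose_mul_of_left_mem 𝒜 i b.2]
    split_ifs with h
    · rw [ha _ (by omega), mul_zero]
    · rfl
  · intro b b' h h'
    rw [add_mul, DirectSum.decompose_add, DirectSum.add_apply, Submodule.coe_add, h, h', add_zero]

variable (𝒜) in
/-- The ideal of the elements without components of degree less than `r`. -/
def truncIdeal (r : ℕ) : Ideal A where
  carrier := {a | ∀ i < r, (DirectSum.decompose 𝒜 a i : A) = 0}
  zero_mem' := fun i _ => by simp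
  add_mem' := fun {a b} ha hb i hi => by
    rw [DirectSum.decompose_add, DirectSum.add_apply, Submodule.coe_add, ha i hi, hb i hi, add_zero]
  smul_mem' := fun c a ha => decompose_mul_eq_zero ha c

lemma mem_truncIdeal_of_mem {r i : ℕ} (h : r ≤ i) {a : A} (ha : a ∈ 𝒜 i) :
    a ∈ truncIdeal 𝒜 r := fun j hj => DirectSum.decompose_of_mem_ne 𝒜 ha (by omega)

lemma truncIdeal_mul_le (r s : ℕ) : truncIdeal 𝒜 r * truncIdeal 𝒜 s ≤ truncIdeal 𝒜 (r + s) := by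
  classical
  refine Ideal.mul_le.2 fun a ha b hb => ?_
  rw [← DirectSum.sum_support_decompose 𝒜 a, ← DirectSum.sum_support_decompose 𝒜 b,
    Finset.sum_mul_sum]
  refine sum_mem fun i hi => sum_mem fun j hj => ?_
  refine mem_truncIdeal_of_mem (i := i + j) (add_le_add ?_ ?_)
    (SetLike.mul_mem_graded (SetLike.coe_mem _) (SetLike.coe_mem _))
  · by_contra! h
    exact (DFinsupp.mem_support_toFun _ _).1 hi (Subtype.ext (ha i h))
  · by_contra! h
    exact (DFinsupp.mem_support_toFun _ _).1 hj (Subtype.ext (hb j h))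

lemma truncIdeal_pow_le (r n : ℕ) : truncIdeal 𝒜 r ^ n ≤ truncIdeal 𝒜 (r * n) := by
  induction n with
  | zero => exact fun a _ i hi => by simp at hi
  | succ n ih =>
    rw [pow_succ, mul_add_one]
    exact (Ideal.mul_mono_left ih).trans (truncIdeal_mul_le _ _)

lemma dimPart_eq_zero_of_le {J : Ideal A} {r j : ℕ} (h : J ≤ truncIdeal 𝒜 r) (hj : j < r) :
    dimPart 𝒜 J j = 0 := by
  have : gradedPart 𝒜 J j = ⊥ := by
    rw [eq_bot_iff]
    intro a ha
    obtain ⟨h1, h2⟩ := mem_gradedPart.1 ha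
    have := h h1 j hj
    rwa [DirectSum.decompose_of_mem_same 𝒜 h2] at this
  rw [dimPart, this, finrank_bot]

/-- The initial degree of a nonzero homogeneous ideal. -/
lemma exists_initialDegree {J : Ideal A} (hJ : J.IsHomogeneous 𝒜) (h0 : J ≠ ⊥) :
    ∃ (e : ℕ) (f : A), f ∈ gradedPart 𝒜 J e ∧ f ≠ 0 ∧ J ≤ truncIdeal 𝒜 e := by
  classical
  have h1 : ∃ e, ∃ f ∈ gradedPart 𝒜 J e, f ≠ 0 := by
    obtain ⟨a, ha, ha0⟩ := Submodule.exists_mem_ne_zero_of_ne_bot h0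
    by_contra! h
    refine ha0 ?_
    rw [← DirectSum.sum_support_decompose 𝒜 a]
    exact Finset.sum_eq_zero fun i _ => h i _ (mem_gradedPart.2 ⟨hJ i ha, SetLike.coe_mem _⟩)
  obtain ⟨f, hf, hf0⟩ := Nat.find_spec h1
  refine ⟨Nat.find h1, f, hf, hf0, fun a ha i hi => ?_⟩
  by_contra h
  exact Nat.find_min h1 hi ⟨_, mem_gradedPart.2 ⟨hJ i ha, SetLike.coe_mem _⟩, h⟩

lemma GeneratedInDegreeLE.mul {K K' : Ideal A} {δ δ' : ℕ} (h : GeneratedInDegreeLE 𝒜 K δ)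
    (h' : GeneratedInDegreeLE 𝒜 K' δ') : GeneratedInDegreeLE 𝒜 (K * K') (δ + δ') := by
  refine (Ideal.mul_mono h h').trans ?_
  rw [Ideal.span_mul_span']
  refine Ideal.span_mono ?_
  rintro _ ⟨a, ⟨ha, i, hi, hai⟩, b, ⟨hb, j, hj, hbj⟩, rfl⟩
  exact ⟨Ideal.mul_mem_mul ha hb, i + j, add_le_add hi hj, SetLike.mul_mem_graded hai hbj⟩

lemma GeneratedInDegreeLE.pow {K : Ideal A} {δ : ℕ} (h : GeneratedInDegreeLE 𝒜 K δ) (n : ℕ) :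
    GeneratedInDegreeLE 𝒜 (K ^ n) (δ * n) := by
  induction n with
  | zero =>
    intro a _
    have : (1 : A) ∈ Ideal.span {a | a ∈ K ^ 0 ∧ ∃ i ≤ δ * 0, a ∈ 𝒜 i} :=
      Ideal.subset_span ⟨by simp, 0, le_rfl, SetLike.GradedOne.one_mem⟩
    rw [(Ideal.eq_top_iff_one _).2 this]
    trivial
  | succ n ih =>
    rw [pow_succ, mul_add_one]
    exact ih.mul h

lemma exists_generatedInDegreeLE [IsNoetherianRing A] {K : Ideal A} (hK : K.IsHomogeneous 𝒜) :
    ∃ δ, GeneratedInDegreeLE 𝒜 K δ := by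
  obtain ⟨r, e, f, hf, hs⟩ := exists_homogeneous_generators hK
  obtain ⟨δ, hδ⟩ := (Set.finite_range e).bddAbove
  refine ⟨δ, ?_⟩
  unfold GeneratedInDegreeLE
  conv_lhs => rw [← hs]
  refine Ideal.span_mono ?_
  rintro _ ⟨i, rfl⟩
  exact ⟨hs ▸ Ideal.subset_span ⟨i, rfl⟩, e i, hδ ⟨i, rfl⟩, hf i⟩

/-- If `𝒜 t * K ⊆ L` and `K` is generated in degrees at most `δ`, then `K` agrees with a subideal
of `L` in degrees at least `δ + t`. -/
lemma GeneratedInDegreeLE.mem_of_le (hA : IsStandardGraded 𝒜) {K L : Ideal A} {δ t : ℕ}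
    (h : GeneratedInDegreeLE 𝒜 K δ) (ht : ∀ a ∈ K, ∀ b ∈ 𝒜 t, a * b ∈ L) {j : ℕ} (hj : δ + t ≤ j)
    {a : A} (ha : a ∈ gradedPart 𝒜 K j) : a ∈ L := by
  classical
  obtain ⟨h1, h2⟩ := mem_gradedPart.1 ha
  have key : (DirectSum.decompose 𝒜 a j : A) ∈ L := by
    have h3 := h h1
    clear ha h2 h1
    induction h3 using Submodule.closure_induction with
    | zero => simp
    | add x y _ _ hx hy =>
      rw [DirectSum.decompose_add, DirectSum.add_apply, Submodule.coe_add]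
      exact add_mem hx hy
    | smul_mem c x hx =>
      obtain ⟨hxK, i, hi, hxi⟩ := hx
      -- The coefficient that matters is the component of `c` of degree `j - i`, which is at least
      -- `t` because `i ≤ δ`.
      rw [smul_eq_mul, DirectSum.coe_decompose_mul_of_right_mem_of_le 𝒜 hxi (by omega), mul_comm]
      exact hA.mul_mem_of_le (i := t) (by omega) (ht x hxK) _ (SetLike.coe_mem _)
  rwa [DirectSum.decompose_of_mem_same 𝒜 h2] at key

end Degrees

end EpsilonDensity

namespace EpsilonDensity

/-! ### Limits along every slope for the powers of an ideal. -/

section Limits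

lemma HasDensity.tendsto_floor {g : ℕ × ℕ → ℝ} {D : ℕ} {x l : ℝ} (h : HasDensity g D x l)
    (hx : 0 ≤ x) : Tendsto (fun n : ℕ => g (n, ⌊x * n⌋₊) / (n : ℝ) ^ D) atTop (𝓝 l) := by
  unfold HasDensity at h
  exact h.comp (tendsto_floor_slopeFilter hx)

variable {k A : Type*} [Field k] [CommRing A] [Algebra k A]
  {𝒜 : ℕ → Submodule k A} [GradedAlgebra 𝒜]

lemma sub_decompose_mem_truncIdeal {a : A} {r : ℕ} (ha : a ∈ truncIdeal 𝒜 r) :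
    a - DirectSum.decompose 𝒜 a r ∈ truncIdeal 𝒜 (r + 1) := by
  intro i hi
  rw [DirectSum.decompose_sub, DirectSum.sub_apply, Submodule.coe_sub]
  rcases (Nat.lt_succ_iff.1 hi).lt_or_eq with h | rfl
  · rw [ha i h, DirectSum.decompose_of_mem_ne 𝒜 (SetLike.coe_mem _) h.ne', sub_zero]
  · rw [DirectSum.decompose_of_mem_same 𝒜 (SetLike.coe_mem _), sub_self]

/-- Only the lowest components contribute to the lowest degree of a product. -/
lemma decompose_mul_of_mem_truncIdeal {a b : A} {r s : ℕ} (ha : a ∈ truncIdeal 𝒜 r)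
    (hb : b ∈ truncIdeal 𝒜 s) : (DirectSum.decompose 𝒜 (a * b) (r + s) : A) =
      DirectSum.decompose 𝒜 a r * DirectSum.decompose 𝒜 b s := by
  classical
  have h1 := sub_decompose_mem_truncIdeal ha
  have h2 := truncIdeal_mul_le _ _ (Ideal.mul_mem_mul h1 hb) (r + s) (by omega)
  rw [sub_mul, DirectSum.decompose_sub, DirectSum.sub_apply, Submodule.coe_sub, sub_eq_zero] at h2
  rw [h2, DirectSum.coe_decompose_mul_add_of_left_mem 𝒜 (SetLike.coe_mem _)]

lemma isHomogeneous_pow {J : Ideal A} (hJ : J.IsHomogeneous 𝒜) (n : ℕ) :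
    (J ^ n).IsHomogeneous 𝒜 := by
  induction n with
  | zero =>
    rw [pow_zero, Ideal.one_eq_top]
    exact Ideal.IsHomogeneous.top 𝒜
  | succ n ih =>
    rw [pow_succ]
    exact ih.mul hJ

/-- The lowest graded parts of the powers of an ideal are the powers of the lowest graded part. -/
lemma gradedPart_pow_eq {J : Ideal A} {e : ℕ} (he : J ≤ truncIdeal 𝒜 e)
    (hJ : J.IsHomogeneous 𝒜) (h𝒜 : 𝒜 0 = 1) (n : ℕ) :
    gradedPart 𝒜 (J ^ n) (e * n) = gradedPart 𝒜 J e ^ n := by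
  induction n with
  | zero =>
    rw [pow_zero, pow_zero, mul_zero, ← h𝒜]
    ext a
    simp [mem_gradedPart]
  | succ n ih =>
    apply le_antisymm
    · intro a ha
      obtain ⟨h1, h2⟩ := mem_gradedPart.1 ha
      have key : (DirectSum.decompose 𝒜 a (e * n + e) : A) ∈ gradedPart 𝒜 J e ^ (n + 1) := by
        clear h2 ha
        rw [pow_succ] at h1
        induction h1 using Submodule.mul_induction_on' with
        | mem_mul_mem x hx y hy =>
          have hx' := (Ideal.pow_right_mono he n).trans (truncIdeal_pow_le e n) hx
          rw [decompose_mul_of_mem_truncIdeal hx' (he hy), pow_succ, ← ih]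
          have hJn := isHomogeneous_pow hJ n
          exact Submodule.mul_mem_mul (mem_gradedPart.2 ⟨hJn _ hx, SetLike.coe_mem _⟩)
            (mem_gradedPart.2 ⟨hJ _ hy, SetLike.coe_mem _⟩)
        | add x _ y _ hx hy =>
          rw [DirectSum.decompose_add, DirectSum.add_apply, Submodule.coe_add]
          exact add_mem hx hy
      rwa [← mul_add_one, DirectSum.decompose_of_mem_same 𝒜 h2] at key
    · rw [pow_succ, ← ih, Submodule.mul_le]
      intro a ha b hb
      obtain ⟨h1, h2⟩ := mem_gradedPart.1 ha
      obtain ⟨h3, h4⟩ := mem_gradedPart.1 hb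
      exact mem_gradedPart.2 ⟨pow_succ J n ▸ Ideal.mul_mem_mul h1 h3,
        SetLike.mul_mem_graded h2 h4⟩

/-- The Hilbert functions of the powers of a homogeneous ideal have a limit along every slope. -/
theorem IsStandardGraded.exists_tendsto_pow [IsDomain A] (hA : IsStandardGraded 𝒜) {d : ℕ}
    (hd : ringKrullDim A = (d : WithBot ℕ∞)) (hd1 : 1 ≤ d) {J : Ideal A}
    (hJ : J.IsHomogeneous 𝒜) (h0 : J ≠ ⊥) {x : ℝ} (hx : 0 ≤ x) :
    ∃ l, Tendsto (fun n : ℕ => (dimPart 𝒜 (J ^ n) ⌊x * n⌋₊ : ℝ) / (n : ℝ) ^ (d - 1)) atTop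
      (𝓝 l) := by
  obtain ⟨e, f, hf, hf0, he⟩ := exists_initialDegree hJ h0
  -- Below slope `e` the graded parts vanish. At slope `e` they are the powers of the
  -- finite-dimensional space `J_e`. Above it the two monotonicities give the limit.
  rcases lt_trichotomy x e with h | rfl | h
  · refine ⟨0, tendsto_const_nhds.congr' ?_⟩
    filter_upwards [eventually_gt_atTop 0] with n hn
    have hn' : (0 : ℝ) < n := by exact_mod_cast hn
    rw [dimPart_eq_zero_of_le ((Ideal.pow_right_mono he n).trans (truncIdeal_pow_le e n)),
      Nat.cast_zero, zero_div]
    rw [Nat.floor_lt (by positivity)]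
    push_cast
    gcongr
  · obtain ⟨c, hc⟩ := hA.exists_dimPart_le hd hd1
    have := hA.finite_gradedPart J e
    have hfl : ∀ n : ℕ, dimPart 𝒜 (J ^ n) ⌊(e : ℝ) * n⌋₊ =
        Module.finrank k (gradedPart 𝒜 J e ^ n : Submodule k A) := fun n => by
      rw [← Nat.cast_mul, Nat.floor_natCast, dimPart, gradedPart_pow_eq he hJ hA.zero_eq]
    obtain ⟨l, hl⟩ := exists_tendsto_finrank_pow (W := gradedPart 𝒜 J e)
      (Module.Finite.iff_fg.1 this) (d := d - 1) (c := c * ((e : ℝ) + 1) ^ (d - 1)) fun n => by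
        have h1 := hc (J ^ n) (e * n)
        rw [dimPart, gradedPart_pow_eq he hJ hA.zero_eq] at h1
        calc _ ≤ ((c * (e * n + 1) ^ (d - 1) : ℕ) : ℝ) := Nat.cast_le.2 h1
          _ ≤ c * (((e : ℝ) + 1) * (n + 1)) ^ (d - 1) := by
            push_cast
            have h2 : (0 : ℝ) ≤ e := Nat.cast_nonneg e
            have h3 : (0 : ℝ) ≤ n := Nat.cast_nonneg n
            gcongr
            nlinarith
          _ = _ := by rw [mul_pow, mul_assoc]
    exact ⟨l, hl.congr fun n => by rw [hfl]⟩
  · obtain ⟨l, hl⟩ := hA.exists_hasDensity_pow hd hd1 hJ hf0 hf h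
    exact ⟨l, hl.tendsto_floor hx⟩

end Limits

/-- A Noetherian filtration of saturated homogeneous ideals. -/
structure IsSaturatedFiltration {k A : Type*} [Field k] [CommRing A] [Algebra k A]
    (𝒜 : ℕ → Submodule k A) [GradedAlgebra 𝒜] (F : ℕ → Ideal A) (m : ℕ) : Prop where
  pos : 0 < m
  zero_eq_top : F 0 = ⊤
  antitone : Antitone F
  mul_le : ∀ i j, F i * F j ≤ F (i + j)
  mul_eq : ∀ n, m ≤ n → F n * F m = F (n + m)
  isHomogeneous : ∀ n, (F n).IsHomogeneous 𝒜
  saturated : ∀ n, saturation 𝒜 (F n) = F n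

/-! ### The saturated filtration, in particular at its lowest slope. -/

namespace IsSaturatedFiltration

variable {k A : Type*} [Field k] [CommRing A] [Algebra k A]
  {𝒜 : ℕ → Submodule k A} [GradedAlgebra 𝒜] {F : ℕ → Ideal A} {m : ℕ}

lemma mul_pow_eq (hF : IsSaturatedFiltration 𝒜 F m) {i : ℕ} (hi : m ≤ i) (r : ℕ) :
    F i * F m ^ r = F (i + m * r) := by
  induction r with
  | zero => simp
  | succ r ih => rw [pow_succ, ← mul_assoc, ih, hF.mul_eq _ (by omega), mul_add_one, add_assoc]

lemma pow_eq (hF : IsSaturatedFiltration 𝒜 F m) {r : ℕ} (hr : 1 ≤ r) : F (m * r) = F m ^ r := by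
  obtain ⟨r, rfl⟩ := Nat.exists_eq_add_of_le' hr
  rw [pow_succ', hF.mul_pow_eq le_rfl, mul_add_one, add_comm]

lemma pow_le (hF : IsSaturatedFiltration 𝒜 F m) (n r : ℕ) : F n ^ r ≤ F (n * r) := by
  induction r with
  | zero => simp [hF.zero_eq_top]
  | succ r ih =>
    rw [pow_succ, mul_add_one]
    exact (Ideal.mul_mono_left ih).trans (hF.mul_le _ _)

lemma mul_mem (hF : IsSaturatedFiltration 𝒜 F m) {i j : ℕ} {a b : A} (ha : a ∈ F i)
    (hb : b ∈ F j) : a * b ∈ F (i + j) := hF.mul_le _ _ (Ideal.mul_mem_mul ha hb)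

/-- The power `a ^ m` lies in `F (m n) = F m ^ n`, which starts in degree `e n`, while its own
degree `j m` is smaller; so `a ^ m = 0`. -/
lemma eq_zero_of_lt [IsDomain A] (hF : IsSaturatedFiltration 𝒜 F m) {e : ℕ}
    (he : F m ≤ truncIdeal 𝒜 e) {n j : ℕ} (h : j * m < e * n) {a : A}
    (ha : a ∈ gradedPart 𝒜 (F n) j) : a = 0 := by
  obtain ⟨h1, h2⟩ := mem_gradedPart.1 ha
  have hn : 1 ≤ n := Nat.pos_of_ne_zero fun h0 => by simp [h0] at h
  have h3 : a ^ m ∈ truncIdeal 𝒜 (e * n) := by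
    have := hF.pow_le n m (Ideal.pow_mem_pow h1 m)
    rw [mul_comm, hF.pow_eq hn] at this
    exact (Ideal.pow_right_mono he n).trans (truncIdeal_pow_le e n) this
  have h4 : a ^ m ∈ 𝒜 (j * m) := by
    have := SetLike.pow_mem_graded m h2
    rwa [smul_eq_mul, mul_comm] at this
  have h5 := h3 (j * m) h
  rw [DirectSum.decompose_of_mem_same 𝒜 h4] at h5
  exact eq_zero_of_pow_eq_zero h5

lemma dimPart_eq_zero [IsDomain A] (hF : IsSaturatedFiltration 𝒜 F m) {e : ℕ}
    (he : F m ≤ truncIdeal 𝒜 e) {n j : ℕ} (h : j * m < e * n) : dimPart 𝒜 (F n) j = 0 := by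
  have : gradedPart 𝒜 (F n) j = ⊥ := by
    rw [eq_bot_iff]
    exact fun a ha => hF.eq_zero_of_lt he h ha
  rw [dimPart, this, finrank_bot]

/-- Not every linear form multiplies, up to a power, some nonzero element of lowest slope
`e / m` into a deeper step of the filtration. -/
lemma exists_linearForm [IsDomain A] [IsNoetherianRing A] (hA : IsStandardGraded 𝒜)
    (hF : IsSaturatedFiltration 𝒜 F m) {e : ℕ} (he0 : 0 < e) (he : F m ≤ truncIdeal 𝒜 e) :
    ∃ y ∈ 𝒜 1, ∀ c j R b, b ≠ 0 → b ∈ gradedPart 𝒜 (F c) j → j * m = e * c →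
      b * y ^ R ∉ F (c + m) := by
  classical
  by_contra! hcon
  obtain ⟨T, hT⟩ := Module.Finite.iff_fg.1 hA.finite_one
  -- Suppose every linear form fails with some `b`. The product of these elements over a finite set
  -- of linear forms still has slope `e / m` and serves for all of them at once.
  have hS : ∀ S : Finset A, (S : Set A) ⊆ 𝒜 1 → ∃ c j R b, b ≠ 0 ∧ b ∈ gradedPart 𝒜 (F c) j ∧
      j * m = e * c ∧ ∀ y ∈ S, b * y ^ R ∈ F (c + m) := by
    intro S
    induction S using Finset.induction_on with
    | empty =>
      exact fun _ => ⟨0, 0, 0, 1, one_ne_zero, mem_gradedPart.2 ⟨by simp [hF.zero_eq_top],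
        SetLike.GradedOne.one_mem⟩, by simp, by simp⟩
    | insert y S _ ih =>
      intro h
      rw [Finset.coe_insert, Set.insert_subset_iff] at h
      obtain ⟨c, j, R, b, hb0, hb, hj, hbS⟩ := ih h.2
      obtain ⟨c', j', R', b', hb0', hb', hj', hy⟩ := hcon y h.1
      rw [mem_gradedPart] at hb hb'
      refine ⟨c + c', j + j', R + R', b * b', mul_ne_zero hb0 hb0',
        mem_gradedPart.2 ⟨hF.mul_mem hb.1 hb'.1, SetLike.mul_mem_graded hb.2 hb'.2⟩,
        by rw [add_mul, mul_add, hj, hj'], fun z hz => ?_⟩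
      rcases Finset.mem_insert.1 hz with rfl | hz
      · have := Ideal.mul_mem_left _ (z ^ R) (hF.mul_mem hb.1 hy)
        have h1 : b * b' * z ^ (R + R') = z ^ R * (b * (b' * z ^ R')) := by ring
        rwa [h1, add_assoc]
      · have := Ideal.mul_mem_left _ (z ^ R') (hF.mul_mem hb'.1 (hbS z hz))
        have h1 : b * b' * z ^ (R + R') = z ^ R' * (b' * (b * z ^ R)) := by ring
        have h2 : c + c' + m = c' + (c + m) := by omega
        rwa [h1, h2]
  obtain ⟨c, j, R, b, hb0, hb, hj, hbT⟩ := hS T (hT ▸ Submodule.subset_span)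
  set C : Ideal A := (F (c + m)).colon {b} with hC
  have h1 : Ideal.span (T : Set A) ≤ C.radical := by
    refine Ideal.span_le.2 fun y hy => ⟨R, ?_⟩
    rw [hC, Submodule.mem_colon_singleton, smul_eq_mul, mul_comm]
    exact hbT y hy
  obtain ⟨n, hn⟩ := Ideal.exists_pow_le_of_le_radical_of_fg h1
    ((isNoetherianRing_iff_ideal_fg A).1 inferInstance _)
  have h2 : (𝒜 1 : Set A) ⊆ Ideal.span (T : Set A) := by
    have : 𝒜 1 ≤ (Ideal.span (T : Set A)).restrictScalars k := by
      rw [← hT]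
      exact Submodule.span_le.2 Ideal.subset_span
    exact this
  have h3 : ∀ i, 𝒜 i ≤ (Ideal.span (T : Set A) ^ i).restrictScalars k := by
    intro i
    induction i with
    | zero => exact fun b _ => by simp
    | succ i ih =>
      rw [← hA.mul_eq, Submodule.mul_le]
      intro b hb c hc
      rw [Submodule.restrictScalars_mem, pow_succ]
      exact Ideal.mul_mem_mul (ih hb) (h2 hc)
  -- A power of the irrelevant ideal now multiplies `b` into `F (c + m)`, so saturatedness puts `b`
  -- there; but its slope `j / (c + m)` is below `e / m`, which forces `b = 0`.
  have h4 : b ∈ F (c + m) := by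
    rw [← hF.saturated]
    refine hA.mem_saturation.2 ⟨n, fun z hz => ?_⟩
    have := hn (h3 n hz)
    rwa [hC, Submodule.mem_colon_singleton, smul_eq_mul, mul_comm] at this
  have hm := hF.pos
  refine hb0 (hF.eq_zero_of_lt he (n := c + m) (j := j) ?_
    (mem_gradedPart.2 ⟨h4, (mem_gradedPart.1 hb).2⟩))
  rw [hj]
  exact Nat.mul_lt_mul_of_pos_left (Nat.lt_add_of_pos_right hm) he0

/-- The parts of lowest slope `e / m` have fewer than maximal dimensions. -/
lemma mul_dimPart_le [IsDomain A] [IsNoetherianRing A] (hA : IsStandardGraded 𝒜)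
    (hF : IsSaturatedFiltration 𝒜 F m) {e : ℕ} (he0 : 0 < e) (he : F m ≤ truncIdeal 𝒜 e) {f : A}
    (hf : f ∈ gradedPart 𝒜 (F m) e) (hf0 : f ≠ 0) {c j : ℕ} (hj : j * m = e * c) (r : ℕ) :
    r * dimPart 𝒜 (F c) j ≤ Module.finrank k (𝒜 (j + e * r)) := by
  classical
  obtain ⟨y, hy1, hy⟩ := hF.exists_linearForm hA he0 he
  have := hA.finite (j + e * r)
  have := hA.finite_gradedPart (F c) j
  obtain ⟨hfF, hfe⟩ := mem_gradedPart.1 hf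
  -- The map `(a_i) ↦ ∑ a_i f ^ i y ^ (e (r - i))` takes values in degree `j + e r`, since `f` has
  -- degree `e` and `y` degree one.
  let φ : (Fin r → gradedPart 𝒜 (F c) j) →ₗ[k] A :=
    ∑ i : Fin r, (LinearMap.mulRight k (f ^ (i : ℕ) * y ^ (e * (r - i)))) ∘ₗ
      (gradedPart 𝒜 (F c) j).subtype ∘ₗ LinearMap.proj i
  have hφ : ∀ a, φ a = ∑ i : Fin r, (a i : A) * (f ^ (i : ℕ) * y ^ (e * (r - i))) := fun a => by
    simp [φ, LinearMap.sum_apply, mul_assoc]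
  have hfi : ∀ i : ℕ, f ^ i ∈ 𝒜 (e * i) := fun i => by
    have := SetLike.pow_mem_graded i hfe
    rwa [smul_eq_mul, mul_comm] at this
  have hrange : ∀ a, φ a ∈ 𝒜 (j + e * r) := by
    intro a
    rw [hφ]
    refine sum_mem fun i _ => ?_
    have h2 : y ^ (e * (r - i)) ∈ 𝒜 (e * (r - i)) := by
      have := SetLike.pow_mem_graded (e * (r - i)) hy1
      rwa [smul_eq_mul, mul_one] at this
    have h3 : e * r = e * i + e * (r - i) := by rw [← mul_add, Nat.add_sub_cancel' i.2.le]
    rw [h3]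
    exact SetLike.mul_mem_graded (mem_gradedPart.1 (a i).2).2 (SetLike.mul_mem_graded (hfi i) h2)
  have hinj : Function.Injective (φ.codRestrict (𝒜 (j + e * r)) hrange) := by
    rw [← LinearMap.ker_eq_bot, LinearMap.ker_codRestrict, LinearMap.ker_eq_bot']
    intro a ha
    by_contra hne
    have hne' : (Finset.univ.filter fun i => a i ≠ 0).Nonempty := by
      obtain ⟨i, hi⟩ := Function.ne_iff.1 hne
      exact ⟨i, by simpa using hi⟩
    -- In a relation the first nonzero term would equal minus the sum of the later ones, which lie
    -- in `F (c + m (i + 1))`. As `a_i f ^ i` lies in `F (c + m i)` with slope `e / m`, this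
    -- contradicts the choice of `y`.
    obtain ⟨i, hi, hmin⟩ := Finset.exists_min_image _ id hne'
    simp only [Finset.mem_filter, Finset.mem_univ, true_and, id] at hi hmin
    have hai : (a i : A) ≠ 0 := fun h => hi (Subtype.ext h)
    obtain ⟨h1, h2⟩ := mem_gradedPart.1 (a i).2
    have hmem : ∀ l : ℕ, ∀ b ∈ F c, b * f ^ l ∈ F (c + m * l) := fun l b hb =>
      hF.mul_mem hb (hF.pow_le m l (Ideal.pow_mem_pow hfF l))
    refine hy (c + m * i) (j + e * i) (e * (r - i)) (a i * f ^ (i : ℕ))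
      (mul_ne_zero hai (pow_ne_zero _ hf0))
      (mem_gradedPart.2 ⟨hmem _ _ h1, SetLike.mul_mem_graded h2 (hfi i)⟩)
      (by rw [add_mul, hj]; ring) ?_
    rw [hφ, ← Finset.add_sum_erase _ _ (Finset.mem_univ i), add_eq_zero_iff_eq_neg] at ha
    rw [mul_assoc, ha]
    refine neg_mem (sum_mem fun l hl => ?_)
    by_cases hal : a l = 0
    · simp [hal]
    · have hil : i < l := lt_of_le_of_ne (hmin l hal) (Finset.ne_of_mem_erase hl).symm
      rw [← mul_assoc]
      refine Ideal.mul_mem_right _ _ (hF.antitone ?_ (hmem l _ (mem_gradedPart.1 (a l).2).1))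
      have : m * (i + 1) ≤ m * l := Nat.mul_le_mul_left m hil
      rw [mul_add_one] at this
      omega
  have := LinearMap.finrank_le_finrank_of_injective hinj
  rw [Module.finrank_pi_fintype, Finset.sum_const, Finset.card_univ, Fintype.card_fin,
    smul_eq_mul] at this
  exact this

/-- The Hilbert functions of the filtration have a limit along every slope. -/
theorem exists_tendsto [IsDomain A] (hA : IsStandardGraded 𝒜) {d : ℕ}
    (hd : ringKrullDim A = (d : WithBot ℕ∞)) (hd1 : 1 ≤ d) (hF : IsSaturatedFiltration 𝒜 F m)
    (h0 : F m ≠ ⊥) {x : ℝ} (hx : 0 ≤ x) :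
    ∃ l, Tendsto (fun n : ℕ => (dimPart 𝒜 (F n) ⌊x * n⌋₊ : ℝ) / (n : ℝ) ^ (d - 1)) atTop
      (𝓝 l) := by
  have := hA.finiteType
  have : IsNoetherianRing A := Algebra.FiniteType.isNoetherianRing k A
  obtain ⟨e, f, hf, hf0, he⟩ := exists_initialDegree (hF.isHomogeneous m) h0
  have hm : (0 : ℝ) < m := by exact_mod_cast hF.pos
  rcases lt_trichotomy (x * m) e with h | h | h
  · refine ⟨0, tendsto_const_nhds.congr' ?_⟩
    filter_upwards [eventually_gt_atTop 0] with n hn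
    have hn' : (0 : ℝ) < n := by exact_mod_cast hn
    rw [hF.dimPart_eq_zero he, Nat.cast_zero, zero_div]
    have h1 : (⌊x * n⌋₊ : ℝ) ≤ x * n := Nat.floor_le (by positivity)
    have h2 : (⌊x * n⌋₊ : ℝ) * m < e * n := by nlinarith
    exact_mod_cast h2
  · rcases Nat.eq_zero_or_pos e with rfl | he0
    -- In initial degree zero `F m` contains a nonzero constant, so the whole filtration is trivial.
    · have hx0 : x = 0 := by
        rw [Nat.cast_zero] at h
        exact (mul_eq_zero.1 h).resolve_right hm.ne'
      have htop : F m = ⊤ := by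
        obtain ⟨h1, h2⟩ := mem_gradedPart.1 hf
        rw [hA.zero_eq, Submodule.mem_one] at h2
        obtain ⟨t, rfl⟩ := h2
        have ht : t ≠ 0 := by
          rintro rfl
          simp at hf0
        exact Ideal.eq_top_of_isUnit_mem _ h1 ((isUnit_iff_ne_zero.2 ht).map (algebraMap k A))
      have htop' : ∀ n, F n = ⊤ := fun n => by
        rw [eq_top_iff]
        calc ⊤ = F m ^ (n + 1) := by rw [htop, Ideal.top_pow]
          _ = F (m * (n + 1)) := (hF.pow_eq (by omega)).symm
          _ ≤ F n := hF.antitone (by nlinarith [hF.pos])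
      simp only [hx0, htop', zero_mul, Nat.floor_zero]
      rcases Nat.eq_zero_or_pos (d - 1) with hd0 | hd0
      · exact ⟨dimPart 𝒜 ⊤ 0, by simp [hd0]⟩
      · exact ⟨0, ((tendsto_pow_atTop hd0.ne').comp tendsto_natCast_atTop_atTop).const_div_atTop _⟩
    · obtain ⟨c, hc⟩ := hA.exists_dimPart_le hd hd1
      -- With `r = j + 1` the inequality for the lowest slope bounds `j + 1` times the dimension by
      -- a quantity of order `(j + 1) ^ (d - 1)`, so the limit is `0`.
      have hbound : ∀ n : ℕ, ((⌊x * n⌋₊ : ℝ) + 1) * dimPart 𝒜 (F n) ⌊x * n⌋₊ ≤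
          (c * ((e : ℝ) + 1) ^ (d - 1)) * ((⌊x * n⌋₊ : ℝ) + 1) ^ (d - 1) := by
        intro n
        set j := ⌊x * n⌋₊ with hj
        have h1 : (j : ℝ) ≤ x * n := Nat.floor_le (by positivity)
        have h2 : j * m ≤ e * n := by
          have : (j : ℝ) * m ≤ e * n := by nlinarith
          exact_mod_cast this
        rcases h2.lt_or_eq with h3 | h3
        · rw [hF.dimPart_eq_zero he h3, Nat.cast_zero, mul_zero]
          positivity
        · have h4 := hF.mul_dimPart_le hA he0 he hf hf0 h3 (j + 1)
          have h5 := hc ⊤ (j + e * (j + 1))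
          have h6 : dimPart 𝒜 ⊤ (j + e * (j + 1)) = Module.finrank k (𝒜 (j + e * (j + 1))) := by
            have : gradedPart 𝒜 ⊤ (j + e * (j + 1)) = 𝒜 (j + e * (j + 1)) := by
              ext; simp [mem_gradedPart]
            rw [dimPart, this]
          rw [h6] at h5
          have h7 := h4.trans h5
          have h8 : j + e * (j + 1) + 1 = (e + 1) * (j + 1) := by ring
          rw [h8, mul_pow, ← mul_assoc] at h7
          exact_mod_cast h7
      have hx0 : 0 < x := by
        have : (0 : ℝ) < x * m := by rw [h]; exact_mod_cast he0
        exact pos_of_mul_pos_left this hm.le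
      refine ⟨0, ?_⟩
      have h1 := (hasDensity_const_mul_pow (c * ((e : ℝ) + 1) ^ (d - 1))
        (d - 1) x).tendsto_floor hx
      have h2 : Tendsto (fun n : ℕ => ((⌊x * n⌋₊ : ℝ) + 1)⁻¹) atTop (𝓝 0) := by
        have h3 : Tendsto (fun n : ℕ => (⌊x * n⌋₊ : ℝ)) atTop atTop :=
          tendsto_natCast_atTop_atTop.comp (tendsto_nat_floor_atTop.comp
            (tendsto_natCast_atTop_atTop.const_mul_atTop hx0))
        exact (tendsto_atTop_add_const_right _ 1 h3).inv_tendsto_atTop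
      have h3 := h1.mul h2
      rw [mul_zero] at h3
      refine squeeze_zero (fun n => by positivity) (fun n => ?_) h3
      have h4 : (0 : ℝ) < (⌊x * n⌋₊ : ℝ) + 1 := by positivity
      rw [div_mul_eq_mul_div]
      refine div_le_div_of_nonneg_right ?_ (by positivity)
      rw [← div_eq_mul_inv, le_div_iff₀ h4, mul_comm]
      exact hbound n
  · obtain ⟨l, hl⟩ := hA.exists_hasDensity_pow hd hd1 (hF.isHomogeneous m) hf0 hf
      (x := m * x) (by rwa [mul_comm] at h)
    have := HasDensity.of_multiples (g := fun p => (dimPart 𝒜 (F p.1) p.2 : ℝ)) hF.pos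
      (fun n n' j hn => Nat.cast_le.2 (hA.dimPart_mono (hF.antitone hn) j))
      (fun r j hr => by simp only [hF.pow_eq hr]) hl
    exact ⟨_, this.tendsto_floor hx⟩

theorem piecewiseDensity [IsDomain A] (hA : IsStandardGraded 𝒜) {d : ℕ}
    (hd : ringKrullDim A = (d : WithBot ℕ∞)) (hd1 : 1 ≤ d) (hF : IsSaturatedFiltration 𝒜 F m) :
    PiecewiseDensity (fun p : ℕ × ℕ => (dimPart 𝒜 (F p.1) p.2 : ℝ)) (d - 1) :=
  PiecewiseDensity.of_multiples hF.pos
    (fun _ _ j hn => Nat.cast_le.2 (hA.dimPart_mono (hF.antitone hn) j))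
    (fun r j hr => by simp only [hF.pow_eq hr])
    (hA.piecewiseDensity_pow hd hd1 (hF.isHomogeneous m))

theorem piecewiseDensity_sum [Nontrivial A] (hA : IsStandardGraded 𝒜) {d : ℕ}
    (hd : ringKrullDim A = (d : WithBot ℕ∞)) (hF : IsSaturatedFiltration 𝒜 F m) :
    PiecewiseDensity (fun p : ℕ × ℕ =>
      ∑ j ∈ Finset.range (p.2 + 1), (dimPart 𝒜 (F p.1) j : ℝ)) d :=
  PiecewiseDensity.of_multiples hF.pos
    (fun _ _ j hn => Finset.sum_le_sum fun i _ =>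
      Nat.cast_le.2 (hA.dimPart_mono (hF.antitone hn) i))
    (fun r j hr => by simp only [hF.pow_eq hr])
    (hA.piecewiseDensity_sum_pow hd (hF.isHomogeneous m))

/-- If each `F n` lies in the saturation of `I ^ n`, the two ideals agree from some linear
function of `n` on. -/
theorem exists_gradedPart_le [IsNoetherianRing A] (hA : IsStandardGraded 𝒜)
    (hF : IsSaturatedFiltration 𝒜 F m) {I : Ideal A} (hI : ∀ n, F n ≤ saturation 𝒜 (I ^ n)) :
    ∃ c : ℕ, ∀ n j, m ≤ n → c * n ≤ j → ∀ a ∈ gradedPart 𝒜 (F n) j, a ∈ I ^ n := by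
  have h1 : ∀ i, ∃ t, ∀ a ∈ F i, ∀ b ∈ 𝒜 t, a * b ∈ I ^ i := fun i =>
    hA.exists_forall_mul_mem (hI i)
  have h2 : ∀ i, ∃ δ, GeneratedInDegreeLE 𝒜 (F i) δ := fun i =>
    exists_generatedInDegreeLE (hF.isHomogeneous i)
  choose t ht using h1
  choose δ hδ using h2
  set t' := (Finset.range (2 * m)).sup t
  set δ' := (Finset.range (2 * m)).sup δ
  have ht' : ∀ i < 2 * m, ∀ a ∈ F i, ∀ b ∈ 𝒜 t', a * b ∈ I ^ i := fun i hi a ha =>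
    hA.mul_mem_of_le (Finset.le_sup (f := t) (Finset.mem_range.2 hi)) (ht i a ha)
  have hδ' : ∀ i < 2 * m, GeneratedInDegreeLE 𝒜 (F i) δ' := fun i hi =>
    (hδ i).mono (Finset.le_sup (f := δ) (Finset.mem_range.2 hi))
  have hm := hF.pos
  refine ⟨δ' + t', fun n j hn hj a ha => ?_⟩
  -- Now `F n = F i * F m ^ r` with `i` in the finite window from `m` to `2 m - 1`, so generator
  -- degrees and saturation exponents need only be bounded there.
  obtain ⟨i, r, hi1, hi2, hr⟩ : ∃ i r, m ≤ i ∧ i < 2 * m ∧ n = i + m * r := by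
    refine ⟨m + n % m, n / m - 1, by omega, ?_, ?_⟩
    · have := Nat.mod_lt n hm
      omega
    · have h3 : 1 ≤ n / m := (Nat.one_le_div_iff hm).2 hn
      obtain ⟨q, hq⟩ := Nat.exists_eq_add_of_le' h3
      have h4 := Nat.mod_add_div n m
      rw [hq] at h4 ⊢
      rw [mul_add_one] at h4
      rw [Nat.add_sub_cancel]
      omega
  -- The exponents add up over the `r + 1` factors, as do the generator degrees; both are at most
  -- linear in `n` because `r + 1 ≤ n`.
  have hmul : ∀ r, ∀ a ∈ F i * F m ^ r, ∀ b ∈ 𝒜 (t' * (r + 1)), a * b ∈ I ^ (i + m * r) := by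
    intro r
    induction r with
    | zero => simpa using ht' i hi2
    | succ r ih =>
      intro a ha
      rw [pow_succ, ← mul_assoc] at ha
      rw [mul_add_one t' (r + 1)]
      refine hA.mul_mem_of_add fun b hb c hc => ?_
      induction ha using Submodule.mul_induction_on' with
      | mem_mul_mem x hx y hy =>
        have h3 := Ideal.mul_mem_mul (ih x hx b hb) (ht' m (by omega) y hy c hc)
        rw [← pow_add] at h3
        have h4 : x * y * b * c = x * b * (y * c) := by ring
        rwa [h4, mul_add_one, ← add_assoc]
      | add x _ y _ hx hy =>
        rw [add_mul, add_mul]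
        exact add_mem hx hy
  have hgen := (hδ' i hi2).mul ((hδ' m (by omega)).pow r)
  rw [hr, ← hF.mul_pow_eq hi1] at ha
  rw [hr]
  refine hgen.mem_of_le hA (hmul r) (le_trans ?_ hj) ha
  have h5 : r + 1 ≤ n := by nlinarith
  calc δ' + δ' * r + t' * (r + 1) = (δ' + t') * (r + 1) := by ring
    _ ≤ (δ' + t') * n := Nat.mul_le_mul_left _ h5

end IsSaturatedFiltration

end EpsilonDensity

namespace EpsilonDensity

/-! ### The length as a sum of dimensions of graded parts. -/

section Length

/-- When `A` acts through scalars of `k`, both rings have the same submodules. -/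
lemma length_eq_of_smul_eq {k A M : Type*} [Field k] [CommRing A] [Algebra k A] [AddCommGroup M]
    [Module k M] [Module A M] [IsScalarTower k A M]
    (h : ∀ a : A, ∃ t : k, ∀ x : M, a • x = t • x) : Module.length A M = Module.length k M := by
  let e : Submodule A M ≃o Submodule k M :=
    { toFun := fun N => N.restrictScalars k
      invFun := fun N =>
        { N with
          smul_mem' := fun a x hx => by
            obtain ⟨t, ht⟩ := h a
            rw [ht]
            exact N.smul_mem t hx }
      left_inv := fun _ => rfl
      right_inv := fun _ => rfl
      map_rel_iff' := Iff.rfl }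
  apply WithBot.coe_injective
  rw [Module.coe_length, Module.coe_length]
  exact Order.krullDim_eq_of_orderIso e

lemma length_quotient_submoduleOf_add {A M : Type*} [CommRing A] [AddCommGroup M] [Module A M]
    {P Q R : Submodule A M} (hPQ : P ≤ Q) (hQR : Q ≤ R) :
    Module.length A (R ⧸ P.submoduleOf R) =
      Module.length A (Q ⧸ P.submoduleOf Q) + Module.length A (R ⧸ Q.submoduleOf R) := by
  have h1 : P.submoduleOf Q ≤ (P.submoduleOf R).comap (Submodule.inclusion hQR) :=
    fun _ hx => hx
  have h2 : P.submoduleOf R ≤ (Q.submoduleOf R).comap LinearMap.id := fun _ hx => hPQ hx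
  refine Module.length_eq_add_of_exact (Submodule.mapQ _ _ (Submodule.inclusion hQR) h1)
    (Submodule.mapQ _ _ LinearMap.id h2) ?_ ?_ ?_
  · rw [← LinearMap.ker_eq_bot, LinearMap.ker_eq_bot']
    intro x hx
    obtain ⟨x, rfl⟩ := Submodule.Quotient.mk_surjective _ x
    rw [Submodule.mapQ_apply, Submodule.Quotient.mk_eq_zero] at hx
    exact (Submodule.Quotient.mk_eq_zero _).2 hx
  · intro x
    obtain ⟨x, rfl⟩ := Submodule.Quotient.mk_surjective _ x
    exact ⟨Submodule.Quotient.mk x, by rw [Submodule.mapQ_apply, LinearMap.id_apply]⟩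
  · intro x
    obtain ⟨x, rfl⟩ := Submodule.Quotient.mk_surjective _ x
    rw [Submodule.mapQ_apply, LinearMap.id_apply, Submodule.Quotient.mk_eq_zero]
    constructor
    · intro hx
      exact ⟨Submodule.Quotient.mk ⟨x, hx⟩, by rw [Submodule.mapQ_apply]; rfl⟩
    · rintro ⟨y, hy⟩
      obtain ⟨y, rfl⟩ := Submodule.Quotient.mk_surjective _ y
      rw [Submodule.mapQ_apply, Submodule.Quotient.eq] at hy
      have h3 : (y : M) - x ∈ P := hy
      have h4 := sub_mem y.2 (hPQ h3)
      rwa [sub_sub_cancel] at h4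

variable {k A : Type*} [Field k] [CommRing A] [Algebra k A]
  {𝒜 : ℕ → Submodule k A} [GradedAlgebra 𝒜]

/-- The dimension of the degree `j` part of `F / G`. -/
noncomputable def quotientDimPart (𝒜 : ℕ → Submodule k A) (F G : Ideal A) (j : ℕ) : ℕ :=
  Module.finrank k (gradedPart 𝒜 F j ⧸ (gradedPart 𝒜 G j).submoduleOf (gradedPart 𝒜 F j))

lemma IsStandardGraded.quotientDimPart_add (hA : IsStandardGraded 𝒜) {F G : Ideal A} (h : G ≤ F)
    (j : ℕ) : quotientDimPart 𝒜 F G j + dimPart 𝒜 G j = dimPart 𝒜 F j := by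
  have := hA.finite_gradedPart F j
  have hle : gradedPart 𝒜 G j ≤ gradedPart 𝒜 F j := fun a ha =>
    mem_gradedPart.2 ⟨h (mem_gradedPart.1 ha).1, (mem_gradedPart.1 ha).2⟩
  have h1 := Submodule.finrank_quotient_add_finrank
    ((gradedPart 𝒜 G j).submoduleOf (gradedPart 𝒜 F j))
  rw [(Submodule.submoduleOfEquivOfLe hle).finrank_eq] at h1
  exact h1

/-- One step of the filtration of `F / G` by degree. -/
lemma IsStandardGraded.length_step (hA : IsStandardGraded 𝒜) {F G : Ideal A}
    (hF : F.IsHomogeneous 𝒜) (hG : G.IsHomogeneous 𝒜) (j : ℕ) :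
    Module.length A ((G ⊔ F ⊓ truncIdeal 𝒜 j : Ideal A) ⧸
      (G ⊔ F ⊓ truncIdeal 𝒜 (j + 1)).submoduleOf (G ⊔ F ⊓ truncIdeal 𝒜 j)) =
      quotientDimPart 𝒜 F G j := by
  set N := G ⊔ F ⊓ truncIdeal 𝒜 j with hN
  set N' := G ⊔ F ⊓ truncIdeal 𝒜 (j + 1) with hN'
  -- Elements without constant term annihilate `N / N'`, so `A` acts on it through its degree zero
  -- part `k`.
  have hmul : ∀ a ∈ truncIdeal 𝒜 1, ∀ x ∈ N, a * x ∈ N' := by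
    intro a ha x hx
    obtain ⟨g, hg, y, hy, rfl⟩ := Submodule.mem_sup.1 hx
    rw [mul_add]
    refine Submodule.add_mem_sup (G.mul_mem_left a hg) ⟨F.mul_mem_left a hy.1, ?_⟩
    have := truncIdeal_mul_le _ _ (Ideal.mul_mem_mul ha hy.2)
    rwa [add_comm] at this
  rw [length_eq_of_smul_eq (k := k)]
  · let ψ : gradedPart 𝒜 F j →ₗ[k] N ⧸ N'.submoduleOf N :=
      ((N'.submoduleOf N).mkQ.restrictScalars k) ∘ₗ
        LinearMap.codRestrict (N.restrictScalars k) (gradedPart 𝒜 F j).subtype fun a =>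
          (le_sup_right : F ⊓ truncIdeal 𝒜 j ≤ N) ⟨(mem_gradedPart.1 a.2).1,
            mem_truncIdeal_of_mem le_rfl (mem_gradedPart.1 a.2).2⟩
    have hψ : ∀ a, ψ a = 0 ↔ (a : A) ∈ N' := fun a => Submodule.Quotient.mk_eq_zero _
    have hsurj : Function.Surjective ψ := by
      intro x
      obtain ⟨⟨x, hx⟩, rfl⟩ := Submodule.Quotient.mk_surjective _ x
      obtain ⟨g, hg, y, hy, rfl⟩ := Submodule.mem_sup.1 hx
      refine ⟨⟨DirectSum.decompose 𝒜 y j, mem_gradedPart.2 ⟨hF j hy.1, SetLike.coe_mem _⟩⟩, ?_⟩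
      refine (Submodule.Quotient.eq _).2 ?_
      have : (DirectSum.decompose 𝒜 y j : A) - (g + y) ∈ N' := by
        rw [← neg_mem_iff, neg_sub, add_sub_assoc]
        exact Submodule.add_mem_sup hg ⟨sub_mem hy.1 (hF j hy.1), sub_decompose_mem_truncIdeal hy.2⟩
      exact this
    have hker : LinearMap.ker ψ = (gradedPart 𝒜 G j).submoduleOf (gradedPart 𝒜 F j) := by
      ext a
      rw [LinearMap.mem_ker, hψ]
      change _ ↔ (a : A) ∈ gradedPart 𝒜 G j
      obtain ⟨h1, h2⟩ := mem_gradedPart.1 a.2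
      constructor
      · intro ha
        obtain ⟨g, hg, y, hy, hgy⟩ := Submodule.mem_sup.1 ha
        have h3 := hG j hg
        have h4 : (DirectSum.decompose 𝒜 g j : A) = a := by
          rw [← DirectSum.decompose_of_mem_same 𝒜 h2, ← hgy, DirectSum.decompose_add,
            DirectSum.add_apply, Submodule.coe_add, hy.2 j (Nat.lt_succ_self j), add_zero]
        rw [h4] at h3
        exact mem_gradedPart.2 ⟨h3, h2⟩
      · exact fun ha => Submodule.mem_sup_left (mem_gradedPart.1 ha).1
    let e := (Submodule.quotEquivOfEq _ _ hker.symm).trans (ψ.quotKerEquivOfSurjective hsurj)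
    have := hA.finite_gradedPart F j
    rw [← e.length_eq, Module.length_eq_finrank]
    rfl
  · intro a
    have h1 : (DirectSum.decompose 𝒜 a 0 : A) ∈ (1 : Submodule k A) :=
      hA.zero_eq ▸ SetLike.coe_mem _
    obtain ⟨t, ht⟩ := Submodule.mem_one.1 h1
    refine ⟨t, fun x => ?_⟩
    obtain ⟨x, rfl⟩ := Submodule.Quotient.mk_surjective _ x
    rw [← algebraMap_smul A t, ← sub_eq_zero, ← sub_smul, ← Submodule.Quotient.mk_smul,
      Submodule.Quotient.mk_eq_zero]
    refine hmul _ ?_ x x.2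
    rw [ht]
    exact sub_decompose_mem_truncIdeal (r := 0) fun i hi => absurd hi (Nat.not_lt_zero i)

/-- If `G ⊆ F` agree in degrees at least `c`, then the length of `F / G` is the sum of the
dimensions of the graded parts. -/
theorem IsStandardGraded.length_eq_sum (hA : IsStandardGraded 𝒜) {F G : Ideal A}
    (hF : F.IsHomogeneous 𝒜) (hG : G.IsHomogeneous 𝒜) (hGF : G ≤ F) {c : ℕ}
    (hc : ∀ j, c ≤ j → ∀ a ∈ gradedPart 𝒜 F j, a ∈ G) :
    Module.length A (F ⧸ G.submoduleOf F) =
      ((∑ j ∈ Finset.range c, quotientDimPart 𝒜 F G j : ℕ) : ℕ∞) := by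
  classical
  -- The ideals `G + F_{≥ j}` descend from `F` at `j = 0` to `G` at `j = c`.
  have hle : ∀ j, G ⊔ F ⊓ truncIdeal 𝒜 (j + 1) ≤ G ⊔ F ⊓ truncIdeal 𝒜 j := fun j =>
    sup_le_sup_left (inf_le_inf_left _ fun a ha i hi => ha i (by omega)) _
  have hle' : ∀ j, G ⊔ F ⊓ truncIdeal 𝒜 j ≤ F := fun j => sup_le hGF inf_le_left
  have key : ∀ r, Module.length A (F ⧸ (G ⊔ F ⊓ truncIdeal 𝒜 r).submoduleOf F) =
      ((∑ j ∈ Finset.range r, quotientDimPart 𝒜 F G j : ℕ) : ℕ∞) := by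
    intro r
    induction r with
    | zero =>
      have h0 : G ⊔ F ⊓ truncIdeal 𝒜 0 = F := by
        have : truncIdeal 𝒜 0 = ⊤ := eq_top_iff.2 fun a _ i hi => absurd hi (Nat.not_lt_zero i)
        rw [this, inf_top_eq, sup_eq_right.2 hGF]
      rw [h0, Submodule.submoduleOf_self]
      simp [Module.length_eq_zero]
    | succ r ih =>
      rw [length_quotient_submoduleOf_add (hle r) (hle' r), ih, hA.length_step hF hG,
        Finset.sum_range_succ, add_comm]
      push_cast
      rfl
  have hlast : G ⊔ F ⊓ truncIdeal 𝒜 c = G := by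
    refine sup_eq_left.2 fun a ha => ?_
    rw [← DirectSum.sum_support_decompose 𝒜 a]
    refine sum_mem fun i _ => ?_
    rcases lt_or_ge i c with h | h
    · rw [ha.2 i h]
      exact zero_mem _
    · exact hc i h _ (mem_gradedPart.2 ⟨hF i ha.1, SetLike.coe_mem _⟩)
  rw [← key c, hlast]

end Length

end EpsilonDensity

namespace EpsilonDensity

/-! ### Ordering the cut points. -/

section PiecewisePolynomial

lemma cutEval_eq_of_forall_le (Q : ℚ →₀ ℚ[X]) {a : ℚ} {x : ℝ} (hax : (a : ℝ) < x)
    (h : ∀ b ∈ Q.support, (b : ℝ) < x → b ≤ a) :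
    cutEval Q x = Polynomial.aeval x (∑ b ∈ Q.support.filter (· ≤ a), Q b) := by
  rw [cutEval, Finsupp.sum, map_sum, Finset.sum_filter]
  refine Finset.sum_congr rfl fun b hb => ?_
  have : (b : ℝ) < x ↔ b ≤ a := ⟨h b hb, fun hba => lt_of_le_of_lt (by exact_mod_cast hba) hax⟩
  simp only [this]

/-- This is the source of the rationality of the epsilon multiplicity. -/
lemma cutEval_ratCast (Q : ℚ →₀ ℚ[X]) (x : ℚ) : ∃ y : ℚ, cutEval Q x = y := by
  refine ⟨Q.sum fun a q => if a < x then q.eval x else 0, ?_⟩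
  rw [cutEval, Finsupp.sum, Finsupp.sum, Rat.cast_sum]
  refine Finset.sum_congr rfl fun a _ => ?_
  simp only [Rat.cast_lt]
  split_ifs
  · rw [← eq_ratCast (algebraMap ℚ ℝ) x, Polynomial.aeval_algebraMap_apply,
      Polynomial.coe_aeval_eq_eval, eq_ratCast]
  · simp

/-- A piecewise polynomial function in the sense of `PiecewiseDensity` that vanishes for large
arguments is piecewise polynomial. -/
theorem exists_piecewise_of_cutEval {E : Finset ℚ} {Q : ℚ →₀ ℚ[X]} {D : ℕ} (hQE : Q.support ⊆ E)
    (hE : ∀ a ∈ E, 0 ≤ a) (hQ : ∀ a, (Q a).natDegree ≤ D) {f : ℝ≥0 → ℝ}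
    (hf : ∀ x : ℝ≥0, 0 < x → (∀ a ∈ E, (a : ℝ) ≠ x) → f x = cutEval Q x) {c : ℝ}
    (hc : ∀ x : ℝ≥0, c < x → f x = 0) :
    ∃ (r : ℕ) (a : Fin (r + 1) → ℚ) (q : Fin r → ℚ[X]),
      StrictMono a ∧ (∀ i, 0 ≤ a i) ∧ (∀ i, (q i).natDegree ≤ D) ∧
      (∀ x : ℝ≥0, ((x : ℝ) < (a 0 : ℝ) ∨ (a (Fin.last r) : ℝ) < (x : ℝ)) → f x = 0) ∧
      (∀ (i : Fin r) (x : ℝ≥0), (a i.castSucc : ℝ) < (x : ℝ) → (x : ℝ) < (a i.succ : ℝ) →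
        f x = Polynomial.aeval (x : ℝ) (q i)) := by
  classical
  obtain ⟨N, hN⟩ := exists_nat_gt c
  -- The extra cut point `0` makes the range to the left of the first one empty, and `N > c` makes
  -- the function vanish to the right of the last one.
  set E' : Finset ℚ := insert 0 (insert (N : ℚ) E) with hE'
  obtain ⟨r, hr⟩ : ∃ r, E'.card = r + 1 :=
    Nat.exists_eq_succ_of_ne_zero (Finset.card_ne_zero_of_mem (Finset.mem_insert_self 0 _))
  set a := E'.orderEmbOfFin hr with ha
  have hmem : ∀ i, a i ∈ E' := Finset.orderEmbOfFin_mem E' hr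
  have hsurj : ∀ b ∈ E', ∃ i, a i = b := fun b hb => by
    have : b ∈ Set.range a := by rw [ha, Finset.range_orderEmbOfFin]; exact hb
    exact this
  have hpos : ∀ i, 0 ≤ a i := fun i => by
    rcases Finset.mem_insert.1 (hmem i) with h | h
    · exact h.ge
    · rcases Finset.mem_insert.1 h with h | h
      · rw [h]; positivity
      · exact hE _ h
  have hEE' : E ⊆ E' := (Finset.subset_insert _ _).trans (Finset.subset_insert _ _)
  refine ⟨r, a, fun i => ∑ b ∈ Q.support.filter (· ≤ a i.castSucc), Q b, a.strictMono, hpos,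
    fun i => Polynomial.natDegree_sum_le_of_forall_le _ _ fun b _ => hQ b, ?_, ?_⟩
  · rintro x (hx | hx)
    · obtain ⟨i, hi⟩ := hsurj 0 (Finset.mem_insert_self 0 _)
      have h1 : a 0 ≤ 0 := hi ▸ a.monotone (Fin.zero_le i)
      have h2 : (a 0 : ℝ) ≤ 0 := by exact_mod_cast h1
      exact absurd (hx.trans_le h2) (not_lt.2 x.2)
    · obtain ⟨i, hi⟩ := hsurj N (Finset.mem_insert_of_mem (Finset.mem_insert_self _ _))
      have h1 : (N : ℚ) ≤ a (Fin.last r) := hi ▸ a.monotone (Fin.le_last i)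
      have h2 : (N : ℝ) ≤ a (Fin.last r) := by exact_mod_cast h1
      exact hc x (by linarith)
  · intro i x h1 h2
    have hbetween : ∀ b ∈ E', (b : ℝ) < x → b ≤ a i.castSucc := by
      intro b hb hbx
      obtain ⟨l, rfl⟩ := hsurj b hb
      refine a.monotone ?_
      have h3 : a l < a i.succ := by exact_mod_cast hbx.trans h2
      exact Fin.le_castSucc_iff.2 (a.lt_iff_lt.1 h3)
    have h0 : (0 : ℝ) ≤ a i.castSucc := by exact_mod_cast hpos _
    rw [hf x (by exact_mod_cast h0.trans_lt h1) fun b hb hbx => ?_,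
      cutEval_eq_of_forall_le Q h1 fun b hb => hbetween b (hEE' (hQE hb))]
    obtain ⟨l, rfl⟩ := hsurj b (hEE' hb)
    rw [← hbx] at h1 h2
    have h3 : a i.castSucc < a l := by exact_mod_cast h1
    have h4 : a l < a i.succ := by exact_mod_cast h2
    exact absurd (Fin.le_castSucc_iff.2 (a.lt_iff_lt.1 h4)) (not_le.2 (a.lt_iff_lt.1 h3))

end PiecewisePolynomial

/-! ### Rational limits of total lengths. -/

section EpsilonMultiplicity

/-- Normalized natural numbers converge in `[0, ∞]` when they do in the reals. -/
lemma tendsto_ennreal_div {s : ℕ → ℕ} {d : ℕ} {l : ℝ}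
    (h : Tendsto (fun n : ℕ => (s n : ℝ) / (n : ℝ) ^ d) atTop (𝓝 l)) :
    Tendsto (fun n : ℕ => (s n : ℝ≥0∞) / ((n : ℝ≥0∞) ^ d / (d.factorial : ℝ≥0∞))) atTop
      (𝓝 (ENNReal.ofReal (d.factorial * l))) := by
  refine (ENNReal.tendsto_ofReal (h.const_mul (d.factorial : ℝ))).congr' ?_
  filter_upwards [eventually_gt_atTop 0] with n hn
  have hn' : (0 : ℝ) < n := by exact_mod_cast hn
  have hd : (0 : ℝ) < d.factorial := by exact_mod_cast d.factorial_pos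
  have e1 : (d.factorial : ℝ) * (s n / (n : ℝ) ^ d) = s n / ((n : ℝ) ^ d / d.factorial) := by
    field_simp
  rw [e1, ENNReal.ofReal_div_of_pos (by positivity), ENNReal.ofReal_div_of_pos hd,
    ENNReal.ofReal_pow hn'.le, ENNReal.ofReal_natCast, ENNReal.ofReal_natCast,
    ENNReal.ofReal_natCast]

/-- The cumulative sums of a function supported below a line have a rational limit. -/
lemma exists_tendsto_sum {h : ℕ → ℕ → ℕ} {d c : ℕ}
    (hH : PiecewiseDensity (fun p : ℕ × ℕ => ∑ j ∈ Finset.range (p.2 + 1), (h p.1 j : ℝ)) d)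
    (hc : ∀ᶠ n in atTop, ∀ j, c * n ≤ j → h n j = 0) :
    ∃ l : ℚ, 0 ≤ l ∧ Tendsto (fun n : ℕ =>
      ((∑ j ∈ Finset.range (c * n), h n j : ℕ) : ℝ) / (n : ℝ) ^ d) atTop (𝓝 l) := by
  obtain ⟨E, Q, -, -, -, h4⟩ := hH
  obtain ⟨M, hM⟩ := E.bddAbove
  -- An integer slope beyond all cut points and beyond `c`: the sum up to `y n` then contains the
  -- whole support, and the density there is a rational number.
  obtain ⟨y, hy⟩ := exists_nat_gt (max (M : ℝ) (max c 1))
  have hyM : (M : ℝ) < y := (le_max_left _ _).trans_lt hy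
  have hyc : (c : ℝ) < y := ((le_max_left _ _).trans (le_max_right _ _)).trans_lt hy
  have hy1 : (1 : ℝ) < y := ((le_max_right _ _).trans (le_max_right _ _)).trans_lt hy
  have h5 := h4 y (by linarith) fun a ha hay => by
    have h6 : (a : ℝ) ≤ M := by exact_mod_cast hM ha
    linarith
  obtain ⟨l, hl⟩ := cutEval_ratCast Q y
  rw [Rat.cast_natCast] at hl
  rw [hl] at h5
  have h6 := h5.tendsto_floor (by linarith)
  have h7 : Tendsto (fun n : ℕ =>
      ((∑ j ∈ Finset.range (c * n), h n j : ℕ) : ℝ) / (n : ℝ) ^ d) atTop (𝓝 l) := by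
    refine h6.congr' ?_
    filter_upwards [hc] with n hn
    rw [← Nat.cast_mul, Nat.floor_natCast]
    push_cast
    congr 1
    symm
    refine Finset.sum_subset ?_ fun j _ hj => ?_
    · refine Finset.range_subset_range.2 ?_
      have : c ≤ y := by exact_mod_cast hyc.le
      nlinarith
    · rw [hn j (by simpa using hj), Nat.cast_zero]
  have h8 : (0 : ℝ) ≤ l := ge_of_tendsto' h7 fun n => by positivity
  exact ⟨l, by exact_mod_cast h8, h7⟩

end EpsilonMultiplicity

end EpsilonDensity

namespace EpsilonDensity

/-! ### Assembly. -/

section Main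

variable {k A : Type*} [Field k] [CommRing A] [Algebra k A]
  {𝒜 : ℕ → Submodule k A} [GradedAlgebra 𝒜]

lemma IsStandardGraded.exists_isSaturatedFiltration [IsNoetherianRing A]
    (hA : IsStandardGraded 𝒜) {I : Ideal A} (hI : I.IsHomogeneous 𝒜)
    (hN : IsNoetherianFiltration fun n : ℕ => saturation 𝒜 (I ^ n)) :
    ∃ m, IsSaturatedFiltration 𝒜 (fun n => saturation 𝒜 (I ^ n)) m := by
  obtain ⟨m, hm, h⟩ := hN.noetherian
  exact ⟨m, hm, hN.zero_eq_top, antitone_nat_of_succ_le hN.succ_le, hN.mul_le, h,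
    fun n => hA.isHomogeneous_saturation (isHomogeneous_pow hI n),
    fun n => hA.saturation_saturation _⟩

lemma IsStandardGraded.gradedLength_eq_sub (hA : IsStandardGraded 𝒜) (I : Ideal A) (n j : ℕ) :
    (gradedLength 𝒜 I n j : ℝ) =
      dimPart 𝒜 (saturation 𝒜 (I ^ n)) j - dimPart 𝒜 (I ^ n) j := by
  rw [eq_sub_iff_add_eq]
  exact_mod_cast hA.quotientDimPart_add (hA.le_saturation (I ^ n)) j

lemma densitySeq_eq (d : ℕ) (I : Ideal A) (x : ℝ≥0) (n : ℕ) :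
    densitySeq 𝒜 d I x n =
      d.factorial * ((gradedLength 𝒜 I n ⌊(x : ℝ) * n⌋₊ : ℝ) / (n : ℝ) ^ (d - 1)) := by
  have h1 : ⌊x * n⌋₊ = ⌊(x : ℝ) * n⌋₊ := by
    refine eq_of_forall_le_iff fun i => ?_
    rw [Nat.le_floor_iff (by positivity), Nat.le_floor_iff (by positivity)]
    exact_mod_cast Iff.rfl
  rw [densitySeq, h1]
  field_simp

/-- The density sequences converge. -/
lemma IsStandardGraded.exists_tendsto_gradedLength [IsDomain A] (hA : IsStandardGraded 𝒜) {d : ℕ}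
    (hd : ringKrullDim A = (d : WithBot ℕ∞)) (hd1 : 1 ≤ d) {I : Ideal A} (hI : I.IsHomogeneous 𝒜)
    {m : ℕ} (hF : IsSaturatedFiltration 𝒜 (fun n => saturation 𝒜 (I ^ n)) m) {x : ℝ}
    (hx : 0 ≤ x) :
    ∃ l, Tendsto (fun n : ℕ => (gradedLength 𝒜 I n ⌊x * n⌋₊ : ℝ) / (n : ℝ) ^ (d - 1)) atTop
      (𝓝 l) := by
  by_cases h0 : I = ⊥
  · refine ⟨0, tendsto_const_nhds.congr' ?_⟩
    filter_upwards [eventually_gt_atTop 0] with n hn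
    rw [hA.gradedLength_eq_sub, h0, Ideal.bot_pow hn.ne', hA.saturation_bot hd hd1, sub_self,
      zero_div]
  · have h1 : saturation 𝒜 (I ^ m) ≠ ⊥ := fun h =>
      pow_ne_zero m (M₀ := Ideal A) h0 (eq_bot_iff.2 (h ▸ hA.le_saturation (I ^ m)))
    obtain ⟨l, hl⟩ := hF.exists_tendsto hA hd hd1 h1 hx
    obtain ⟨l', hl'⟩ := hA.exists_tendsto_pow hd hd1 hI h0 hx
    refine ⟨l - l', (hl.sub hl').congr fun n => ?_⟩
    rw [hA.gradedLength_eq_sub, sub_div]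

end Main

end EpsilonDensity

theorem corollary6 {k A : Type*} [Field k] [CommRing A] [IsDomain A] [Algebra k A]
    (𝒜 : ℕ → Submodule k A) [GradedAlgebra 𝒜] (hA : EpsilonDensity.IsStandardGraded 𝒜)
    (d : ℕ) (hd : ringKrullDim A = (d : WithBot ℕ∞)) (hd1 : 1 ≤ d)
    (I : Ideal A) (hI : I.IsHomogeneous 𝒜)
    (hN : EpsilonDensity.IsNoetherianFiltration
      (fun n : ℕ => EpsilonDensity.saturation 𝒜 (I ^ n))) :
    -- the limit defining the density function exists at every point
    (∀ x : ℝ≥0, Tendsto (EpsilonDensity.densitySeq 𝒜 d I x) atTop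
      (𝓝 (EpsilonDensity.epsilonDensity 𝒜 d I x))) ∧
    -- the density function is piecewise polynomial
    (∃ (r : ℕ) (a : Fin (r + 1) → ℚ) (q : Fin r → ℚ[X]),
      StrictMono a ∧ (∀ i, 0 ≤ a i) ∧ (∀ i, (q i).natDegree ≤ d - 1) ∧
      (∀ x : ℝ≥0, ((x : ℝ) < (a 0 : ℝ) ∨ (a (Fin.last r) : ℝ) < (x : ℝ)) →
        EpsilonDensity.epsilonDensity 𝒜 d I x = 0) ∧
      (∀ (i : Fin r) (x : ℝ≥0), (a i.castSucc : ℝ) < (x : ℝ) → (x : ℝ) < (a i.succ : ℝ) →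
        EpsilonDensity.epsilonDensity 𝒜 d I x = Polynomial.aeval (x : ℝ) (q i))) ∧
    -- the epsilon multiplicity is a limit and a rational number
    Tendsto (EpsilonDensity.epsilonSeq 𝒜 d I) atTop
      (𝓝 (EpsilonDensity.epsilonMultiplicity 𝒜 d I)) ∧
    ∃ c : ℚ, 0 ≤ c ∧ EpsilonDensity.epsilonMultiplicity 𝒜 d I = ENNReal.ofReal (c : ℝ) := by
  open EpsilonDensity in
  have := hA.finiteType
  have : IsNoetherianRing A := Algebra.FiniteType.isNoetherianRing k A
  obtain ⟨m, hF⟩ := hA.exists_isSaturatedFiltration hI hN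
  obtain ⟨c, hc⟩ := hF.exists_gradedPart_le hA fun n => le_rfl
  have hzero : ∀ᶠ n in atTop, ∀ j, c * n ≤ j → gradedLength 𝒜 I n j = 0 := by
    filter_upwards [eventually_ge_atTop m] with n hn j hj
    have h1 : gradedPart 𝒜 (saturation 𝒜 (I ^ n)) j = gradedPart 𝒜 (I ^ n) j :=
      le_antisymm (fun a ha => mem_gradedPart.2 ⟨hc n j hn hj a ha, (mem_gradedPart.1 ha).2⟩)
        fun a ha => mem_gradedPart.2
          ⟨hA.le_saturation _ (mem_gradedPart.1 ha).1, (mem_gradedPart.1 ha).2⟩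
    have h2 := hA.gradedLength_eq_sub I n j
    rw [dimPart, dimPart, h1, sub_self] at h2
    exact_mod_cast h2
  have hlim : ∀ x : ℝ≥0, Tendsto (densitySeq 𝒜 d I x) atTop (𝓝 (epsilonDensity 𝒜 d I x)) := by
    intro x
    obtain ⟨l, hl⟩ := hA.exists_tendsto_gradedLength hd hd1 hI hF x.2
    exact tendsto_nhds_limUnder
      ⟨_, (hl.const_mul (d.factorial : ℝ)).congr fun n => (densitySeq_eq d I x n).symm⟩
  have hPD : PiecewiseDensity (fun p : ℕ × ℕ => (gradedLength 𝒜 I p.1 p.2 : ℝ)) (d - 1) := by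
    simp only [hA.gradedLength_eq_sub]
    exact (hF.piecewiseDensity hA hd hd1).sub (hA.piecewiseDensity_pow hd hd1 hI)
  have hPDs : PiecewiseDensity (fun p : ℕ × ℕ =>
      ∑ j ∈ Finset.range (p.2 + 1), (gradedLength 𝒜 I p.1 j : ℝ)) d := by
    simp only [hA.gradedLength_eq_sub, Finset.sum_sub_distrib]
    exact (hF.piecewiseDensity_sum hA hd).sub (hA.piecewiseDensity_sum_pow hd hI)
  refine ⟨hlim, ?_, ?_⟩
  · obtain ⟨E, Q, h1, h2, h3, h4⟩ := hPD
    refine exists_piecewise_of_cutEval (E := E)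
      -- The factor `d!` is the normalization in `densitySeq`.
      (Q := Q.mapRange (fun q => Polynomial.C (d.factorial : ℚ) * q) (mul_zero _))
      (Finsupp.support_mapRange.trans h1) h2 (fun a => ?_) (fun x hx hxE => ?_) (c := c)
      fun x hx => ?_
    · rw [Finsupp.mapRange_apply]
      exact (Polynomial.natDegree_C_mul_le _ _).trans (h3 a)
    · have h5 := ((h4 x (by exact_mod_cast hx) hxE).tendsto_floor x.2).const_mul (d.factorial : ℝ)
      refine (tendsto_nhds_unique (hlim x) (h5.congr fun n => (densitySeq_eq d I x n).symm)).trans ?_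
      rw [cutEval, cutEval, Finsupp.sum_mapRange_index (by simp), Finsupp.sum, Finsupp.sum,
        Finset.mul_sum]
      refine Finset.sum_congr rfl fun a _ => ?_
      split_ifs <;> simp
    · refine tendsto_nhds_unique (hlim x) (tendsto_const_nhds.congr' ?_)
      filter_upwards [hzero, eventually_gt_atTop 0] with n hn hn0
      rw [densitySeq_eq, hn, Nat.cast_zero, zero_div, mul_zero]
      refine Nat.le_floor ?_
      push_cast
      gcongr
  -- For `n ≥ m` the length is the sum of the graded lengths in degrees below `c n`, so its limit is
  -- that of the cumulative sums.
  · obtain ⟨l, hl0, hl⟩ := exists_tendsto_sum hPDs hzero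
    have h1 : Tendsto (epsilonSeq 𝒜 d I) atTop (𝓝 (ENNReal.ofReal (d.factorial * l))) := by
      refine (tendsto_ennreal_div hl).congr' ?_
      filter_upwards [eventually_ge_atTop m] with n hn
      rw [epsilonSeq, hA.length_eq_sum (hF.isHomogeneous n) (isHomogeneous_pow hI n)
        (hA.le_saturation _) fun j hj => hc n j hn hj]
      rfl
    have h2 : epsilonMultiplicity 𝒜 d I = ENNReal.ofReal (d.factorial * l) := h1.limsup_eq
    refine ⟨h2 ▸ h1, d.factorial * l, by positivity, ?_⟩
    rw [h2]
    push_cast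
    rfl
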